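/- **Notation.** For $x=(x_1,x_2,x_3)\in\mathbb{R}^3$ let $r=\sqrt{x_1^2+x_2^2}$, and let $\mathcal{O}=O(2)\times\{1\}\subset O(3)$. For $m\in\{1,3\}$ let $\mathcal{D}^{1,2}(\mathbb{R}^3,\mathbb{R}^m)$ be the completion of $C_0^\infty(\mathbb{R}^3,\mathbb{R}^m)$ with respect to the norm $|\nabla\,\cdot\,|_2$ (the $L^2$-norm of the gradient), regarded as a space of functions in $L^6$ with weak gradient in $L^2$; functions are identified if they agree almost everywhere, and derivatives are weak derivatives. Put $$X=\Bigl\{u\in\mathcal{D}^{1,2}(\mathbb{R}^3):\int_{\mathbb{R}^3}\frac{|u|^2}{r^2}\,dx<\infty\Bigr\},\qquad \|u\|=\bigl(|\nabla u|_2^2+|u/r|_2^2\bigr)^{1/2},$$ let $X_{\mathcal{O}}$ be the subspace of the $\mathcal{O}$-invariant $u\in X$ (for every $g\in\mathcal{O}$, $u(gx)=u(x)$ for a.e. $x$), and let $\mathcal{D}_{\mathcal{F}}$ be the subspace of those $\mathbf{U}\in\mathcal{D}^{1,2}(\mathbb{R}^3,\mathbb{R}^3)$ with $\mathbf{U}(x)=\frac{b(x)}{r}(-x_2,x_1,0)$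 for a.e. $x$ and some $\mathcal{O}$-invariant $b\colon\mathbb{R}^3\to\mathbb{R}$. **Theorem.** Let $f\colon\mathbb{R}^3\times\mathbb{R}\to\mathbb{R}$ be a Carathéodory function (measurable in $x$ for every $u$, continuous in $u$ for a.e. $x$) that is $\mathcal{O}$-invariant and $1$-periodic in $x_3$: for every $g\in\mathcal{O}$ and every $k\in\mathbb{Z}$, $f(gx,u)=f(x,u)=f(x+(0,0,k),u)$ for a.e. $x$ and every $u$. Suppose that for some constant $C>0$, $|f(x,u)|\le C|u|^5$ for a.e. $x\in\mathbb{R}^3$ and every $u\in\mathbb{R}$. Let $h\colon\mathbb{R}^3\times\mathbb{R}^3\to\mathbb{R}^3$ be such that $h(x,\alpha w)=f(x,\alpha)w$ for a.e. $x\in\mathbb{R}^3$, every $\alpha\in\mathbb{R}$ and every $w\in\mathbb{R}^3$ with $|w|=1$. Put $F(x,u)=\int_0^u f(x,t)\,dt$, $H(x,\mathbf{U})=\int_0^1\langle h(x,t\mathbf{U}),\mathbf{U}\rangle\,dt$, $$\mathcal{J}(u)=\frac12\int_{\mathbb{R}^3}|\nabla u|^2+\frac{|u|^2}{r^2}\,dx-\int_{\mathbb{R}^3}F(x,u)\,dx\quad(u\in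 X),$$ $$\mathcal{E}(\mathbf{U})=\frac12\int_{\mathbb{R}^3}|\nabla\times\mathbf{U}|^2\,dx-\int_{\mathbb{R}^3}H(x,\mathbf{U})\,dx\quad(\mathbf{U}\in\mathcal{D}^{1,2}(\mathbb{R}^3,\mathbb{R}^3)).$$ A solution of $-\Delta u+\frac{u}{r^2}=f(x,u)$ in $\mathbb{R}^3$ means a critical point $u\in X$ of $\mathcal{J}\colon X\to\mathbb{R}$, and a solution of $\nabla\times(\nabla\times\mathbf{U})=h(x,\mathbf{U})$ in $\mathbb{R}^3$ means a critical point $\mathbf{U}\in\mathcal{D}^{1,2}(\mathbb{R}^3,\mathbb{R}^3)$ of $\mathcal{E}\colon\mathcal{D}^{1,2}(\mathbb{R}^3,\mathbb{R}^3)\to\mathbb{R}$ (that is, the functional has Fréchet derivative zero there). Let $u\colon\mathbb{R}^3\to\mathbb{R}$ and $\mathbf{U}\colon\mathbb{R}^3\to\mathbb{R}^3$ satisfy $\mathbf{U}(x)=\frac{u(x)}{r}(-x_2,x_1,0)$ for a.e. $x\in\mathbb{R}^3$. Then: 1. $\mathbf{U}\in\mathcal{D}_{\mathcal{F}}$ if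 and only if $u\in X_{\mathcal{O}}$. 2. In that case $\operatorname{div}\mathbf{U}=0$ in the sense of distributions, and $\mathcal{J}(u)=\mathcal{E}(\mathbf{U})$. 3. $u$ belongs to $X_{\mathcal{O}}$ and is a solution of $-\Delta u+\frac{u}{r^2}=f(x,u)$ if and only if $\mathbf{U}$ belongs to $\mathcal{D}_{\mathcal{F}}$ and is a solution of $\nabla\times(\nabla\times\mathbf{U})=h(x,\mathbf{U})$. -/

import Mathlib

open MeasureTheory Filter Topology

noncomputable section

namespace CurlCurl

/-- Three-dimensional Euclidean space. -/
abbrev E3 : Type := EuclideanSpace ℝ (Fin 3)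

section Sobolev

variable {F : Type*} [NormedAddCommGroup F] [NormedSpace ℝ F]

/-- The classical partial derivative `∂ᵢ φ`. -/
def partialDeriv (i : Fin 3) (φ : E3 → F) (x : E3) : F :=
  fderiv ℝ φ x (EuclideanSpace.single i 1)

/-- `φ` belongs to `C₀^∞(ℝ³, F)`: it is smooth and has compact support. -/
def IsTest (φ : E3 → F) : Prop :=
  ContDiff ℝ (⊤ : ℕ∞) φ ∧ HasCompactSupport φ

/-- `v` is a weak (distributional) partial derivative `∂ᵢ u`. -/
def IsWeakPartial (i : Fin 3) (u v : E3 → F) : Prop :=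
  LocallyIntegrable u volume ∧ LocallyIntegrable v volume ∧
    ∀ φ : E3 → ℝ, IsTest φ → ∫ x, partialDeriv i φ x • u x = -∫ x, φ x • v x

open Classical in
/-- The weak partial derivative `∂ᵢ u` (unique up to a null set); zero if there is none. -/
def weakPartial (i : Fin 3) (u : E3 → F) : E3 → F :=
  if h : ∃ v, IsWeakPartial i u v then h.choose else 0

/-- Membership in `𝒟^{1,2}(ℝ³, F)`, the completion of `C₀^∞(ℝ³, F)` for the norm `|∇φ|₂`, realised
(by the Sobolev embedding) as a space of functions in `L⁶`: the function `u ∈ L⁶` has weak partial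
derivatives in `L²`, and it is a limit of functions in `C₀^∞` for the norm `|∇ · |₂`. -/
def MemD12 (u : E3 → F) : Prop :=
  MemLp u 6 volume ∧
  (∀ i, ∃ v, IsWeakPartial i u v ∧ MemLp v 2 volume) ∧
  ∃ φ : ℕ → E3 → F, (∀ n, IsTest (φ n)) ∧
    ∀ i, Tendsto
      (fun n => eLpNorm (fun x => partialDeriv i (φ n) x - weakPartial i u x) 2 volume)
      atTop (𝓝 0)

/-- `|∇u(x)|²`, the sum of the squares of all first order partial derivatives. -/
def gradSq (u : E3 → F) (x : E3) : ℝ := ∑ i, ‖weakPartial i u x‖ ^ 2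

/-- The norm `|∇u|₂` of `𝒟^{1,2}(ℝ³, F)`. -/
def normD12 (u : E3 → F) : ℝ := Real.sqrt (∫ x, gradSq u x)

/-- `u` is a critical point of the functional `Φ` on the linear space `S` of functions with norm
`N`: the point `u` lies in `S`, and `Φ` is Fréchet differentiable at `u` with derivative `0`, i.e.
`Φ (u + v) - Φ u = o (N v)` as `N v → 0`, `v ∈ S`. -/
def IsCriticalPoint (S : Set (E3 → F)) (N : (E3 → F) → ℝ) (Φ : (E3 → F) → ℝ) (u : E3 → F) : Prop :=
  u ∈ S ∧ ∀ ε > 0, ∃ δ > 0, ∀ v ∈ S, N v < δ → |Φ (u + v) - Φ u| ≤ ε * N v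

end Sobolev

/-- The distance `r` to the `x₃`-axis. -/
def rad (x : E3) : ℝ := Real.sqrt (x 0 ^ 2 + x 1 ^ 2)

/-- The vector field `(-x₂, x₁, 0)`. -/
def rot (x : E3) : E3 := !₂[-x 1, x 0, 0]

/-- The action on `ℝ³` of the element of `𝒪 = O(2) × {1}` with upper left block `g`. -/
def act (g : Matrix.orthogonalGroup (Fin 2) ℝ) (x : E3) : E3 :=
  !₂[g.1 0 0 * x 0 + g.1 0 1 * x 1, g.1 1 0 * x 0 + g.1 1 1 * x 1, x 2]

/-- `𝒪`-invariance of a function defined up to null sets. -/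
def InvariantO (b : E3 → ℝ) : Prop :=
  ∀ g : Matrix.orthogonalGroup (Fin 2) ℝ, ∀ᵐ x : E3, b (act g x) = b x

/-! ### The scalar problem `-Δu + (a / r²) u = f(x, u)` -/

/-- The space `X` of all `u ∈ 𝒟^{1,2}(ℝ³)` with `∫ |u|² / r² < ∞`. -/
def spaceX : Set (E3 → ℝ) :=
  {u | MemD12 u ∧ Integrable (fun x => u x ^ 2 / rad x ^ 2) volume}

/-- The norm `(|∇u|₂² + |u / r|₂²)^{1/2}` of `X`. -/
def normX (u : E3 → ℝ) : ℝ :=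
  Real.sqrt ((∫ x, gradSq u x) + ∫ x, u x ^ 2 / rad x ^ 2)

/-- The subspace `X_𝒪` of the `𝒪`-invariant elements of `X`. -/
def spaceXO : Set (E3 → ℝ) := {u | u ∈ spaceX ∧ InvariantO u}

/-- The primitive `F(x, s) = ∫₀ˢ f(x, t) dt`. -/
def primF (f : E3 → ℝ → ℝ) (x : E3) (s : ℝ) : ℝ := ∫ t in (0 : ℝ)..s, f x t

/-- The energy `𝒥(u) = ½ ∫ (|∇u|² + (a / r²) |u|²) - ∫ F(x, u)`. -/
def energyJ (a : ℝ) (f : E3 → ℝ → ℝ) (u : E3 → ℝ) : ℝ :=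
  1 / 2 * (∫ x, (gradSq u x + a / rad x ^ 2 * |u x| ^ 2)) - ∫ x, primF f x (u x)

/-- A solution to the scalar equation: a critical point of `𝒥` in `X`. -/
def IsSolutionS (a : ℝ) (f : E3 → ℝ → ℝ) (u : E3 → ℝ) : Prop :=
  IsCriticalPoint spaceX normX (energyJ a f) u

/-! ### The curl-curl problem `∇ × (∇ × U) = h(x, U)` -/

/-- The space `𝒟^{1,2}(ℝ³, ℝ³)`. -/
def spaceD : Set (E3 → E3) := {U | MemD12 U}

/-- The family `ℱ` of the fields `(b / r) (-x₂, x₁, 0)` with `b` an `𝒪`-invariant function. -/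
def familyF : Set (E3 → E3) :=
  {U | ∃ b : E3 → ℝ, InvariantO b ∧ ∀ᵐ x : E3, U x = (b x / rad x) • rot x}

/-- `𝒟_ℱ = 𝒟^{1,2}(ℝ³, ℝ³) ∩ ℱ`. -/
def spaceDF : Set (E3 → E3) := spaceD ∩ familyF

/-- The weak curl `∇ × U`. -/
def curl (U : E3 → E3) (x : E3) : E3 :=
  !₂[weakPartial 1 U x 2 - weakPartial 2 U x 1,
     weakPartial 2 U x 0 - weakPartial 0 U x 2,
     weakPartial 0 U x 1 - weakPartial 1 U x 0]

/-- `div U = 0` in the sense of distributions. -/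
def DivFree (U : E3 → E3) : Prop :=
  LocallyIntegrable U volume ∧
    ∀ φ : E3 → ℝ, IsTest φ → ∫ x, ∑ i, U x i * partialDeriv i φ x = 0

/-- `H(x, V) = ∫₀¹ ⟨h(x, tV), V⟩ dt`. -/
def primH (h : E3 → E3 → E3) (x V : E3) : ℝ := ∫ t in (0 : ℝ)..1, inner ℝ (h x (t • V)) V

/-- The energy `ℰ(U) = ½ ∫ |∇ × U|² - ∫ H(x, U)`. -/
def energyE (h : E3 → E3 → E3) (U : E3 → E3) : ℝ :=
  1 / 2 * (∫ x, ‖curl U x‖ ^ 2) - ∫ x, primH h x (U x)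

/-- A solution to the curl-curl equation: a critical point of `ℰ` in `𝒟^{1,2}(ℝ³, ℝ³)`. -/
def IsSolutionV (h : E3 → E3 → E3) (U : E3 → E3) : Prop :=
  IsCriticalPoint spaceD normD12 (energyE h) U

/-- Condition (F1) for `N = 3`, `K = 2`: `f` is a Carathéodory function that is `𝒪`-invariant and
`1`-periodic in `x₃`. (Real functions on `ℝ³` are Lebesgue measurable exactly if they are
`AEMeasurable`.) -/
structure CondF1 (f : E3 → ℝ → ℝ) : Prop where
  measurable : ∀ s : ℝ, AEMeasurable (fun x => f x s) volume
  continuous : ∀ᵐ x : E3, Continuous (f x)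
  invariant : ∀ g : Matrix.orthogonalGroup (Fin 2) ℝ, ∀ᵐ x : E3, ∀ s : ℝ, f (act g x) s = f x s
  periodic : ∀ k : ℤ, ∀ᵐ x : E3, ∀ s : ℝ, f x s = f (x + EuclideanSpace.single 2 (k : ℝ)) s

end CurlCurl

end

/-! Coordinates are indexed from 0, so the axis is `x 0 = x 1 = 0`. Let `τ = rot / r` and `ρ = (x 0,
x 1, 0) / r` be the azimuthal and radial unit fields, so that `U = u τ` almost everywhere, and call
`x 0 ∂₁ - x 1 ∂₀` the angular derivative. The proof rests on one fact: an invariant locally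
integrable function integrates to zero against the angular derivative of any test function
(`integral_mul_angDeriv`), because its integral against a rotated test function does not depend on
the angle.

Spaces. Truncation and mollification show that membership in `𝒟^{1,2}` just means `u ∈ L⁶` with weak
gradient in `L²` (`HasWeakGrad.memD12`, `MemD12.hasWeakGrad`). The functions `x j / r` with `j ≠ 2`
have gradient of size `O(1 / r)`, so multiplying by them preserves this class when `u / r ∈ L²`
(`HasWeakGrad.dir_mul`); hence `u ∈ X` gives `u τ ∈ 𝒟^{1,2}`. Conversely, let `u` be invariant with
`u τ ∈ 𝒟^{1,2}`. The angular derivative of a component of `u τ` is, up to sign, the other component,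
and it is also at most `r` times the gradient. Thus `u / r` is controlled by the gradient of `U`
(`HasWeakGrad.axisL2_of_tauField`), and `u = τ · U` lies in `X`.

Energies. The divergence of `U` is the angular derivative of the invariant function `u / r`, which
is zero. For divergence free fields the curl form equals the gradient form, since mixed second order
terms can be exchanged (`integral_inner_curlOf`), and the gradient form of `u τ` is the form of `X`.
The relation between `h` and `f` forces `f` to be odd in its second variable, so `F` is even and
`H(x, U) = F(x, |U|) = F(x, u)`.

Critical points. Both energies have a first order expansion: the quadratic part is explicit and the
nonlinear part, of critical growth, is handled by `exists_remainder_le`. Hence critical points are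
the zeros of the first variations. If `V / r ∈ L²`, the variation of `ℰ` at `u τ` along `V` equals
that of `𝒥` at `u` along `τ · V` (`NonlinPair.firstE_eq`): the two differ by the integral of `u /
r²` times the angular derivative of `ρ · V`, which vanishes by invariance. Every `v ∈ X` occurs as
`τ · V`, with `V = v τ`, so no symmetric criticality principle is needed. A general `V` is reached
by density, because the axis has zero capacity (`firstE_eq_zero`). -/

noncomputable section
namespace CurlCurl

/-! ### Calculus of weak partial derivatives. -/

section Weak
variable {F : Type*} [NormedAddCommGroup F] [NormedSpace ℝ F]
variable {G : Type*} [NormedAddCommGroup G] [NormedSpace ℝ G]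

lemma IsTest.continuous {φ : E3 → F} (hφ : IsTest φ) : Continuous φ := hφ.1.continuous

lemma IsTest.differentiable {φ : E3 → F} (hφ : IsTest φ) : Differentiable ℝ φ :=
  hφ.1.differentiable (by simp)

lemma IsTest.integrable {φ : E3 → F} (hφ : IsTest φ) : Integrable φ volume :=
  hφ.continuous.integrable_of_hasCompactSupport hφ.2

lemma IsTest.memLp {φ : E3 → F} (hφ : IsTest φ) (p : ENNReal) : MemLp φ p volume :=
  hφ.continuous.memLp_of_hasCompactSupport hφ.2

lemma contDiff_partialDeriv {φ : E3 → F} (hφ : ContDiff ℝ (⊤ : ℕ∞) φ) (i : Fin 3) :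
    ContDiff ℝ (⊤ : ℕ∞) (partialDeriv i φ) := by
  unfold partialDeriv
  exact (hφ.fderiv_right (m := (⊤ : ℕ∞)) (by simp)).clm_apply contDiff_const

lemma hasCompactSupport_partialDeriv {φ : E3 → F} (hφ : HasCompactSupport φ) (i : Fin 3) :
    HasCompactSupport (partialDeriv i φ) :=
  hφ.fderiv_apply (𝕜 := ℝ) (EuclideanSpace.single i 1)

lemma IsTest.partialDeriv {φ : E3 → F} (hφ : IsTest φ) (i : Fin 3) :
    IsTest (partialDeriv i φ) :=
  ⟨contDiff_partialDeriv hφ.1 i, hasCompactSupport_partialDeriv hφ.2 i⟩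

lemma IsTest.smul_left {χ : E3 → ℝ} {φ : E3 → F} (hχ : ContDiff ℝ (⊤ : ℕ∞) χ) (hφ : IsTest φ) :
    IsTest (fun x => χ x • φ x) :=
  ⟨hχ.smul hφ.1, hφ.2.smul_left⟩

lemma IsTest.smul_right {χ : E3 → ℝ} {φ : E3 → F} (hχ : IsTest χ) (hφ : ContDiff ℝ (⊤ : ℕ∞) φ) :
    IsTest (fun x => χ x • φ x) :=
  ⟨hχ.1.smul hφ, hχ.2.smul_right⟩

lemma partialDeriv_smul {χ : E3 → ℝ} {φ : E3 → F} (i : Fin 3) {x : E3}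
    (hχ : DifferentiableAt ℝ χ x) (hφ : DifferentiableAt ℝ φ x) :
    partialDeriv i (fun x => χ x • φ x) x
      = partialDeriv i χ x • φ x + χ x • partialDeriv i φ x := by
  unfold partialDeriv
  rw [fderiv_fun_smul hχ hφ]
  simp [add_comm]

lemma partialDeriv_mul {χ φ : E3 → ℝ} (i : Fin 3) {x : E3}
    (hχ : DifferentiableAt ℝ χ x) (hφ : DifferentiableAt ℝ φ x) :
    partialDeriv i (fun x => χ x * φ x) x
      = partialDeriv i χ x * φ x + χ x * partialDeriv i φ x :=
  partialDeriv_smul i hχ hφ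

lemma IsTest.smul_integrable {φ : E3 → ℝ} (hφ : IsTest φ) {u : E3 → F}
    (hu : LocallyIntegrable u volume) : Integrable (fun x => φ x • u x) volume :=
  hu.integrable_smul_left_of_hasCompactSupport hφ.continuous hφ.2

lemma IsWeakPartial.unique [CompleteSpace F] {i : Fin 3} {u v w : E3 → F}
    (hv : IsWeakPartial i u v) (hw : IsWeakPartial i u w) : v =ᵐ[volume] w := by
  have h := ae_eq_zero_of_integral_contDiff_smul_eq_zero (μ := volume)
    (f := fun x => v x - w x) (hv.2.1.sub hw.2.1) (fun g hg hgc => by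
      have ht : IsTest g := ⟨hg, hgc⟩
      have h1 := hv.2.2 g ht
      have h2 := hw.2.2 g ht
      simp_rw [smul_sub]
      rw [integral_sub (ht.smul_integrable hv.2.1) (ht.smul_integrable hw.2.1)]
      rw [h1] at h2
      rw [neg_injective h2, sub_self])
  filter_upwards [h] with x hx
  exact sub_eq_zero.1 hx

lemma locallyIntegrable_congr {F : Type*} [NormedAddCommGroup F] {u u' : E3 → F} (hu : LocallyIntegrable u volume)
    (h : u =ᵐ[volume] u') : LocallyIntegrable u' volume := fun x => by
  obtain ⟨s, hs, hi⟩ := hu x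
  exact ⟨s, hs, hi.congr (ae_restrict_of_ae h)⟩

lemma IsWeakPartial.congr {i : Fin 3} {u v u' v' : E3 → F} (h : IsWeakPartial i u v)
    (hu : u =ᵐ[volume] u') (hv : v =ᵐ[volume] v') : IsWeakPartial i u' v' := by
  refine ⟨locallyIntegrable_congr h.1 hu, locallyIntegrable_congr h.2.1 hv, fun φ hφ => ?_⟩
  have h1 : ∫ x, CurlCurl.partialDeriv i φ x • u' x = ∫ x, CurlCurl.partialDeriv i φ x • u x :=
    integral_congr_ae (by filter_upwards [hu] with x hx; rw [hx])
  have h2 : ∫ x, φ x • v' x = ∫ x, φ x • v x :=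
    integral_congr_ae (by filter_upwards [hv] with x hx; rw [hx])
  rw [h1, h2, h.2.2 φ hφ]

lemma IsWeakPartial.add {i : Fin 3} {u v u' v' : E3 → F} (h : IsWeakPartial i u v)
    (h' : IsWeakPartial i u' v') :
    IsWeakPartial i (fun x => u x + u' x) (fun x => v x + v' x) := by
  refine ⟨h.1.add h'.1, h.2.1.add h'.2.1, fun φ hφ => ?_⟩
  simp_rw [smul_add]
  rw [integral_add ((hφ.partialDeriv i).smul_integrable h.1)
      ((hφ.partialDeriv i).smul_integrable h'.1),
    integral_add (hφ.smul_integrable h.2.1) (hφ.smul_integrable h'.2.1),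
    h.2.2 φ hφ, h'.2.2 φ hφ, neg_add]

lemma locallyIntegrable_clm (T : F →L[ℝ] G) {u : E3 → F} (hu : LocallyIntegrable u volume) :
    LocallyIntegrable (fun x => T (u x)) volume := fun x => by
  obtain ⟨s, hs, hi⟩ := hu x
  exact ⟨s, hs, T.integrable_comp hi⟩

lemma IsWeakPartial.clm [CompleteSpace F] [CompleteSpace G] (T : F →L[ℝ] G) {i : Fin 3}
    {u v : E3 → F} (h : IsWeakPartial i u v) :
    IsWeakPartial i (fun x => T (u x)) (fun x => T (v x)) := by
  refine ⟨locallyIntegrable_clm T h.1, locallyIntegrable_clm T h.2.1, fun φ hφ => ?_⟩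
  simp_rw [← map_smul]
  rw [T.integral_comp_comm ((hφ.partialDeriv i).smul_integrable h.1),
    T.integral_comp_comm (hφ.smul_integrable h.2.1), h.2.2 φ hφ, map_neg]

lemma IsWeakPartial.const_smul {i : Fin 3} {u v : E3 → F} (h : IsWeakPartial i u v) (c : ℝ) :
    IsWeakPartial i (fun x => c • u x) (fun x => c • v x) := by
  refine ⟨h.1.smul c, h.2.1.smul c, fun φ hφ => ?_⟩
  simp_rw [smul_comm _ c]
  rw [integral_smul, integral_smul, h.2.2 φ hφ, smul_neg]

lemma IsWeakPartial.sum {ι : Type*} (s : Finset ι) {i : Fin 3} {u v : ι → E3 → F}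
    (h : ∀ j ∈ s, IsWeakPartial i (u j) (v j)) :
    IsWeakPartial i (fun x => ∑ j ∈ s, u j x) (fun x => ∑ j ∈ s, v j x) := by
  classical
  induction s using Finset.induction_on with
  | empty =>
    simp only [Finset.sum_empty]
    exact ⟨locallyIntegrable_const 0, locallyIntegrable_const 0, fun φ hφ => by simp⟩
  | insert a s ha ih =>
    simp only [Finset.sum_insert ha]
    exact (h a (by simp)).add (ih fun j hj => h j (by simp [hj]))

lemma isWeakPartial_of_contDiff [CompleteSpace F] {ψ : E3 → F} (hψ : ContDiff ℝ (⊤ : ℕ∞) ψ)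
    (i : Fin 3) : IsWeakPartial i ψ (partialDeriv i ψ) := by
  refine ⟨hψ.continuous.locallyIntegrable,
    (contDiff_partialDeriv hψ i).continuous.locallyIntegrable, fun φ hφ => ?_⟩
  have := integral_smul_fderiv_eq_neg_fderiv_smul_of_integrable (𝕜 := ℝ) (μ := volume)
    (f := φ) (g := ψ) (v := EuclideanSpace.single i 1)
    ((hφ.partialDeriv i).smul_integrable hψ.continuous.locallyIntegrable)
    (hφ.smul_integrable (contDiff_partialDeriv hψ i).continuous.locallyIntegrable)
    (hφ.smul_integrable hψ.continuous.locallyIntegrable)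
    (fun x _ => hφ.differentiable x) (fun x _ => hψ.differentiable (by simp) x)
  rw [show (∫ x, φ x • CurlCurl.partialDeriv i ψ x) = -∫ x, CurlCurl.partialDeriv i φ x • ψ x
    from this, neg_neg]

lemma locallyIntegrable_continuous_smul {χ : E3 → ℝ} {u : E3 → F} (hχ : Continuous χ)
    (hu : LocallyIntegrable u volume) : LocallyIntegrable (fun x => χ x • u x) volume := by
  rw [← locallyIntegrableOn_univ] at hu ⊢
  exact hu.continuousOn_smul isOpen_univ.isLocallyClosed hχ.continuousOn

/-- The product of a smooth `χ` with a test function is again a test function; inserting it into the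
definition of the weak derivative gives the Leibniz rule. -/
lemma IsWeakPartial.smooth_smul {χ : E3 → ℝ} {i : Fin 3} {u v : E3 → F}
    (hχ : ContDiff ℝ (⊤ : ℕ∞) χ) (h : IsWeakPartial i u v) :
    IsWeakPartial i (fun x => χ x • u x) (fun x => partialDeriv i χ x • u x + χ x • v x) := by
  have l1 := locallyIntegrable_continuous_smul (contDiff_partialDeriv hχ i).continuous h.1
  have l2 := locallyIntegrable_continuous_smul hχ.continuous h.2.1
  have l3 := locallyIntegrable_continuous_smul hχ.continuous h.1
  refine ⟨l3, l1.add l2, fun φ hφ => ?_⟩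
  have ht : IsTest (fun x => χ x • φ x) := hφ.smul_left hχ
  have key := h.2.2 _ ht
  have e1 : ∀ x, CurlCurl.partialDeriv i (fun x => χ x • φ x) x • u x
      = φ x • CurlCurl.partialDeriv i χ x • u x + CurlCurl.partialDeriv i φ x • χ x • u x := by
    intro x
    rw [partialDeriv_smul i (hχ.differentiable (by simp) x) (hφ.differentiable x), add_smul]
    simp only [smul_smul, smul_eq_mul, mul_comm]
  simp_rw [e1] at key
  rw [integral_add (hφ.smul_integrable l1) ((hφ.partialDeriv i).smul_integrable l3)] at key
  simp_rw [smul_add]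
  rw [integral_add (hφ.smul_integrable l1) (hφ.smul_integrable l2)]
  have e2 : ∫ x, (χ x • φ x) • v x = ∫ x, φ x • χ x • v x := by
    congr 1; ext x; rw [smul_smul, smul_eq_mul, mul_comm]
  rw [e2] at key
  rw [neg_add, ← key]; abel

/-- `weakPartial` is picked by choice; this is what lets an explicit weak derivative stand in for it
almost everywhere. -/
lemma IsWeakPartial.weakPartial [CompleteSpace F] {i : Fin 3} {u v : E3 → F}
    (h : IsWeakPartial i u v) : weakPartial i u =ᵐ[volume] v := by
  have hex : ∃ v, IsWeakPartial i u v := ⟨v, h⟩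
  unfold CurlCurl.weakPartial
  rw [dif_pos hex]
  exact hex.choose_spec.unique h

lemma isWeakPartial_pi {i : Fin 3} {U V : E3 → E3}
    (h : ∀ j, IsWeakPartial i (fun x => U x j) (fun x => V x j)) : IsWeakPartial i U V := by
  have := IsWeakPartial.sum Finset.univ (i := i)
    (u := fun (j : Fin 3) x => U x j • (EuclideanSpace.single j 1 : E3))
    (v := fun (j : Fin 3) x => V x j • (EuclideanSpace.single j 1 : E3))
    (fun j _ => (h j).clm ((ContinuousLinearMap.id ℝ ℝ).smulRight (EuclideanSpace.single j 1 : E3)))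
  have key : ∀ W : E3, ∑ j, W j • (EuclideanSpace.single j 1 : E3) = W := by
    intro W
    ext k
    fin_cases k <;> simp [Fin.sum_univ_three]
  simpa only [key] using this

lemma IsWeakPartial.apply {i : Fin 3} {U V : E3 → E3} (h : IsWeakPartial i U V) (j : Fin 3) :
    IsWeakPartial i (fun x => U x j) (fun x => V x j) :=
  h.clm (EuclideanSpace.proj j : E3 →L[ℝ] ℝ)

end Weak

/-! ### Mollification in `L^p`. -/

section Mollify
open scoped Convolution ENNReal NNReal
open ContinuousLinearMap (lsmul)

variable {F : Type*} [NormedAddCommGroup F] [NormedSpace ℝ F]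

/-- A weighted mean is bounded in every `L^p`: Young's inequality for a probability density. -/
lemma eLpNorm_convolution_le {ρ : E3 → ℝ} (hρc : Continuous ρ) (hρ0 : ∀ x, 0 ≤ ρ x)
    (hρi : Integrable ρ volume) (hρ1 : ∫ x, ρ x = 1) {w : E3 → F}
    (hw : AEStronglyMeasurable w volume) {p : ℝ≥0} (hp : 1 ≤ p) :
    eLpNorm (ρ ⋆[lsmul ℝ ℝ, volume] w) p volume ≤ eLpNorm w p volume := by
  have hp0 : p ≠ 0 := (zero_lt_one.trans_le hp).ne'
  have hp0' : (0 : ℝ) < p := by exact_mod_cast zero_lt_one.trans_le hp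
  -- Against the probability measure with density `ρ`, the `L¹` norm is at most the `L^p` norm. This
  -- replaces Jensen's inequality; Tonelli and translation invariance then finish.
  set ν : Measure E3 := volume.withDensity (fun t => ENNReal.ofReal (ρ t)) with hν
  have hm : Measurable fun t => ENNReal.ofReal (ρ t) :=
    ENNReal.measurable_ofReal.comp hρc.measurable
  have hνp : IsProbabilityMeasure ν := by
    constructor
    rw [hν, withDensity_apply _ MeasurableSet.univ, Measure.restrict_univ,
      ← ofReal_integral_eq_lintegral_ofReal hρi (ae_of_all _ hρ0), hρ1, ENNReal.ofReal_one]
  have hνac : ν ≪ volume := withDensity_absolutelyContinuous _ _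
  have hpt : ∀ x, ‖(ρ ⋆[lsmul ℝ ℝ, volume] w) x‖ₑ ^ (p : ℝ)
      ≤ ∫⁻ t, ENNReal.ofReal (ρ t) * ‖w (x - t)‖ₑ ^ (p : ℝ) := by
    intro x
    have hwx : AEStronglyMeasurable (fun t => w (x - t)) volume :=
      hw.comp_quasiMeasurePreserving (quasiMeasurePreserving_sub_left volume x)
    have h1 : ‖(ρ ⋆[lsmul ℝ ℝ, volume] w) x‖ₑ ≤ ∫⁻ t, ‖w (x - t)‖ₑ ∂ν := by
      rw [hν, lintegral_withDensity_eq_lintegral_mul₀ hm.aemeasurable hwx.enorm]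
      refine (enorm_integral_le_lintegral_enorm _).trans (lintegral_mono fun t => ?_)
      simp [enorm_smul, Real.enorm_eq_ofReal (hρ0 t)]
    have h2 : ∫⁻ t, ‖w (x - t)‖ₑ ∂ν ≤ eLpNorm (fun t => w (x - t)) p ν := by
      rw [← eLpNorm_one_eq_lintegral_enorm]
      exact eLpNorm_le_eLpNorm_of_exponent_le (by exact_mod_cast hp) (hwx.mono_ac hνac)
    calc _ ≤ eLpNorm (fun t => w (x - t)) p ν ^ (p : ℝ) := by gcongr; exact h1.trans h2
      _ = _ := by
        rw [eLpNorm_nnreal_pow_eq_lintegral hp0, hν,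
          lintegral_withDensity_eq_lintegral_mul₀ hm.aemeasurable (hwx.enorm.pow_const _)]
        rfl
  rw [← ENNReal.rpow_le_rpow_iff hp0', eLpNorm_nnreal_pow_eq_lintegral hp0,
    eLpNorm_nnreal_pow_eq_lintegral hp0]
  refine (lintegral_mono hpt).trans ?_
  have hmeas : AEMeasurable (Function.uncurry fun x t : E3 =>
      ENNReal.ofReal (ρ t) * ‖w (x - t)‖ₑ ^ (p : ℝ)) (volume.prod volume) := by
    have h3 : AEStronglyMeasurable (fun q : E3 × E3 => w (q.1 - q.2)) (volume.prod volume) :=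
      hw.comp_quasiMeasurePreserving (quasiMeasurePreserving_sub volume volume)
    exact (hm.comp measurable_snd).aemeasurable.mul (h3.enorm.pow_const _)
  rw [lintegral_lintegral_swap hmeas]
  have h4 : ∀ t, ∫⁻ x, ENNReal.ofReal (ρ t) * ‖w (x - t)‖ₑ ^ (p : ℝ)
      = ENNReal.ofReal (ρ t) * ∫⁻ x, ‖w x‖ₑ ^ (p : ℝ) := by
    intro t
    rw [lintegral_const_mul' _ _ ENNReal.ofReal_ne_top,
      lintegral_sub_right_eq_self (fun x => ‖w x‖ₑ ^ (p : ℝ)) t]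
  simp_rw [h4]
  rw [lintegral_mul_const _ hm, ← ofReal_integral_eq_lintegral_ofReal hρi (ae_of_all _ hρ0), hρ1,
    ENNReal.ofReal_one, one_mul]

/-- A sequence of bump functions shrinking to the origin. -/
def shrinkingBump (n : ℕ) : ContDiffBump (0 : E3) where
  rIn := 1 / (n + 2)
  rOut := 1 / (n + 1)
  rIn_pos := by positivity
  rIn_lt_rOut := by gcongr; norm_num

/-- The mollification at scale `1 / (n + 1)`. -/
def mollify (n : ℕ) (w : E3 → F) : E3 → F :=
  (shrinkingBump n).normed volume ⋆[lsmul ℝ ℝ, volume] w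

lemma isTest_shrinkingBump (n : ℕ) : IsTest ((shrinkingBump n).normed volume) :=
  ⟨(shrinkingBump n).contDiff_normed, (shrinkingBump n).hasCompactSupport_normed⟩

lemma mollify_apply (n : ℕ) (w : E3 → F) (x : E3) :
    mollify n w x = ∫ y, (shrinkingBump n).normed volume (x - y) • w y := by
  unfold mollify
  rw [convolution_def, ← integral_sub_left_eq_self _ volume x]
  simp

lemma eLpNorm_mollify_le (n : ℕ) {w : E3 → F}
    (hw : AEStronglyMeasurable w volume) {p : ℝ≥0} (hp : 1 ≤ p) :
    eLpNorm (mollify n w) p volume ≤ eLpNorm w p volume :=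
  eLpNorm_convolution_le (isTest_shrinkingBump n).continuous
    (shrinkingBump n).nonneg_normed (isTest_shrinkingBump n).integrable
    (shrinkingBump n).integral_normed hw hp

lemma mollify_sub (n : ℕ) {w z : E3 → F} (hw : LocallyIntegrable w volume)
    (hz : LocallyIntegrable z volume) (x : E3) :
    mollify n (w - z) x = mollify n w x - mollify n z x := by
  have ht : IsTest (fun y => (shrinkingBump n).normed volume (x - y)) :=
    ⟨(isTest_shrinkingBump n).1.comp (contDiff_const.sub contDiff_id),
      (isTest_shrinkingBump n).2.comp_homeomorph (Homeomorph.subLeft x)⟩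
  simp_rw [mollify_apply, Pi.sub_apply, smul_sub]
  exact integral_sub (ht.smul_integrable hw) (ht.smul_integrable hz)

lemma contDiff_mollify [CompleteSpace F] (n : ℕ) {w : E3 → F} (hw : LocallyIntegrable w volume) :
    ContDiff ℝ (⊤ : ℕ∞) (mollify n w) :=
  (isTest_shrinkingBump n).2.contDiff_convolution_left _ (isTest_shrinkingBump n).1 hw

lemma isTest_mollify [CompleteSpace F] (n : ℕ) {w : E3 → F} (hw : LocallyIntegrable w volume)
    (hc : HasCompactSupport w) : IsTest (mollify n w) :=
  ⟨contDiff_mollify n hw, (isTest_shrinkingBump n).2.convolution _ hc⟩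

/-- The derivative first falls on the kernel. Since `y ↦ ρ (x - y)` is a test function, the
definition of the weak derivative moves it over to `w`. -/
lemma partialDeriv_mollify [CompleteSpace F] (n : ℕ) {i : Fin 3} {w v : E3 → F}
    (h : IsWeakPartial i w v) (x : E3) :
    partialDeriv i (mollify n w) x = mollify n v x := by
  set ρ := (shrinkingBump n).normed (volume : Measure E3) with hρ
  have hρt : IsTest ρ := isTest_shrinkingBump n
  have ht : IsTest (fun y => ρ (x - y)) :=
    ⟨hρt.1.comp (contDiff_const.sub contDiff_id), hρt.2.comp_homeomorph (Homeomorph.subLeft x)⟩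
  have hd : ∀ y, partialDeriv i (fun y => ρ (x - y)) y = - partialDeriv i ρ (x - y) := by
    intro y
    unfold partialDeriv
    have h0 : HasFDerivAt (fun y : E3 => x - y) (-ContinuousLinearMap.id ℝ E3) y :=
      (hasFDerivAt_id y).const_sub x
    have h1 := ((hρt.differentiable (x - y)).hasFDerivAt.comp y h0).fderiv
    rw [show (fun y => ρ (x - y)) = ρ ∘ fun y => x - y from rfl, h1]
    simp
  have h1 := hρt.2.hasFDerivAt_convolution_left (lsmul ℝ ℝ) (hρt.1.of_le (by simp)) h.1 x
  have h2 : partialDeriv i (mollify n w) x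
      = ∫ t, partialDeriv i ρ t • w (x - t) := by
    unfold partialDeriv mollify
    rw [h1.fderiv]
    have hf : HasCompactSupport (fderiv ℝ ρ) := hρt.2.fderiv (𝕜 := ℝ)
    have hcont : Continuous (fderiv ℝ ρ) := hρt.1.continuous_fderiv (by simp)
    have hex : ConvolutionExistsAt (fderiv ℝ ρ) w x ((lsmul ℝ ℝ).precompL E3) volume :=
      hf.convolutionExists_left _ hcont h.1 x
    rw [convolution_def, ContinuousLinearMap.integral_apply hex]
    rfl
  rw [h2, ← integral_sub_left_eq_self _ volume x]
  simp only [sub_sub_cancel]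
  rw [mollify_apply, ← neg_inj, ← h.2.2 _ ht, ← integral_neg]
  simp_rw [hd, neg_smul]

lemma tendsto_rOut_shrinkingBump :
    Tendsto (fun n => (shrinkingBump n).rOut) atTop (𝓝 0) :=
  tendsto_one_div_add_atTop_nhds_zero_nat

/-- Uniform continuity makes the difference uniformly small, and since every mollification radius is
at most one, all the functions live in one ball of finite volume. -/
lemma tendsto_eLpNorm_mollify_of_isTest [CompleteSpace F] {g : E3 → F} (hg : IsTest g) {p : ℝ≥0}
    (hp : 1 ≤ p) :
    Tendsto (fun n => eLpNorm (fun x => mollify n g x - g x) p volume) atTop (𝓝 0) := by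
  obtain ⟨R, hR⟩ := hg.2.isCompact.isBounded.subset_closedBall (0 : E3)
  set K : Set E3 := Metric.closedBall 0 (R + 1) with hK
  have hKfin : volume K ≠ ∞ := measure_closedBall_lt_top.ne
  have hsupp : ∀ n, Function.support (mollify n g) ⊆ K := by
    intro n
    refine (support_convolution_subset _).trans ?_
    rintro _ ⟨a, ha, b, hb, rfl⟩
    rw [(shrinkingBump n).support_normed_eq, mem_ball_zero_iff] at ha
    have hb' := hR (subset_tsupport g hb)
    rw [mem_closedBall_zero_iff] at hb'
    rw [hK, mem_closedBall_zero_iff]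
    have : (shrinkingBump n).rOut ≤ 1 := by
      show (1 : ℝ) / (n + 1) ≤ 1
      rw [div_le_one (by positivity)]; linarith [Nat.cast_nonneg (α := ℝ) n]
    linarith [norm_add_le a b]
  have hsupp' : Function.support g ⊆ K := by
    refine (subset_tsupport g).trans (hR.trans (Metric.closedBall_subset_closedBall (by linarith)))
  have huc : UniformContinuous g := hg.2.uniformContinuous_of_continuous hg.continuous
  have hlim : Tendsto (fun δ : ℝ => ENNReal.ofReal δ * volume K ^ (1 / (p : ℝ))) (𝓝[>] 0) (𝓝 0) := by
    have h0 : Tendsto (fun δ : ℝ => ENNReal.ofReal δ) (𝓝[>] 0) (𝓝 0) := by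
      have := (ENNReal.continuous_ofReal.tendsto 0).mono_left (nhdsWithin_le_nhds (s := Set.Ioi 0))
      simpa using this
    have := ENNReal.Tendsto.mul_const (b := volume K ^ (1 / (p : ℝ))) h0
      (Or.inr (ENNReal.rpow_ne_top_of_nonneg (by positivity) hKfin))
    simpa using this
  rw [ENNReal.tendsto_nhds_zero]
  intro ε hε
  obtain ⟨δ, hδε, hδ⟩ := ((hlim.eventually_lt_const hε).and self_mem_nhdsWithin).exists
  obtain ⟨η, hη, hη'⟩ := Metric.uniformContinuous_iff.1 huc δ hδ
  filter_upwards [tendsto_rOut_shrinkingBump.eventually_lt_const hη] with n hn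
  refine le_trans ?_ hδε.le
  have hb : ∀ x, dist (mollify n g x) (g x) ≤ δ := fun x =>
    ContDiffBump.dist_normed_convolution_le hg.continuous.aestronglyMeasurable
      (fun y hy => (hη' (lt_trans (Metric.mem_ball.1 hy) hn)).le)
  have := eLpNorm_sub_le_of_dist_bdd volume (p := p) (by simp) (s := K)
    Metric.isClosed_closedBall.measurableSet (f := mollify n g) (g := g) (le_of_lt hδ) hb (hsupp n) hsupp'
  exact this.trans (le_of_eq (by simp))

/-- Density argument: approximate by a test function and use that mollification does not increase
the `L^p` norm. -/
lemma tendsto_eLpNorm_mollify [CompleteSpace F] {w : E3 → F} {p : ℝ≥0}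
    (hp : 1 ≤ p) (hw : MemLp w p volume) :
    Tendsto (fun n => eLpNorm (fun x => mollify n w x - w x) p volume) atTop (𝓝 0) := by
  have hp' : (1 : ℝ≥0∞) ≤ p := by exact_mod_cast hp
  rw [ENNReal.tendsto_nhds_zero]
  intro ε hε
  obtain ⟨δ, hδ0, hδ⟩ : ∃ δ : ℝ, 0 < δ ∧ 3 * ENNReal.ofReal δ ≤ ε := by
    rcases eq_or_ne ε ∞ with rfl | hε'
    · exact ⟨1, one_pos, le_top⟩
    · refine ⟨ε.toReal / 3, div_pos (ENNReal.toReal_pos hε.ne' hε') (by norm_num), ?_⟩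
      rw [show (3 : ℝ≥0∞) = ENNReal.ofReal 3 by simp, ← ENNReal.ofReal_mul (by norm_num),
        mul_div_cancel₀ _ (by norm_num), ENNReal.ofReal_toReal hε']
  obtain ⟨g, hgc, hgs, hgw⟩ := hw.exist_eLpNorm_sub_le (by simp) hp' hδ0
  have hg : IsTest g := ⟨hgs, hgc⟩
  have hgm : MemLp g p volume := hg.memLp p
  have hwl : LocallyIntegrable w volume := hw.locallyIntegrable hp'
  filter_upwards [(ENNReal.tendsto_nhds_zero.1 (tendsto_eLpNorm_mollify_of_isTest hg hp))
    (ENNReal.ofReal δ) (by simpa using hδ0)] with n hn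
  have hgl := hg.continuous.locallyIntegrable (μ := volume)
  have hdec : (fun x => mollify n w x - w x)
      = (mollify n (w - g) + fun x => mollify n g x - g x) + (g - w) := by
    ext x
    simp [mollify_sub n hwl hgl]
  have hm1 : AEStronglyMeasurable (mollify n (w - g)) volume :=
    (contDiff_mollify n (hwl.sub hgl)).continuous.aestronglyMeasurable
  have hm2 : AEStronglyMeasurable (fun x => mollify n g x - g x) volume :=
    ((contDiff_mollify n hgl).continuous.sub hg.continuous).aestronglyMeasurable
  have hgw' : eLpNorm (g - w) p volume ≤ ENNReal.ofReal δ := by rwa [eLpNorm_sub_comm]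
  rw [hdec]
  calc _ ≤ eLpNorm (mollify n (w - g)) p volume + eLpNorm (fun x => mollify n g x - g x) p volume
        + eLpNorm (g - w) p volume :=
      (eLpNorm_add_le (hm1.add hm2) (hgm.sub hw).1 hp').trans
        (by gcongr; exact eLpNorm_add_le hm1 hm2 hp')
    _ ≤ ENNReal.ofReal δ + ENNReal.ofReal δ + ENNReal.ofReal δ := by
      gcongr
      exact (eLpNorm_mollify_le n (hw.sub hgm).1 hp).trans hgw
    _ = 3 * ENNReal.ofReal δ := by ring
    _ ≤ ε := hδ

end Mollify

/-! ### Density of test functions and the Sobolev inequality. -/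

section Density
open scoped ENNReal NNReal

variable {F : Type*} [NormedAddCommGroup F]

lemma tendsto_eLpNorm_of_dominated {f : ℕ → E3 → F} {g : E3 → ℝ} {p : ℝ≥0} (hp : p ≠ 0)
    (hg : MemLp g p volume) (hf : ∀ n, AEStronglyMeasurable (f n) volume)
    (hb : ∀ n, ∀ᵐ x, ‖f n x‖ ≤ ‖g x‖)
    (hlim : ∀ᵐ x, Tendsto (fun n => f n x) atTop (𝓝 0)) :
    Tendsto (fun n => eLpNorm (f n) p volume) atTop (𝓝 0) := by
  have hp0 : (0 : ℝ) < p := by exact_mod_cast pos_iff_ne_zero.2 hp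
  have hfin : ∫⁻ x, ‖g x‖ₑ ^ (p : ℝ) ≠ ∞ := by
    rw [← eLpNorm_nnreal_pow_eq_lintegral hp]
    exact ENNReal.rpow_ne_top_of_nonneg hp0.le hg.eLpNorm_ne_top
  have key : Tendsto (fun n => ∫⁻ x, ‖f n x‖ₑ ^ (p : ℝ)) atTop (𝓝 (∫⁻ _ : E3, 0)) := by
    refine tendsto_lintegral_of_dominated_convergence' (fun x => ‖g x‖ₑ ^ (p : ℝ))
      (fun n => (hf n).enorm.pow_const _) (fun n => ?_) hfin ?_
    · filter_upwards [hb n] with x hx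
      gcongr
      exact enorm_le_iff_norm_le.2 hx
    · filter_upwards [hlim] with x hx
      have h1 : Tendsto (fun n => ‖f n x‖ₑ) atTop (𝓝 0) := by simpa using hx.enorm
      have h2 := (ENNReal.continuous_rpow_const (y := (p : ℝ))).tendsto 0 |>.comp h1
      simpa [Function.comp_def, ENNReal.zero_rpow_of_pos hp0] using h2
  rw [lintegral_zero] at key
  have h3 := (ENNReal.continuous_rpow_const (y := (p : ℝ)⁻¹)).tendsto 0 |>.comp key
  rw [ENNReal.zero_rpow_of_pos (inv_pos.2 hp0)] at h3
  refine h3.congr fun n => ?_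
  simp only [Function.comp]
  rw [← eLpNorm_nnreal_pow_eq_lintegral hp, ← ENNReal.rpow_mul, mul_inv_cancel₀ hp0.ne',
    ENNReal.rpow_one]

/-- A bump function equal to one on the unit ball. -/
def unitBump : ContDiffBump (0 : E3) where
  rIn := 1
  rOut := 2
  rIn_pos := one_pos
  rIn_lt_rOut := one_lt_two

/-- The cutoff function at scale `n + 1`. -/
def cutoff (n : ℕ) (x : E3) : ℝ := unitBump (((n : ℝ) + 1)⁻¹ • x)

lemma isTest_unitBump : IsTest (unitBump : E3 → ℝ) :=
  ⟨unitBump.contDiff, unitBump.hasCompactSupport⟩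

lemma isTest_cutoff (n : ℕ) : IsTest (cutoff n) := by
  refine ⟨isTest_unitBump.1.comp (contDiff_const_smul _), ?_⟩
  exact isTest_unitBump.2.comp_homeomorph
    (Homeomorph.smulOfNeZero (((n : ℝ) + 1)⁻¹) (by positivity))

lemma cutoff_nonneg (n : ℕ) (x : E3) : 0 ≤ cutoff n x := unitBump.nonneg
lemma cutoff_le_one (n : ℕ) (x : E3) : cutoff n x ≤ 1 := unitBump.le_one

lemma cutoff_eq_one (n : ℕ) {x : E3} (hx : ‖x‖ ≤ n + 1) : cutoff n x = 1 := by
  refine unitBump.one_of_mem_closedBall ?_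
  rw [mem_closedBall_zero_iff, norm_smul, norm_inv, Real.norm_of_nonneg (by positivity)]
  show _ ≤ (1 : ℝ)
  rw [inv_mul_le_iff₀ (by positivity), mul_one]
  exact hx

lemma partialDeriv_cutoff (n : ℕ) (i : Fin 3) (x : E3) :
    partialDeriv i (cutoff n) x
      = ((n : ℝ) + 1)⁻¹ * partialDeriv i unitBump (((n : ℝ) + 1)⁻¹ • x) := by
  unfold partialDeriv cutoff
  have h0 : HasFDerivAt (fun y : E3 => ((n : ℝ) + 1)⁻¹ • y)
      (((n : ℝ) + 1)⁻¹ • ContinuousLinearMap.id ℝ E3) x :=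
    (hasFDerivAt_id x).const_smul (((n : ℝ) + 1)⁻¹)
  have h1 := ((isTest_unitBump.differentiable (((n : ℝ) + 1)⁻¹ • x)).hasFDerivAt.comp x h0).fderiv
  rw [show (fun x => unitBump (((n : ℝ) + 1)⁻¹ • x))
    = (unitBump : E3 → ℝ) ∘ fun y => ((n : ℝ) + 1)⁻¹ • y from rfl, h1]
  simp

lemma partialDeriv_cutoff_eq_zero (n : ℕ) (i : Fin 3) {x : E3} (hx : ‖x‖ < n + 1) :
    partialDeriv i (cutoff n) x = 0 := by
  have : cutoff n =ᶠ[𝓝 x] fun _ => 1 := by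
    filter_upwards [Metric.isOpen_ball.mem_nhds (mem_ball_zero_iff.2 hx)] with y hy
    exact cutoff_eq_one n (mem_ball_zero_iff.1 hy).le
  unfold partialDeriv
  rw [this.fderiv_eq]
  simp

/-- The cutoff functions have a scale invariant gradient bound in `L³`. -/
lemma eLpNorm_partialDeriv_cutoff (n : ℕ) (i : Fin 3) :
    eLpNorm (partialDeriv i (cutoff n)) 3 volume = eLpNorm (partialDeriv i unitBump) 3 volume := by
  have hc : (0 : ℝ) < ((n : ℝ) + 1)⁻¹ := by positivity
  set c : ℝ := ((n : ℝ) + 1)⁻¹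
  have h3 : (0 : ℝ) < 3 := by norm_num
  refine ENNReal.rpow_left_injective h3.ne' ?_
  simp only
  rw [show (3 : ℝ≥0∞) = ((3 : ℝ≥0) : ℝ≥0∞) by simp]
  have e := fun f : E3 → ℝ => eLpNorm_nnreal_pow_eq_lintegral (μ := volume) (f := f) (p := 3)
    (by norm_num)
  simp only [NNReal.coe_ofNat] at e
  rw [e, e]
  have hm : Measurable fun x : E3 => ‖partialDeriv i unitBump x‖ₑ ^ (3 : ℝ) :=
    ((isTest_unitBump.partialDeriv i).continuous.measurable.enorm).pow_const _
  -- Scaling in dimension three produces the Jacobian `c⁻³`, which cancels the factor `c³` that the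
  -- chain rule gives for the cube of the gradient.
  have h1 := lintegral_map (μ := volume) hm (measurable_const_smul c)
  rw [Measure.map_addHaar_smul volume hc.ne', lintegral_smul_measure] at h1
  simp only [finrank_euclideanSpace, Fintype.card_fin] at h1
  have h2 : ∀ x, ‖partialDeriv i (cutoff n) x‖ₑ ^ (3 : ℝ)
      = ENNReal.ofReal (c ^ 3) * ‖partialDeriv i unitBump (c • x)‖ₑ ^ (3 : ℝ) := by
    intro x
    rw [partialDeriv_cutoff, enorm_mul, ENNReal.mul_rpow_of_nonneg _ _ h3.le,
      Real.enorm_eq_ofReal hc.le, ENNReal.ofReal_rpow_of_pos hc, Real.rpow_ofNat]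
  simp_rw [h2]
  rw [lintegral_const_mul' _ _ ENNReal.ofReal_ne_top, ← h1, smul_eq_mul, ← mul_assoc,
    ← ENNReal.ofReal_mul (by positivity), abs_of_pos (by positivity), mul_inv_cancel₀
      (by positivity), ENNReal.ofReal_one, one_mul]

lemma tendsto_eLpNorm_add_zero {p : ℝ≥0∞} (hp : 1 ≤ p) {f g : ℕ → E3 → F}
    (hf : ∀ n, AEStronglyMeasurable (f n) volume) (hg : ∀ n, AEStronglyMeasurable (g n) volume)
    (hf0 : Tendsto (fun n => eLpNorm (f n) p volume) atTop (𝓝 0))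
    (hg0 : Tendsto (fun n => eLpNorm (g n) p volume) atTop (𝓝 0)) :
    Tendsto (fun n => eLpNorm (fun x => f n x + g n x) p volume) atTop (𝓝 0) := by
  have := hf0.add hg0
  rw [add_zero] at this
  exact tendsto_of_tendsto_of_tendsto_of_le_of_le tendsto_const_nhds this
    (fun _ => zero_le) fun n => eLpNorm_add_le (hf n) (hg n) hp

variable [NormedSpace ℝ F]

/-- `u ∈ L⁶` has the weak gradient `v ∈ L²`. -/
def HasWeakGrad (u : E3 → F) (v : Fin 3 → E3 → F) : Prop :=
  MemLp u 6 volume ∧ ∀ i, IsWeakPartial i u (v i) ∧ MemLp (v i) 2 volume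

/-- Hölder pairing of the cutoff gradients in `L³` with functions in `L⁶`, landing in `L²`. -/
instance holderTriple_three_six_two : ENNReal.HolderTriple 3 6 2 where
  inv_add_inv_eq_inv := by
    rw [← ENNReal.toReal_eq_toReal_iff' (by simp) (by simp), ENNReal.toReal_add (by simp) (by simp)]
    norm_num

lemma tendsto_cutoff (x : E3) : ∀ᶠ n : ℕ in atTop, ‖x‖ < n + 1 := by
  filter_upwards [eventually_gt_atTop ⌈‖x‖⌉₊] with n hn
  exact (Nat.lt_of_ceil_lt hn).trans (lt_add_one _)

lemma tendsto_eLpNorm_cutoff_smul {w : E3 → F} {p : ℝ≥0} (hp : p ≠ 0) (hw : MemLp w p volume) :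
    Tendsto (fun n => eLpNorm (fun x => cutoff n x • w x - w x) p volume) atTop (𝓝 0) := by
  refine tendsto_eLpNorm_of_dominated hp hw.norm (fun n => ?_) (fun n => ae_of_all _ fun x => ?_)
    (ae_of_all _ fun x => ?_)
  · exact ((isTest_cutoff n).continuous.aestronglyMeasurable.smul hw.1).sub hw.1
  · have : cutoff n x • w x - w x = (cutoff n x - 1) • w x := by rw [sub_smul, one_smul]
    rw [this, norm_smul, norm_norm]
    refine mul_le_of_le_one_left (norm_nonneg _) ?_
    rw [Real.norm_eq_abs, abs_le]
    constructor <;> linarith [cutoff_nonneg n x, cutoff_le_one n x]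
  · refine tendsto_const_nhds.congr' ?_
    filter_upwards [tendsto_cutoff x] with n hn
    rw [cutoff_eq_one n hn.le]; simp

/-- The gradient of the cutoff vanishes for `‖x‖ < n + 1`, so only the tail of `w` in `L⁶` matters;
that tail tends to zero while the `L³` norm of the gradient stays fixed. -/
lemma tendsto_eLpNorm_partialDeriv_cutoff_smul {w : E3 → F} (i : Fin 3)
    (hw : MemLp w 6 volume) :
    Tendsto (fun n => eLpNorm (fun x => partialDeriv i (cutoff n) x • w x) 2 volume)
      atTop (𝓝 0) := by
  set t : ℕ → E3 → F := fun n => Set.indicator {x | (n : ℝ) + 1 ≤ ‖x‖} w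
  have hms : ∀ n : ℕ, MeasurableSet {x : E3 | (n : ℝ) + 1 ≤ ‖x‖} := fun n =>
    measurableSet_le measurable_const measurable_norm
  have htm : ∀ n, AEStronglyMeasurable (t n) volume := fun n => hw.1.indicator (hms n)
  have ht : Tendsto (fun n => eLpNorm (t n) (6 : ℝ≥0) volume) atTop (𝓝 0) := by
    refine tendsto_eLpNorm_of_dominated (by norm_num) hw.norm htm
      (fun n => ae_of_all _ fun x => ?_) (ae_of_all _ fun x => ?_)
    · rw [norm_norm]; exact norm_indicator_le_norm_self _ _
    · refine tendsto_const_nhds.congr' ?_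
      filter_upwards [tendsto_cutoff x] with n hn
      simp only [t]
      rw [Set.indicator_of_notMem (by simpa using hn)]
  have hC : eLpNorm (partialDeriv i unitBump) 3 volume ≠ ∞ :=
    ((isTest_unitBump.partialDeriv i).memLp 3).eLpNorm_ne_top
  have hlim := ENNReal.Tendsto.const_mul ht (Or.inr hC)
  rw [mul_zero] at hlim
  refine tendsto_of_tendsto_of_tendsto_of_le_of_le tendsto_const_nhds hlim
    (fun _ => zero_le) fun n => ?_
  have e : (fun x => partialDeriv i (cutoff n) x • w x) = partialDeriv i (cutoff n) • t n := by
    ext x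
    simp only [Pi.smul_apply', t]
    by_cases hx : (n : ℝ) + 1 ≤ ‖x‖
    · rw [Set.indicator_of_mem (by exact hx)]
    · rw [Set.indicator_of_notMem (by exact hx), partialDeriv_cutoff_eq_zero n i (not_le.1 hx)]
      simp
  simp only
  rw [e]
  refine (eLpNorm_smul_le_mul_eLpNorm (p := 3) (q := 6) (r := 2) (htm n)
    ((isTest_cutoff n).partialDeriv i).continuous.aestronglyMeasurable).trans ?_
  rw [eLpNorm_partialDeriv_cutoff]
  simp

lemma memLp_cutoff_smul {w : E3 → F} {p : ℝ≥0∞} (hw : MemLp w p volume) (n : ℕ) :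
    MemLp (fun x => cutoff n x • w x) p volume := by
  refine hw.mono ((isTest_cutoff n).continuous.aestronglyMeasurable.smul hw.1)
    (ae_of_all _ fun x => ?_)
  rw [norm_smul, Real.norm_of_nonneg (cutoff_nonneg n x)]
  exact mul_le_of_le_one_left (norm_nonneg _) (cutoff_le_one n x)

/-- Test functions are dense in the space of functions with weak gradient. -/
lemma HasWeakGrad.exists_isTest [CompleteSpace F] {u : E3 → F} {v : Fin 3 → E3 → F}
    (h : HasWeakGrad u v) {ε : ℝ≥0∞} (hε : 0 < ε) :
    ∃ φ : E3 → F, IsTest φ ∧ eLpNorm (fun x => φ x - u x) 6 volume ≤ ε ∧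
      ∀ i, eLpNorm (fun x => partialDeriv i φ x - v i x) 2 volume ≤ ε := by
  have hε2 : 0 < ε / 2 := ENNReal.half_pos hε.ne'
  have h6 : Tendsto (fun n => eLpNorm (fun x => cutoff n x • u x - u x) 6 volume) atTop (𝓝 0) :=
    tendsto_eLpNorm_cutoff_smul (p := 6) (by norm_num) h.1
  set w : ℕ → Fin 3 → E3 → F := fun n i x => partialDeriv i (cutoff n) x • u x + cutoff n x • v i x
  have hmp : ∀ n i, AEStronglyMeasurable (fun x => partialDeriv i (cutoff n) x • u x) volume :=
    fun n i => ((isTest_cutoff n).partialDeriv i).continuous.aestronglyMeasurable.smul h.1.1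
  have h2 : ∀ i, Tendsto (fun n => eLpNorm (fun x => w n i x - v i x) 2 volume) atTop (𝓝 0) := by
    intro i
    have := tendsto_eLpNorm_add_zero one_le_two (hmp · i)
      (fun n => ((memLp_cutoff_smul (h.2 i).2 n).sub (h.2 i).2).1)
      (tendsto_eLpNorm_partialDeriv_cutoff_smul i h.1)
      (tendsto_eLpNorm_cutoff_smul (p := 2) (by norm_num) (h.2 i).2)
    simpa only [w, Pi.sub_apply, add_sub_assoc] using this
  -- Half of the error is spent on truncation; the other half goes to mollifying the truncated
  -- function.
  obtain ⟨n, hn6, hn2⟩ := ((ENNReal.tendsto_nhds_zero.1 h6 _ hε2).and (eventually_all.2 fun i =>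
    ENNReal.tendsto_nhds_zero.1 (h2 i) _ hε2)).exists
  have hun : MemLp (fun x => cutoff n x • u x) 6 volume := memLp_cutoff_smul h.1 n
  have hw2 : ∀ i, MemLp (w n i) 2 volume := by
    intro i
    refine MemLp.add ?_ (memLp_cutoff_smul (h.2 i).2 n)
    refine ⟨hmp n i, ?_⟩
    exact lt_of_le_of_lt (eLpNorm_smul_le_mul_eLpNorm (p := 3) (q := 6) (r := 2) h.1.1
      ((isTest_cutoff n).partialDeriv i).continuous.aestronglyMeasurable)
      (ENNReal.mul_lt_top (((isTest_cutoff n).partialDeriv i).memLp 3).2 h.1.2)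
  have hwp : ∀ i, IsWeakPartial i (fun x => cutoff n x • u x) (w n i) := fun i =>
    (h.2 i).1.smooth_smul (isTest_cutoff n).1
  have hm6 := tendsto_eLpNorm_mollify (p := 6) (by norm_num) hun
  have hm2 := fun i => tendsto_eLpNorm_mollify (p := 2) (by norm_num) (hw2 i)
  obtain ⟨k, hk6, hk2⟩ := ((ENNReal.tendsto_nhds_zero.1 hm6 _ hε2).and (eventually_all.2 fun i =>
    ENNReal.tendsto_nhds_zero.1 (hm2 i) _ hε2)).exists
  have hT : IsTest (mollify k (fun x => cutoff n x • u x)) :=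
    isTest_mollify k (hwp 0).1 (isTest_cutoff n).2.smul_right
  refine ⟨_, hT, ?_, fun i => ?_⟩
  · have e : (fun x => mollify k (fun x => cutoff n x • u x) x - u x)
        = (fun x => mollify k (fun x => cutoff n x • u x) x - cutoff n x • u x)
          + fun x => cutoff n x • u x - u x := by
      ext x; simp
    rw [e, ← ENNReal.add_halves ε]
    exact (eLpNorm_add_le (hT.continuous.aestronglyMeasurable.sub hun.1) (hun.1.sub h.1.1)
      (by norm_num)).trans (add_le_add hk6 hn6)
  · have e : (fun x => partialDeriv i (mollify k (fun x => cutoff n x • u x)) x - v i x)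
        = (fun x => mollify k (w n i) x - w n i x) + fun x => w n i x - v i x := by
      ext x; simp [partialDeriv_mollify k (hwp i)]
    rw [e, ← ENNReal.add_halves ε]
    exact (eLpNorm_add_le ((contDiff_mollify k (hwp i).2.1).continuous.aestronglyMeasurable.sub
      (hw2 i).1) ((hw2 i).1.sub (h.2 i).2.1) one_le_two).trans (add_le_add (hk2 i) (hn2 i))

lemma HasWeakGrad.exists_seq [CompleteSpace F] {u : E3 → F} {v : Fin 3 → E3 → F}
    (h : HasWeakGrad u v) :
    ∃ φ : ℕ → E3 → F, (∀ n, IsTest (φ n)) ∧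
      Tendsto (fun n => eLpNorm (fun x => φ n x - u x) 6 volume) atTop (𝓝 0) ∧
      ∀ i, Tendsto (fun n => eLpNorm (fun x => partialDeriv i (φ n) x - v i x) 2 volume)
        atTop (𝓝 0) := by
  have hpos : ∀ n : ℕ, (0 : ℝ≥0∞) < (n + 1 : ℝ≥0∞)⁻¹ := fun n => by simp
  choose φ hφ h6 h2 using fun n : ℕ => h.exists_isTest (hpos n)
  have hlim : Tendsto (fun n : ℕ => (n + 1 : ℝ≥0∞)⁻¹) atTop (𝓝 0) := by
    have := ENNReal.tendsto_inv_nat_nhds_zero.comp (tendsto_add_atTop_nat 1)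
    simpa [Function.comp_def] using this
  exact ⟨φ, hφ, tendsto_of_tendsto_of_tendsto_of_le_of_le tendsto_const_nhds hlim
    (fun _ => zero_le) h6, fun i => tendsto_of_tendsto_of_tendsto_of_le_of_le
    tendsto_const_nhds hlim (fun _ => zero_le) (h2 · i)⟩

lemma HasWeakGrad.weakPartial_ae [CompleteSpace F] {u : E3 → F} {v : Fin 3 → E3 → F}
    (h : HasWeakGrad u v) (i : Fin 3) : weakPartial i u =ᵐ[volume] v i :=
  (h.2 i).1.weakPartial

/-- The approximating sequence demanded in the definition comes for free from density, so `𝒟^{1,2}`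
can be handled through weak gradients alone. -/
lemma HasWeakGrad.memD12 [CompleteSpace F] {u : E3 → F} {v : Fin 3 → E3 → F}
    (h : HasWeakGrad u v) : MemD12 u := by
  refine ⟨h.1, fun i => ⟨v i, h.2 i⟩, ?_⟩
  obtain ⟨φ, hφ, -, h2⟩ := h.exists_seq
  refine ⟨φ, hφ, fun i => (h2 i).congr fun n => eLpNorm_congr_ae ?_⟩
  filter_upwards [h.weakPartial_ae i] with x hx
  rw [hx]

lemma MemD12.isWeakPartial {u : E3 → F} (h : MemD12 u) (i : Fin 3) :
    IsWeakPartial i u (weakPartial i u) := by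
  obtain ⟨v, hv, -⟩ := h.2.1 i
  have hex : ∃ v, IsWeakPartial i u v := ⟨v, hv⟩
  unfold CurlCurl.weakPartial
  rw [dif_pos hex]
  exact hex.choose_spec

lemma MemD12.hasWeakGrad [CompleteSpace F] {u : E3 → F} (h : MemD12 u) :
    HasWeakGrad u (fun i => weakPartial i u) := by
  refine ⟨h.1, fun i => ⟨h.isWeakPartial i, ?_⟩⟩
  obtain ⟨v, hv, hv2⟩ := h.2.1 i
  exact hv2.ae_eq hv.weakPartial.symm

lemma HasWeakGrad.congr {u u' : E3 → F} {v v' : Fin 3 → E3 → F} (h : HasWeakGrad u v)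
    (hu : u =ᵐ[volume] u') (hv : ∀ i, v i =ᵐ[volume] v' i) : HasWeakGrad u' v' :=
  ⟨h.1.ae_eq hu, fun i => ⟨(h.2 i).1.congr hu (hv i), (h.2 i).2.ae_eq (hv i)⟩⟩

lemma HasWeakGrad.add {u u' : E3 → F} {v v' : Fin 3 → E3 → F} (h : HasWeakGrad u v)
    (h' : HasWeakGrad u' v') : HasWeakGrad (u + u') (fun i => v i + v' i) :=
  ⟨h.1.add h'.1, fun i => ⟨(h.2 i).1.add (h'.2 i).1, (h.2 i).2.add (h'.2 i).2⟩⟩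

lemma HasWeakGrad.const_smul {u : E3 → F} {v : Fin 3 → E3 → F} (h : HasWeakGrad u v) (c : ℝ) :
    HasWeakGrad (c • u) (fun i => c • v i) :=
  ⟨h.1.const_smul c, fun i => ⟨(h.2 i).1.const_smul c, (h.2 i).2.const_smul c⟩⟩

lemma IsTest.hasWeakGrad [CompleteSpace F] {φ : E3 → F} (hφ : IsTest φ) :
    HasWeakGrad φ (fun i => CurlCurl.partialDeriv i φ) :=
  ⟨hφ.memLp 6, fun i => ⟨isWeakPartial_of_contDiff hφ.1 i, (hφ.partialDeriv i).memLp 2⟩⟩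

lemma norm_fderiv_le_sum (φ : E3 → F) (x : E3) :
    ‖fderiv ℝ φ x‖ ≤ ∑ i, ‖partialDeriv i φ x‖ := by
  refine ContinuousLinearMap.opNorm_le_bound _ (by positivity) fun y => ?_
  have hy : y = ∑ i, y i • (EuclideanSpace.single i 1 : E3) := by
    ext k
    fin_cases k <;> simp [Fin.sum_univ_three]
  conv_lhs => rw [hy, map_sum]
  refine (norm_sum_le _ _).trans ?_
  rw [Finset.sum_mul]
  refine Finset.sum_le_sum fun i _ => ?_
  rw [map_smul, norm_smul, mul_comm]
  exact mul_le_mul_of_nonneg_left (PiLp.norm_apply_le y i) (norm_nonneg _)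

/-- The Sobolev inequality in `𝒟^{1,2}`. -/
lemma exists_sobolev_const (F : Type*) [NormedAddCommGroup F] [NormedSpace ℝ F]
    [FiniteDimensional ℝ F] :
    ∃ C : ℝ≥0, ∀ (u : E3 → F) (v : Fin 3 → E3 → F), HasWeakGrad u v →
      eLpNorm u 6 volume ≤ C * ∑ i, eLpNorm (v i) 2 volume := by
  have : CompleteSpace F := FiniteDimensional.complete ℝ F
  refine ⟨SNormLESNormFDerivOfEqConst F (volume : Measure E3) 2, fun u v h => ?_⟩
  set C := SNormLESNormFDerivOfEqConst F (volume : Measure E3) 2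
  obtain ⟨φ, hφ, h6, h2⟩ := h.exists_seq
  -- The Gagliardo–Nirenberg–Sobolev inequality holds for each test function, from exponent 2 to
  -- exponent 6 in dimension three; both approximation errors are kept explicit so that the limit
  -- can be taken.
  have hb : ∀ n, eLpNorm u 6 volume ≤ eLpNorm (fun x => φ n x - u x) 6 volume
      + C * ∑ i, (eLpNorm (fun x => partialDeriv i (φ n) x - v i x) 2 volume
        + eLpNorm (v i) 2 volume) := by
    intro n
    have hs : eLpNorm (φ n) 6 volume ≤ C * eLpNorm (fderiv ℝ (φ n)) 2 volume := by
      have := eLpNorm_le_eLpNorm_fderiv_of_eq (F := F) (volume : Measure E3) (u := φ n)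
        ((hφ n).1.of_le (by simp)) (hφ n).2 (p := 2) (p' := 6) (by norm_num) (by simp)
        (by simp; norm_num)
      simpa using this
    have hg : eLpNorm (fderiv ℝ (φ n)) 2 volume
        ≤ ∑ i, eLpNorm (partialDeriv i (φ n)) 2 volume := by
      refine (eLpNorm_mono_real (g := ∑ i, fun x => ‖partialDeriv i (φ n) x‖) fun x => ?_).trans
        ((eLpNorm_sum_le (fun i _ => (((hφ n).partialDeriv i).continuous.norm.aestronglyMeasurable))
          one_le_two).trans (le_of_eq ?_))
      · simpa using norm_fderiv_le_sum (φ n) x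
      · simp_rw [eLpNorm_norm]
    have hd : ∀ i, eLpNorm (partialDeriv i (φ n)) 2 volume
        ≤ eLpNorm (fun x => partialDeriv i (φ n) x - v i x) 2 volume + eLpNorm (v i) 2 volume := by
      intro i
      have e : partialDeriv i (φ n) = (fun x => partialDeriv i (φ n) x - v i x) + v i := by
        ext x; simp
      conv_lhs => rw [e]
      exact eLpNorm_add_le (((hφ n).partialDeriv i).continuous.aestronglyMeasurable.sub (h.2 i).2.1)
        (h.2 i).2.1 one_le_two
    have hu : eLpNorm u 6 volume ≤ eLpNorm (fun x => φ n x - u x) 6 volume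
        + eLpNorm (φ n) 6 volume := by
      have e : u = (fun x => u x - φ n x) + φ n := by ext x; simp
      conv_lhs => rw [e]
      refine (eLpNorm_add_le (h.1.1.sub (hφ n).continuous.aestronglyMeasurable)
        (hφ n).continuous.aestronglyMeasurable (by norm_num)).trans (le_of_eq ?_)
      congr 1
      exact eLpNorm_sub_comm u (φ n) 6 volume
    refine hu.trans ?_
    gcongr
    refine hs.trans ?_
    gcongr
    exact hg.trans (Finset.sum_le_sum fun i _ => hd i)
  have hlim : Tendsto (fun n => eLpNorm (fun x => φ n x - u x) 6 volume
      + C * ∑ i, (eLpNorm (fun x => partialDeriv i (φ n) x - v i x) 2 volume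
        + eLpNorm (v i) 2 volume)) atTop (𝓝 (0 + C * ∑ i, (0 + eLpNorm (v i) 2 volume))) :=
    h6.add (ENNReal.Tendsto.const_mul (tendsto_finsetSum _ fun i _ => (h2 i).add
      tendsto_const_nhds) (Or.inr ENNReal.coe_ne_top))
  simpa using ge_of_tendsto' hlim hb

end Density

/-! ### The singular angular functions `x j / r` and their regularisation. -/

section Axis

lemma rad_nonneg (x : E3) : 0 ≤ rad x := Real.sqrt_nonneg _

lemma rad_sq (x : E3) : rad x ^ 2 = x 0 ^ 2 + x 1 ^ 2 := Real.sq_sqrt (by positivity)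

lemma continuous_rad : Continuous rad := by unfold rad; fun_prop

lemma abs_apply_le_rad (x : E3) {j : Fin 3} (hj : j ≠ 2) : |x j| ≤ rad x := by
  refine Real.abs_le_sqrt ?_
  fin_cases j
  · exact le_add_of_nonneg_right (sq_nonneg _)
  · exact le_add_of_nonneg_left (sq_nonneg _)
  · exact absurd rfl hj

/-- The axis lies in the hyperplane `x 0 = 0`. Hence the value zero that division assigns on the
axis never matters. -/
lemma ae_rad_ne_zero : ∀ᵐ x : E3, rad x ≠ 0 := by
  have hs : (LinearMap.ker (EuclideanSpace.proj (0 : Fin 3) : E3 →L[ℝ] ℝ).toLinearMap) ≠ ⊤ := by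
    intro h
    have h1 : (EuclideanSpace.single 0 1 : E3) ∈
      LinearMap.ker (EuclideanSpace.proj (0 : Fin 3) : E3 →L[ℝ] ℝ).toLinearMap := by rw [h]; trivial
    simp at h1
  have h0 := Measure.addHaar_submodule (volume : Measure E3) _ hs
  rw [ae_iff]
  refine measure_mono_null (fun x hx => ?_) h0
  have hx0 : rad x = 0 := not_not.1 hx
  have h1 := abs_apply_le_rad x (j := 0) (by decide)
  rw [hx0] at h1
  simpa using h1

lemma norm_rot (x : E3) : ‖rot x‖ = rad x := by
  rw [EuclideanSpace.norm_eq]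
  simp [rot, rad, Fin.sum_univ_three, add_comm]

/-- A regularisation of `rad`. -/
def radReg (ε : ℝ) (x : E3) : ℝ := Real.sqrt (x 0 ^ 2 + x 1 ^ 2 + ε ^ 2)

lemma radReg_sq (ε : ℝ) (x : E3) : radReg ε x ^ 2 = x 0 ^ 2 + x 1 ^ 2 + ε ^ 2 :=
  Real.sq_sqrt (by positivity)

lemma radReg_pos {ε : ℝ} (hε : ε ≠ 0) (x : E3) : 0 < radReg ε x :=
  Real.sqrt_pos.2 (by positivity)

lemma rad_le_radReg (ε : ℝ) (x : E3) : rad x ≤ radReg ε x :=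
  Real.sqrt_le_sqrt (le_add_of_nonneg_right (sq_nonneg _))

lemma contDiff_radReg {ε : ℝ} (hε : ε ≠ 0) : ContDiff ℝ (⊤ : ℕ∞) (radReg ε) := by
  unfold radReg
  refine ContDiff.sqrt (by fun_prop) fun x => ?_
  positivity

/-- The derivative of `(r²)/2`. -/
def horiz (i : Fin 3) (x : E3) : ℝ := if i = 2 then 0 else x i

lemma abs_horiz_le (i : Fin 3) (x : E3) : |horiz i x| ≤ rad x := by
  unfold horiz
  split_ifs with h
  · simpa using rad_nonneg x
  · exact abs_apply_le_rad x h

lemma partialDeriv_apply (i j : Fin 3) (x : E3) :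
    partialDeriv i (fun x : E3 => x j) x = if i = j then 1 else 0 := by
  unfold partialDeriv
  have : HasFDerivAt (fun x : E3 => x j) (EuclideanSpace.proj j : E3 →L[ℝ] ℝ) x :=
    (EuclideanSpace.proj j : E3 →L[ℝ] ℝ).hasFDerivAt
  rw [this.fderiv]
  simp [eq_comm]

lemma contDiff_apply_coord (j : Fin 3) : ContDiff ℝ (⊤ : ℕ∞) (fun x : E3 => x j) := by fun_prop

lemma hasFDerivAt_radReg_sq (ε : ℝ) (x : E3) :
    HasFDerivAt (fun x : E3 => x 0 ^ 2 + x 1 ^ 2 + ε ^ 2)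
      ((2 * x 0) • (EuclideanSpace.proj (0 : Fin 3) : E3 →L[ℝ] ℝ)
        + (2 * x 1) • (EuclideanSpace.proj (1 : Fin 3) : E3 →L[ℝ] ℝ)) x := by
  have h0 : HasFDerivAt (fun x : E3 => x 0) (EuclideanSpace.proj (0 : Fin 3) : E3 →L[ℝ] ℝ) x :=
    (EuclideanSpace.proj (0 : Fin 3) : E3 →L[ℝ] ℝ).hasFDerivAt
  have h1 : HasFDerivAt (fun x : E3 => x 1) (EuclideanSpace.proj (1 : Fin 3) : E3 →L[ℝ] ℝ) x :=
    (EuclideanSpace.proj (1 : Fin 3) : E3 →L[ℝ] ℝ).hasFDerivAt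
  simpa using ((h0.pow 2).add (h1.pow 2)).add_const (ε ^ 2)

lemma partialDeriv_radReg {ε : ℝ} (hε : ε ≠ 0) (i : Fin 3) (x : E3) :
    partialDeriv i (radReg ε) x = horiz i x / radReg ε x := by
  have h := (hasFDerivAt_radReg_sq ε x).sqrt (by positivity)
  unfold partialDeriv
  rw [show radReg ε = fun x : E3 => Real.sqrt (x 0 ^ 2 + x 1 ^ 2 + ε ^ 2) from rfl, h.fderiv]
  have h2 : Real.sqrt (x 0 ^ 2 + x 1 ^ 2 + ε ^ 2) ≠ 0 := (radReg_pos hε x).ne'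
  fin_cases i <;> simp [horiz] <;> field_simp

lemma partialDeriv_inv_radReg {ε : ℝ} (hε : ε ≠ 0) (i : Fin 3) (x : E3) :
    partialDeriv i (fun x => (radReg ε x)⁻¹) x = -horiz i x / radReg ε x ^ 3 := by
  have hp := (radReg_pos hε x).ne'
  have hd := ((contDiff_radReg hε).differentiable (by simp) x).hasFDerivAt
  have h := (HasDerivAt.comp_hasFDerivAt x (hasDerivAt_inv hp) hd)
  have e := partialDeriv_radReg hε i x
  unfold partialDeriv at e ⊢
  rw [show (fun x => (radReg ε x)⁻¹) = Inv.inv ∘ radReg ε from rfl, h.fderiv]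
  simp only [_root_.smul_apply, smul_eq_mul, e]
  field_simp

lemma contDiff_inv_radReg {ε : ℝ} (hε : ε ≠ 0) : ContDiff ℝ (⊤ : ℕ∞) (fun x => (radReg ε x)⁻¹) :=
  (contDiff_radReg hε).inv fun x => (radReg_pos hε x).ne'

/-- The regularised angular function `x_j / √(r² + ε²)`. -/
def dirReg (ε : ℝ) (j : Fin 3) (x : E3) : ℝ := x j * (radReg ε x)⁻¹

/-- The angular function `x_j / r`. -/
def dir (j : Fin 3) (x : E3) : ℝ := x j / rad x

/-- The derivative `∂ᵢ (x_j / r)`. -/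
def dirDeriv (i j : Fin 3) (x : E3) : ℝ :=
  (if i = j then 1 else 0) / rad x - horiz i x * x j / rad x ^ 3

lemma contDiff_dirReg {ε : ℝ} (hε : ε ≠ 0) (j : Fin 3) : ContDiff ℝ (⊤ : ℕ∞) (dirReg ε j) :=
  (contDiff_apply_coord j).mul (contDiff_inv_radReg hε)

lemma partialDeriv_dirReg {ε : ℝ} (hε : ε ≠ 0) (i j : Fin 3) (x : E3) :
    partialDeriv i (dirReg ε j) x
      = (if i = j then 1 else 0) / radReg ε x - horiz i x * x j / radReg ε x ^ 3 := by
  unfold dirReg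
  rw [partialDeriv_mul i ((contDiff_apply_coord j).differentiable (by simp) x)
    ((contDiff_inv_radReg hε).differentiable (by simp) x), partialDeriv_apply,
    partialDeriv_inv_radReg hε]
  ring

lemma abs_dirReg_le {ε : ℝ} (hε : ε ≠ 0) {j : Fin 3} (hj : j ≠ 2) (x : E3) :
    |dirReg ε j x| ≤ 1 := by
  unfold dirReg
  rw [abs_mul, abs_inv, abs_of_pos (radReg_pos hε x), ← div_eq_mul_inv,
    div_le_one (radReg_pos hε x)]
  exact (abs_apply_le_rad x hj).trans (rad_le_radReg ε x)

lemma abs_dir_le {j : Fin 3} (hj : j ≠ 2) (x : E3) : |dir j x| ≤ 1 := by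
  unfold dir
  rw [abs_div, abs_of_nonneg (rad_nonneg x)]
  exact div_le_one_of_le₀ (abs_apply_le_rad x hj) (rad_nonneg x)

/-- The denominator `s ≥ r` is left free so that one bound serves both the regularised and the
singular angular functions. Uniformity in `ε` is what dominated convergence needs later. -/
lemma abs_dirDeriv_aux {s r a b : ℝ} (hs : 0 < s) (hr : r ≤ s) (ha : |a| ≤ r) (hb : |b| ≤ r)
    (c : Prop) [Decidable c] :
    |(if c then 1 else 0) / s - a * b / s ^ 3| ≤ 2 / s := by
  have h1 : |(if c then (1 : ℝ) else 0) / s| ≤ 1 / s := by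
    rw [abs_div, abs_of_pos hs]
    gcongr
    split_ifs <;> simp
  have h2 : |a * b / s ^ 3| ≤ 1 / s := by
    rw [abs_div, abs_mul, abs_of_pos (by positivity : (0 : ℝ) < s ^ 3), div_le_div_iff₀
      (by positivity) hs]
    have : |a| * |b| ≤ s * s :=
      mul_le_mul (ha.trans hr) (hb.trans hr) (abs_nonneg _) hs.le
    nlinarith
  calc _ ≤ _ := abs_sub _ _
    _ ≤ 1 / s + 1 / s := add_le_add h1 h2
    _ = 2 / s := by ring

lemma abs_partialDeriv_dirReg_le {ε : ℝ} (hε : ε ≠ 0) (i : Fin 3) {j : Fin 3} (hj : j ≠ 2)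
    {x : E3} (hx : rad x ≠ 0) : |partialDeriv i (dirReg ε j) x| ≤ 2 / rad x := by
  rw [partialDeriv_dirReg hε]
  have h0 : 0 < rad x := lt_of_le_of_ne (rad_nonneg x) hx.symm
  refine (abs_dirDeriv_aux (radReg_pos hε x) (rad_le_radReg ε x) (abs_horiz_le i x)
    (abs_apply_le_rad x hj) _).trans ?_
  gcongr
  exact rad_le_radReg ε x

lemma abs_dirDeriv_le (i : Fin 3) {j : Fin 3} (hj : j ≠ 2)
    {x : E3} (hx : rad x ≠ 0) : |dirDeriv i j x| ≤ 2 / rad x :=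
  abs_dirDeriv_aux (lt_of_le_of_ne (rad_nonneg x) hx.symm) le_rfl (abs_horiz_le i x)
    (abs_apply_le_rad x hj) _

/-- A sequence of regularisation parameters tending to zero. -/
def epsSeq (n : ℕ) : ℝ := 1 / ((n : ℝ) + 1)

lemma epsSeq_pos (n : ℕ) : 0 < epsSeq n := by unfold epsSeq; positivity

lemma epsSeq_ne_zero (n : ℕ) : epsSeq n ≠ 0 := (epsSeq_pos n).ne'

lemma tendsto_epsSeq : Tendsto epsSeq atTop (𝓝 0) := tendsto_one_div_add_atTop_nhds_zero_nat

lemma tendsto_radReg (x : E3) : Tendsto (fun n => radReg (epsSeq n) x) atTop (𝓝 (rad x)) := by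
  have hc : Continuous fun ε : ℝ => radReg ε x := by unfold radReg; fun_prop
  have := (hc.tendsto 0).comp tendsto_epsSeq
  simpa [radReg, rad, Function.comp_def] using this

lemma tendsto_dirReg (j : Fin 3) {x : E3} (hx : rad x ≠ 0) :
    Tendsto (fun n => dirReg (epsSeq n) j x) atTop (𝓝 (dir j x)) := by
  unfold dirReg dir
  rw [div_eq_mul_inv]
  exact ((tendsto_radReg x).inv₀ hx).const_mul _

lemma tendsto_partialDeriv_dirReg (i j : Fin 3) {x : E3} (hx : rad x ≠ 0) :
    Tendsto (fun n => partialDeriv i (dirReg (epsSeq n) j) x) atTop (𝓝 (dirDeriv i j x)) := by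
  simp_rw [partialDeriv_dirReg (epsSeq_ne_zero _)]
  unfold dirDeriv
  exact (tendsto_const_nhds.div (tendsto_radReg x) hx).sub
    (tendsto_const_nhds.div ((tendsto_radReg x).pow 3) (pow_ne_zero 3 hx))

lemma measurable_rad : Measurable rad := continuous_rad.measurable

lemma measurable_dir (j : Fin 3) : Measurable (dir j) :=
  (contDiff_apply_coord j).continuous.measurable.div measurable_rad

lemma measurable_horiz (i : Fin 3) : Measurable (horiz i) := by
  unfold horiz
  split_ifs
  · exact measurable_const
  · exact (contDiff_apply_coord i).continuous.measurable

lemma measurable_dirDeriv (i j : Fin 3) : Measurable (dirDeriv i j) :=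
  (measurable_const.div measurable_rad).sub
    (((measurable_horiz i).mul (contDiff_apply_coord j).continuous.measurable).div
      (measurable_rad.pow_const 3))

variable {F : Type*} [NormedAddCommGroup F] [NormedSpace ℝ F]

/-- The product rule for the multiplication of a weakly differentiable function by an angular
function, which is singular on the axis. -/
lemma IsWeakPartial.dir_smul {i j : Fin 3} (hj : j ≠ 2) {w v : E3 → F}
    (h : IsWeakPartial i w v) (hw : LocallyIntegrable (fun x => (rad x)⁻¹ • w x) volume) :
    IsWeakPartial i (fun x => dir j x • w x) (fun x => dirDeriv i j x • w x + dir j x • v x) := by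
  have hm1 : ∀ {z : E3 → F}, LocallyIntegrable z volume →
      LocallyIntegrable (fun x => dir j x • z x) volume := fun {z} hz =>
    hz.mono ((measurable_dir j).aestronglyMeasurable.smul hz.aestronglyMeasurable)
      (ae_of_all _ fun x => by
        rw [norm_smul]
        exact mul_le_of_le_one_left (norm_nonneg _) (abs_dir_le hj x))
  have hm2 : LocallyIntegrable (fun x => dirDeriv i j x • w x) volume := by
    refine (hw.smul (2 : ℝ)).mono ((measurable_dirDeriv i j).aestronglyMeasurable.smul
      h.1.aestronglyMeasurable) ?_
    filter_upwards [ae_rad_ne_zero] with x hx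
    simp only [Pi.smul_apply, norm_smul, Real.norm_eq_abs, abs_inv, abs_of_nonneg (rad_nonneg x),
      ← mul_assoc]
    refine mul_le_mul_of_nonneg_right ?_ (norm_nonneg _)
    rw [abs_two, ← div_eq_mul_inv]
    exact abs_dirDeriv_le i hj hx
  refine ⟨hm1 h.1, hm2.add (hm1 h.2.1), fun φ hφ => ?_⟩
  -- The product rule holds for the smooth regularised factor. In the limit the derivative of that
  -- factor is dominated by `2 / r`, which is where the local integrability of `w / r` enters.
  have hn := fun n => (h.smooth_smul (contDiff_dirReg (epsSeq_ne_zero n) j)).2.2 φ hφ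
  have hb : ∀ n (z : E3 → F) (ψ : E3 → ℝ) x,
      ‖ψ x • dirReg (epsSeq n) j x • z x‖ ≤ ‖ψ x • z x‖ := by
    intro n z ψ x
    rw [norm_smul, norm_smul, norm_smul]
    gcongr
    exact mul_le_of_le_one_left (norm_nonneg _) (abs_dirReg_le (epsSeq_ne_zero n) hj x)
  have l1 : Tendsto (fun n => ∫ x, CurlCurl.partialDeriv i φ x • dirReg (epsSeq n) j x • w x) atTop
      (𝓝 (∫ x, CurlCurl.partialDeriv i φ x • dir j x • w x)) := by
    refine tendsto_integral_of_dominated_convergence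
      (fun x => ‖CurlCurl.partialDeriv i φ x • w x‖) (fun n => ?_)
      ((hφ.partialDeriv i).smul_integrable h.1).norm (fun n => ae_of_all _ (hb n w _)) ?_
    · exact (hφ.partialDeriv i).continuous.aestronglyMeasurable.smul
        ((contDiff_dirReg (epsSeq_ne_zero n) j).continuous.aestronglyMeasurable.smul
          h.1.aestronglyMeasurable)
    · filter_upwards [ae_rad_ne_zero] with x hx
      exact ((tendsto_dirReg j hx).smul_const _).const_smul _
  have l2 : Tendsto (fun n => ∫ x, φ x • (CurlCurl.partialDeriv i (dirReg (epsSeq n) j) x • w x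
      + dirReg (epsSeq n) j x • v x)) atTop
      (𝓝 (∫ x, φ x • (dirDeriv i j x • w x + dir j x • v x))) := by
    refine tendsto_integral_of_dominated_convergence
      (fun x => 2 * ‖φ x • (rad x)⁻¹ • w x‖ + ‖φ x • v x‖) (fun n => ?_)
      (((hφ.smul_integrable hw).norm.const_mul 2).add (hφ.smul_integrable h.2.1).norm)
      (fun n => ?_) ?_
    · exact hφ.continuous.aestronglyMeasurable.smul
        (((contDiff_partialDeriv (contDiff_dirReg (epsSeq_ne_zero n) j)
          i).continuous.aestronglyMeasurable.smul h.1.aestronglyMeasurable).add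
        ((contDiff_dirReg (epsSeq_ne_zero n) j).continuous.aestronglyMeasurable.smul
          h.2.1.aestronglyMeasurable))
    · filter_upwards [ae_rad_ne_zero] with x hx
      rw [smul_add]
      refine (norm_add_le _ _).trans (add_le_add ?_ (hb n v φ x))
      rw [norm_smul, norm_smul, norm_smul, norm_smul, ← mul_assoc, ← mul_assoc, ← mul_assoc,
        mul_comm (2 : ℝ), mul_assoc ‖φ x‖ 2]
      gcongr
      rw [norm_inv, Real.norm_of_nonneg (rad_nonneg x), mul_comm, mul_comm, ← div_eq_mul_inv]
      exact abs_partialDeriv_dirReg_le (epsSeq_ne_zero n) i hj hx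
    · filter_upwards [ae_rad_ne_zero] with x hx
      exact (((tendsto_partialDeriv_dirReg i j hx).smul_const _).add
        ((tendsto_dirReg j hx).smul_const _)).const_smul _
  exact tendsto_nhds_unique l1 (l2.neg.congr fun n => (hn n).symm)

end Axis

/-! ### Rotations and the angular derivative of invariant functions. -/

section Rotation

lemma act_entries (g : Matrix.orthogonalGroup (Fin 2) ℝ) :
    g.1 0 0 ^ 2 + g.1 1 0 ^ 2 = 1 ∧ g.1 0 1 ^ 2 + g.1 1 1 ^ 2 = 1 ∧
      g.1 0 0 * g.1 0 1 + g.1 1 0 * g.1 1 1 = 0 := by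
  have h := (Matrix.mem_orthogonalGroup_iff' (Fin 2) ℝ).1 g.2
  have h00 := congrFun (congrFun h 0) 0
  have h11 := congrFun (congrFun h 1) 1
  have h01 := congrFun (congrFun h 0) 1
  simp [Matrix.mul_apply, Fin.sum_univ_two] at h00 h11 h01
  exact ⟨by linarith, by linarith, by linarith⟩

lemma rad_act (g : Matrix.orthogonalGroup (Fin 2) ℝ) (x : E3) : rad (act g x) = rad x := by
  obtain ⟨h0, h1, h2⟩ := act_entries g
  unfold rad
  congr 1
  simp only [act, Matrix.cons_val_zero, Matrix.cons_val_one, PiLp.toLp_apply]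
  linear_combination x 0 ^ 2 * h0 + x 1 ^ 2 * h1 + 2 * x 0 * x 1 * h2

lemma norm_sq_eq (x : E3) : ‖x‖ ^ 2 = rad x ^ 2 + x 2 ^ 2 := by
  rw [EuclideanSpace.norm_sq_eq, rad_sq]
  simp [Fin.sum_univ_three]

lemma norm_act (g : Matrix.orthogonalGroup (Fin 2) ℝ) (x : E3) : ‖act g x‖ = ‖x‖ := by
  rw [← sq_eq_sq₀ (norm_nonneg _) (norm_nonneg _), norm_sq_eq, norm_sq_eq, rad_act]
  rfl

/-- The action of `𝒪` by linear isometries. -/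
def actIsometry (g : Matrix.orthogonalGroup (Fin 2) ℝ) : E3 →ₗᵢ[ℝ] E3 where
  toFun := act g
  map_add' x y := by ext k; fin_cases k <;> simp [act] <;> ring
  map_smul' c x := by ext k; fin_cases k <;> simp [act] <;> ring
  norm_map' := norm_act g

lemma measurePreserving_act (g : Matrix.orthogonalGroup (Fin 2) ℝ) :
    MeasurePreserving (act g) (volume : Measure E3) volume :=
  ((actIsometry g).toLinearIsometryEquiv rfl).measurePreserving

lemma measurableEmbedding_act (g : Matrix.orthogonalGroup (Fin 2) ℝ) :
    MeasurableEmbedding (act g) :=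
  ((actIsometry g).toLinearIsometryEquiv rfl).toHomeomorph.measurableEmbedding

lemma InvariantO.congr {b b' : E3 → ℝ} (h : InvariantO b) (hb : b =ᵐ[volume] b') :
    InvariantO b' := by
  intro g
  filter_upwards [h g, hb, (measurePreserving_act g).quasiMeasurePreserving.ae_eq_comp hb]
    with x h1 h2 h3
  simp only [Function.comp] at h3
  rw [← h2, ← h3, h1]

/-- The rotation about the axis by the angle `t`. -/
def rotation (t : ℝ) : Matrix.orthogonalGroup (Fin 2) ℝ :=
  ⟨!![Real.cos t, -Real.sin t; Real.sin t, Real.cos t], by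
    rw [Matrix.mem_orthogonalGroup_iff']
    ext i j
    fin_cases i <;> fin_cases j <;> simp [Matrix.mul_apply, Fin.sum_univ_two] <;>
      nlinarith [Real.sin_sq_add_cos_sq t]⟩

lemma act_rotation (t : ℝ) (x : E3) :
    act (rotation t) x = Real.cos t • !₂[x 0, x 1, 0] + Real.sin t • rot x + !₂[0, 0, x 2] := by
  ext k
  fin_cases k <;> simp [act, rotation, rot]
  ring

lemma act_rotation_zero (x : E3) : act (rotation 0) x = x := by
  ext k
  fin_cases k <;> simp [act, rotation]

lemma hasDerivAt_act_rotation (x : E3) (t : ℝ) :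
    HasDerivAt (fun t => act (rotation t) x) (rot (act (rotation t) x)) t := by
  simp_rw [act_rotation]
  have h := ((((Real.hasDerivAt_cos t).smul_const (!₂[x 0, x 1, 0] : E3)).add
    ((Real.hasDerivAt_sin t).smul_const (rot x))).add_const (!₂[0, 0, x 2] : E3))
  have e : rot (Real.cos t • !₂[x 0, x 1, 0] + Real.sin t • rot x + !₂[0, 0, x 2])
      = -Real.sin t • !₂[x 0, x 1, 0] + Real.cos t • rot x := by
    ext k
    fin_cases k <;> simp [rot]
    ring
  rw [e]
  exact h

/-- The angular derivative `x₁ ∂₂ - x₂ ∂₁`. -/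
def angDeriv (φ : E3 → ℝ) (x : E3) : ℝ := fderiv ℝ φ x (rot x)

lemma rot_eq (x : E3) :
    rot x = x 0 • (EuclideanSpace.single 1 1 : E3) - x 1 • (EuclideanSpace.single 0 1 : E3) := by
  ext k
  fin_cases k <;> simp [rot]

lemma angDeriv_eq (φ : E3 → ℝ) (x : E3) :
    angDeriv φ x = x 0 * partialDeriv 1 φ x - x 1 * partialDeriv 0 φ x := by
  unfold angDeriv partialDeriv
  rw [rot_eq, map_sub, map_smul, map_smul]
  rfl

lemma isTest_angDeriv {φ : E3 → ℝ} (hφ : IsTest φ) : IsTest (angDeriv φ) := by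
  have e : angDeriv φ = fun x => x 0 * partialDeriv 1 φ x - x 1 * partialDeriv 0 φ x := by
    ext x; exact angDeriv_eq φ x
  have h1 := (hφ.partialDeriv 1).smul_left (contDiff_apply_coord 0)
  have h0 := (hφ.partialDeriv 0).smul_left (contDiff_apply_coord 1)
  rw [e]
  refine ⟨h1.1.sub h0.1, ?_⟩
  have := h1.2.add h0.2.neg
  simpa [sub_eq_add_neg, Pi.add_def, Pi.neg_def] using this

/-- Functions which are invariant under rotations have vanishing angular derivative in the sense
of distributions. -/
lemma integral_mul_angDeriv {g : E3 → ℝ} (hg : LocallyIntegrable g volume) (hinv : InvariantO g)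
    {φ : E3 → ℝ} (hφ : IsTest φ) : ∫ x, g x * angDeriv φ x = 0 := by
  have hL := isTest_angDeriv hφ
  obtain ⟨C, hC⟩ := hL.2.exists_bound_of_continuous hL.continuous
  obtain ⟨R, hR⟩ := hL.2.isCompact.isBounded.subset_closedBall (0 : E3)
  set K : Set E3 := Metric.closedBall 0 R
  have hC0 : 0 ≤ C := (norm_nonneg _).trans (hC 0)
  have hcont : ∀ t, Continuous (act (rotation t)) := fun t =>
    (actIsometry (rotation t)).continuous
  have hact : ∀ t (ψ : E3 → ℝ), IsTest ψ → Integrable (fun x => g x * ψ (act (rotation t) x))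
      volume := by
    intro t ψ hψ
    have hc : HasCompactSupport fun x => ψ (act (rotation t) x) :=
      hψ.2.comp_homeomorph
        ((actIsometry (rotation t)).toLinearIsometryEquiv rfl).toHomeomorph
    have := hg.integrable_smul_left_of_hasCompactSupport (hψ.continuous.comp (hcont t)) hc
    simpa [mul_comm] using this
  -- Rotations preserve balls about the origin, so one ball contains the supports for all angles and
  -- gives a bound independent of `t`.
  have hbound : ∀ x t, ‖g x * angDeriv φ (act (rotation t) x)‖ ≤ K.indicator (fun x => ‖g x‖ * C) x := by
    intro x t
    by_cases hx : x ∈ K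
    · rw [Set.indicator_of_mem hx, norm_mul]
      gcongr
      exact hC _
    · rw [Set.indicator_of_notMem hx, image_eq_zero_of_notMem_tsupport (f := angDeriv φ)]
      · simp
      · intro h
        apply hx
        have := hR h
        rw [mem_closedBall_zero_iff, norm_act] at this
        exact mem_closedBall_zero_iff.2 this
  have hKi : Integrable (K.indicator fun x => ‖g x‖ * C) volume := by
    rw [integrable_indicator_iff Metric.isClosed_closedBall.measurableSet]
    exact ((hg.integrableOn_isCompact (isCompact_closedBall _ _)).norm.mul_const C)
  -- Differentiate `t ↦ ∫ g · (φ ∘ R_t)` at zero. By invariance of `g` and of the measure this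
  -- function is constant, so the derivative, which is the wanted integral, vanishes.
  have key := hasDerivAt_integral_of_dominated_loc_of_deriv_le (μ := (volume : Measure E3))
    (F := fun t x => g x * φ (act (rotation t) x))
    (F' := fun t x => g x * angDeriv φ (act (rotation t) x)) (x₀ := (0 : ℝ))
    (s := Set.univ) (bound := K.indicator fun x => ‖g x‖ * C) univ_mem
    (Eventually.of_forall fun t => (hact t φ hφ).aestronglyMeasurable)
    (hact 0 φ hφ) (hact 0 _ hL).aestronglyMeasurable
    (ae_of_all _ fun x t _ => hbound x t) hKi
    (ae_of_all _ fun x t _ => by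
      have h1 := (hφ.differentiable (act (rotation t) x)).hasFDerivAt.comp_hasDerivAt t
        (hasDerivAt_act_rotation x t)
      exact h1.const_mul (g x))
  have hconst : (fun t => ∫ x, g x * φ (act (rotation t) x)) = fun _ => ∫ x, g x * φ x := by
    ext t
    rw [← (measurePreserving_act (rotation t)).integral_comp (measurableEmbedding_act _)
      (fun x => g x * φ x)]
    refine integral_congr_ae ?_
    filter_upwards [hinv (rotation t)] with x hx
    rw [hx]
  have h2 := key.2
  rw [hconst] at h2
  have h3 := h2.unique (hasDerivAt_const (0 : ℝ) _)
  simpa [act_rotation_zero] using h3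

/-- Each coefficient of `x 0 ∂₁ - x 1 ∂₀` is independent of the variable being differentiated, so
integration by parts produces no zero order term. -/
lemma IsWeakPartial.integral_angDeriv {u v0 v1 : E3 → ℝ} (h0 : IsWeakPartial 0 u v0)
    (h1 : IsWeakPartial 1 u v1) {φ : E3 → ℝ} (hφ : IsTest φ) :
    ∫ x, φ x * (x 0 * v1 x - x 1 * v0 x) = -∫ x, u x * angDeriv φ x := by
  have t0 : IsTest (fun x => x 0 * φ x) := hφ.smul_left (contDiff_apply_coord 0)
  have t1 : IsTest (fun x => x 1 * φ x) := hφ.smul_left (contDiff_apply_coord 1)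
  have e1 := h1.2.2 _ t0
  have e0 := h0.2.2 _ t1
  have d1 : ∀ x, CurlCurl.partialDeriv 1 (fun x : E3 => x 0 * φ x) x
      = x 0 * CurlCurl.partialDeriv 1 φ x := by
    intro x
    rw [partialDeriv_mul 1 ((contDiff_apply_coord 0).differentiable (by simp) x)
      (hφ.differentiable x), partialDeriv_apply]
    simp
  have d0 : ∀ x, CurlCurl.partialDeriv 0 (fun x : E3 => x 1 * φ x) x
      = x 1 * CurlCurl.partialDeriv 0 φ x := by
    intro x
    rw [partialDeriv_mul 0 ((contDiff_apply_coord 1).differentiable (by simp) x)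
      (hφ.differentiable x), partialDeriv_apply]
    simp
  simp_rw [d1] at e1
  simp_rw [d0] at e0
  have i1 := ((hφ.partialDeriv 1).smul_left (contDiff_apply_coord 0)).smul_integrable h1.1
  have i0 := ((hφ.partialDeriv 0).smul_left (contDiff_apply_coord 1)).smul_integrable h0.1
  have j1 := t0.smul_integrable h1.2.1
  have j0 := t1.smul_integrable h0.2.1
  have f1 : ∀ x, φ x * (x 0 * v1 x - x 1 * v0 x)
      = (x 0 * φ x) • v1 x - (x 1 * φ x) • v0 x := by
    intro x; simp only [smul_eq_mul]; ring
  have f2 : ∀ x, u x * angDeriv φ x = (x 0 * CurlCurl.partialDeriv 1 φ x) • u x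
      - (x 1 * CurlCurl.partialDeriv 0 φ x) • u x := by
    intro x; rw [angDeriv_eq]; simp only [smul_eq_mul]; ring
  simp_rw [f1, f2]
  have r1 : ∫ x, ((x 0 * φ x) • v1 x - (x 1 * φ x) • v0 x)
    = (∫ x, (x 0 * φ x) • v1 x) - ∫ x, (x 1 * φ x) • v0 x := integral_sub j1 j0
  have r2 : ∫ x, ((x 0 * CurlCurl.partialDeriv 1 φ x) • u x
      - (x 1 * CurlCurl.partialDeriv 0 φ x) • u x)
    = (∫ x, (x 0 * CurlCurl.partialDeriv 1 φ x) • u x)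
      - ∫ x, (x 1 * CurlCurl.partialDeriv 0 φ x) • u x := integral_sub i1 i0
  rw [r1, r2, e1, e0]
  ring

lemma locallyIntegrable_angular {v0 v1 : E3 → ℝ} (h0 : LocallyIntegrable v0 volume)
    (h1 : LocallyIntegrable v1 volume) :
    LocallyIntegrable (fun x : E3 => x 0 * v1 x - x 1 * v0 x) volume :=
  (locallyIntegrable_continuous_smul (contDiff_apply_coord 0).continuous h1).sub
    (locallyIntegrable_continuous_smul (contDiff_apply_coord 1).continuous h0)

/-- The weak angular derivative of an invariant function vanishes. -/
lemma InvariantO.angular_eq_zero {u v0 v1 : E3 → ℝ} (hu : InvariantO u)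
    (h0 : IsWeakPartial 0 u v0) (h1 : IsWeakPartial 1 u v1) :
    ∀ᵐ x : E3, x 0 * v1 x - x 1 * v0 x = 0 := by
  refine ae_eq_zero_of_integral_contDiff_smul_eq_zero
    (locallyIntegrable_angular h0.2.1 h1.2.1) fun φ hφ hc => ?_
  have ht : IsTest φ := ⟨hφ, hc⟩
  have := h0.integral_angDeriv h1 ht
  rw [integral_mul_angDeriv h0.1 hu ht, neg_zero] at this
  exact this

lemma angDeriv_mul {φ χ : E3 → ℝ} {x : E3} (hφ : DifferentiableAt ℝ φ x)
    (hχ : DifferentiableAt ℝ χ x) :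
    angDeriv (fun x => φ x * χ x) x = angDeriv φ x * χ x + φ x * angDeriv χ x := by
  rw [angDeriv_eq, angDeriv_eq, angDeriv_eq, partialDeriv_mul _ hφ hχ, partialDeriv_mul _ hφ hχ]
  ring

/-- The regularised radius is constant along rotations, so the angular derivative acts on `x j`
alone and turns it into the corresponding entry of `rot`. -/
lemma angDeriv_dirReg {ε : ℝ} (hε : ε ≠ 0) {j : Fin 3} (hj : j ≠ 2) (x : E3) :
    angDeriv (dirReg ε j) x = (rot x) j * (radReg ε x)⁻¹ := by
  rw [angDeriv_eq, partialDeriv_dirReg hε, partialDeriv_dirReg hε]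
  fin_cases j
  · simp [horiz, rot]; ring
  · simp [horiz, rot]; ring
  · exact absurd rfl hj

lemma abs_rot_le (x : E3) (j : Fin 3) : |rot x j| ≤ rad x := by
  have := PiLp.norm_apply_le (rot x) j
  rwa [norm_rot] at this

/-- The weak angular derivative of the product of an invariant function with `x_j / r`. -/
lemma InvariantO.angular_dir_mul {u v0 v1 : E3 → ℝ} (hu : InvariantO u)
    (hul : LocallyIntegrable u volume) {j : Fin 3} (hj : j ≠ 2)
    (h0 : IsWeakPartial 0 (fun x => dir j x * u x) v0)
    (h1 : IsWeakPartial 1 (fun x => dir j x * u x) v1) :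
    ∀ᵐ x : E3, x 0 * v1 x - x 1 * v0 x = rot x j / rad x * u x := by
  have hqm : Measurable fun x : E3 => rot x j / rad x := by
    refine Measurable.div ?_ measurable_rad
    refine Continuous.measurable ?_
    simp_rw [rot_eq]
    fun_prop
  have hql : LocallyIntegrable (fun x => rot x j / rad x * u x) volume :=
    hul.mono (hqm.aestronglyMeasurable.mul hul.aestronglyMeasurable) (ae_of_all _ fun x => by
      rw [norm_mul]
      refine mul_le_of_le_one_left (norm_nonneg _) ?_
      rw [Real.norm_eq_abs, abs_div, abs_of_nonneg (rad_nonneg x)]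
      exact div_le_one_of_le₀ (abs_rot_le x j) (rad_nonneg x))
  have hz : ∀ᵐ x : E3, x 0 * v1 x - x 1 * v0 x - rot x j / rad x * u x = 0 := by
    refine ae_eq_zero_of_integral_contDiff_smul_eq_zero
      ((locallyIntegrable_angular h0.2.1 h1.2.1).sub hql) fun φ hφ hc => ?_
    have ht : IsTest φ := ⟨hφ, hc⟩
    have hLt := isTest_angDeriv ht
    have e1 := h0.integral_angDeriv h1 ht
    -- Invariance of `u` is tested with `φ` times the regularised angular function; Leibniz splits
    -- the vanishing integral into these two terms.
    have hn : ∀ n, (∫ x, angDeriv φ x • (dirReg (epsSeq n) j x * u x))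
        + ∫ x, φ x • (rot x j * (radReg (epsSeq n) x)⁻¹ * u x) = 0 := by
      intro n
      have hε := epsSeq_ne_zero n
      have hT : IsTest fun x => φ x * dirReg (epsSeq n) j x :=
        ht.smul_right (contDiff_dirReg hε j)
      have e2 := integral_mul_angDeriv hul hu hT
      have la : LocallyIntegrable (fun x => dirReg (epsSeq n) j x * u x) volume :=
        locallyIntegrable_continuous_smul (contDiff_dirReg hε j).continuous hul
      have lb : LocallyIntegrable (fun x => rot x j * (radReg (epsSeq n) x)⁻¹ * u x) volume := by
        refine locallyIntegrable_continuous_smul (Continuous.mul ?_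
          (contDiff_inv_radReg hε).continuous) hul
        simp_rw [rot_eq]
        fun_prop
      rw [← integral_add (hLt.smul_integrable la) (ht.smul_integrable lb), ← e2]
      congr 1
      ext x
      rw [angDeriv_mul (ht.differentiable x) ((contDiff_dirReg hε j).differentiable (by simp) x),
        angDeriv_dirReg hε hj]
      simp only [smul_eq_mul]; ring
    have l1 : Tendsto (fun n => ∫ x, angDeriv φ x • (dirReg (epsSeq n) j x * u x)) atTop
        (𝓝 (∫ x, angDeriv φ x • (dir j x * u x))) := by
      refine tendsto_integral_of_dominated_convergence (fun x => ‖angDeriv φ x • u x‖)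
        (fun n => hLt.continuous.aestronglyMeasurable.smul
          ((contDiff_dirReg (epsSeq_ne_zero n) j).continuous.aestronglyMeasurable.mul
            hul.aestronglyMeasurable)) (hLt.smul_integrable hul).norm
        (fun n => ae_of_all _ fun x => ?_) ?_
      · rw [norm_smul, norm_smul, norm_mul]
        gcongr
        exact mul_le_of_le_one_left (norm_nonneg _) (abs_dirReg_le (epsSeq_ne_zero n) hj x)
      · filter_upwards [ae_rad_ne_zero] with x hx
        exact ((tendsto_dirReg j hx).mul_const _).const_smul _
    have l2 : Tendsto (fun n => ∫ x, φ x • (rot x j * (radReg (epsSeq n) x)⁻¹ * u x)) atTop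
        (𝓝 (∫ x, φ x • (rot x j / rad x * u x))) := by
      refine tendsto_integral_of_dominated_convergence (fun x => ‖φ x • u x‖)
        (fun n => ht.continuous.aestronglyMeasurable.smul
          (AEStronglyMeasurable.mul (Continuous.aestronglyMeasurable ?_)
            hul.aestronglyMeasurable)) (ht.smul_integrable hul).norm
        (fun n => ae_of_all _ fun x => ?_) ?_
      · refine Continuous.mul ?_ (contDiff_inv_radReg (epsSeq_ne_zero n)).continuous
        simp_rw [rot_eq]
        fun_prop
      · rw [norm_smul, norm_smul, norm_mul]
        gcongr
        refine mul_le_of_le_one_left (norm_nonneg _) ?_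
        have hp := radReg_pos (epsSeq_ne_zero n) x
        rw [← div_eq_mul_inv, Real.norm_eq_abs, abs_div, abs_of_pos hp, div_le_one hp]
        exact (abs_rot_le x j).trans (rad_le_radReg _ x)
      · filter_upwards [ae_rad_ne_zero] with x hx
        simp_rw [div_eq_mul_inv]
        exact ((((tendsto_radReg x).inv₀ hx).const_mul _).mul_const _).const_smul _
    have e3 := tendsto_nhds_unique (l1.add l2) (by simp_rw [hn]; exact tendsto_const_nhds)
    have i1 := ht.smul_integrable (locallyIntegrable_angular h0.2.1 h1.2.1)
    have i2 := ht.smul_integrable hql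
    simp_rw [smul_sub]
    simp_rw [smul_sub] at i1
    have r : ∫ x, (φ x • (x 0 * v1 x) - φ x • (x 1 * v0 x) - φ x • (rot x j / rad x * u x))
      = (∫ x, (φ x • (x 0 * v1 x) - φ x • (x 1 * v0 x)))
        - ∫ x, φ x • (rot x j / rad x * u x) := integral_sub i1 i2
    rw [r]
    have e4 : ∫ x, (φ x • (x 0 * v1 x) - φ x • (x 1 * v0 x))
        = -∫ x, angDeriv φ x • (dir j x * u x) := by
      simp only [smul_eq_mul]
      simp_rw [mul_sub] at e1
      rw [e1]
      congr 2; ext x; ring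
    rw [e4]
    linarith
  filter_upwards [hz] with x hx
  linarith

end Rotation

/-! ### Functions with `v / r` in `L²`. -/

section Weighted
variable {F : Type*} [NormedAddCommGroup F] [NormedSpace ℝ F]

/-- `v / r` belongs to `L²`. -/
def AxisL2 (v : E3 → F) : Prop := MemLp (fun x => (rad x)⁻¹ • v x) 2 volume

lemma AxisL2.locallyIntegrable {v : E3 → F} (h : AxisL2 v) :
    LocallyIntegrable (fun x => (rad x)⁻¹ • v x) volume := MemLp.locallyIntegrable h one_le_two

lemma AxisL2.mono {F' : Type*} [NormedAddCommGroup F'] [NormedSpace ℝ F']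
    {v : E3 → F} {w : E3 → F'} (h : AxisL2 v)
    (hw : AEStronglyMeasurable w volume) (hb : ∀ᵐ x, ‖w x‖ ≤ ‖v x‖) : AxisL2 w := by
  refine MemLp.mono h (measurable_rad.inv.aestronglyMeasurable.smul hw) ?_
  filter_upwards [hb] with x hx
  rw [norm_smul, norm_smul]
  gcongr

lemma AxisL2.const_smul {v : E3 → F} (h : AxisL2 v) (c : ℝ) : AxisL2 (c • v) := by
  have := MemLp.const_smul h c
  refine MemLp.ae_eq (ae_of_all _ fun x => ?_) this
  simp [smul_comm c]

lemma mem_spaceX_iff {u : E3 → ℝ} : u ∈ spaceX ↔ MemD12 u ∧ AxisL2 u := by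
  unfold spaceX AxisL2
  simp only [Set.mem_ofPred_eq]
  refine and_congr_right fun h => ?_
  have hm : AEStronglyMeasurable (fun x => (rad x)⁻¹ • u x) volume :=
    measurable_rad.inv.aestronglyMeasurable.smul h.1.1
  rw [memLp_two_iff_integrable_sq hm]
  refine integrable_congr (ae_of_all _ fun x => ?_)
  simp only [smul_eq_mul, div_eq_mul_inv]
  ring

/-- The derivative of `x j / r` is at most `2 / r`, so the only critical term of the product rule is
bounded by `v / r ∈ L²`. -/
lemma HasWeakGrad.dir_mul {v : E3 → ℝ} {w : Fin 3 → E3 → ℝ} (h : HasWeakGrad v w)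
    (hr : AxisL2 v) {j : Fin 3} (hj : j ≠ 2) :
    HasWeakGrad (fun x => dir j x * v x)
      (fun i x => dirDeriv i j x * v x + dir j x * w i x) := by
  have hm : ∀ {p : ENNReal} {z : E3 → ℝ}, MemLp z p volume →
      MemLp (fun x => dir j x * z x) p volume := fun {p z} hz =>
    hz.mono ((measurable_dir j).aestronglyMeasurable.mul hz.1) (ae_of_all _ fun x => by
      rw [norm_mul]
      exact mul_le_of_le_one_left (norm_nonneg _) (abs_dir_le hj x))
  refine ⟨hm h.1, fun i => ⟨(h.2 i).1.dir_smul hj hr.locallyIntegrable, ?_⟩⟩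
  refine MemLp.add ?_ (hm (h.2 i).2)
  refine (MemLp.const_smul hr (2 : ℝ)).mono
    ((measurable_dirDeriv i j).aestronglyMeasurable.mul h.1.1) ?_
  filter_upwards [ae_rad_ne_zero] with x hx
  simp only [Pi.smul_apply, norm_smul, norm_mul, norm_inv, Real.norm_of_nonneg (rad_nonneg x),
    ← mul_assoc]
  gcongr
  rw [Real.norm_two, ← div_eq_mul_inv]
  exact abs_dirDeriv_le i hj hx

lemma HasWeakGrad.apply {V : E3 → E3} {B : Fin 3 → E3 → E3} (h : HasWeakGrad V B) (j : Fin 3) :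
    HasWeakGrad (fun x => V x j) (fun i x => B i x j) :=
  ⟨(EuclideanSpace.proj j : E3 →L[ℝ] ℝ).comp_memLp' h.1, fun i => ⟨(h.2 i).1.apply j,
    (EuclideanSpace.proj j : E3 →L[ℝ] ℝ).comp_memLp' (h.2 i).2⟩⟩

lemma memLp_pi {V : E3 → E3} {p : ENNReal} (h : ∀ j, MemLp (fun x => V x j) p volume) :
    MemLp V p volume := by
  have h2 : MemLp (fun x => ∑ j, V x j • (EuclideanSpace.single j 1 : E3)) p volume :=
    memLp_finsetSum _ fun j _ =>
      ((ContinuousLinearMap.id ℝ ℝ).smulRight (EuclideanSpace.single j 1 : E3)).comp_memLp' (h j)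
  refine h2.ae_eq (ae_of_all _ fun x => ?_)
  ext k
  fin_cases k <;> simp [Fin.sum_univ_three]

lemma hasWeakGrad_pi {V : E3 → E3} {B : Fin 3 → E3 → E3}
    (h : ∀ j, HasWeakGrad (fun x => V x j) (fun i x => B i x j)) : HasWeakGrad V B :=
  ⟨memLp_pi fun j => (h j).1, fun i => ⟨isWeakPartial_pi fun j => ((h j).2 i).1,
    memLp_pi fun j => ((h j).2 i).2⟩⟩

lemma AxisL2.apply {V : E3 → E3} (h : AxisL2 V) (j : Fin 3) : AxisL2 (fun x => V x j) := by
  have := (EuclideanSpace.proj j : E3 →L[ℝ] ℝ).comp_memLp' (h : MemLp _ 2 volume)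
  exact this

end Weighted

/-! ### Azimuthal fields, and the equivalence of the two spaces. -/

section Angular

/-- The azimuthal field `v τ` with amplitude `v`. -/
def tauField (v : E3 → ℝ) (x : E3) : E3 := (v x / rad x) • rot x

/-- The azimuthal component `τ · V`. -/
def tauComp (V : E3 → E3) (x : E3) : ℝ := dir 0 x * V x 1 - dir 1 x * V x 0

/-- The radial component `ρ · V`. -/
def rhoComp (V : E3 → E3) (x : E3) : ℝ := dir 0 x * V x 0 + dir 1 x * V x 1

/-- The gradient of `v τ`. -/
def tauFieldGrad (v : E3 → ℝ) (w : Fin 3 → E3 → ℝ) (i : Fin 3) (x : E3) : E3 :=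
  !₂[-(dirDeriv i 1 x * v x + dir 1 x * w i x), dirDeriv i 0 x * v x + dir 0 x * w i x, 0]

/-- The gradient of `τ · V`. -/
def tauCompGrad (V : E3 → E3) (B : Fin 3 → E3 → E3) (i : Fin 3) (x : E3) : ℝ :=
  (dirDeriv i 0 x * V x 1 + dir 0 x * B i x 1) - (dirDeriv i 1 x * V x 0 + dir 1 x * B i x 0)

/-- The gradient of `ρ · V`. -/
def rhoCompGrad (V : E3 → E3) (B : Fin 3 → E3 → E3) (i : Fin 3) (x : E3) : ℝ :=
  (dirDeriv i 0 x * V x 0 + dir 0 x * B i x 0) + (dirDeriv i 1 x * V x 1 + dir 1 x * B i x 1)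

lemma tauField_zero (v : E3 → ℝ) (x : E3) : tauField v x 0 = -(dir 1 x * v x) := by
  simp [tauField, rot, dir]; ring

lemma tauField_one (v : E3 → ℝ) (x : E3) : tauField v x 1 = dir 0 x * v x := by
  simp [tauField, rot, dir]; ring

lemma tauField_two (v : E3 → ℝ) (x : E3) : tauField v x 2 = 0 := by
  simp [tauField, rot]

lemma dir_sq_add {x : E3} (hx : rad x ≠ 0) : dir 0 x ^ 2 + dir 1 x ^ 2 = 1 := by
  unfold dir
  have := rad_sq x
  field_simp
  exact this.symm

lemma norm_tauField (v : E3 → ℝ) {x : E3} (hx : rad x ≠ 0) : ‖tauField v x‖ = |v x| := by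
  unfold tauField
  rw [norm_smul, norm_rot, norm_div, Real.norm_of_nonneg (rad_nonneg x), div_mul_cancel₀ _ hx,
    Real.norm_eq_abs]

lemma norm_tauField_le (v : E3 → ℝ) (x : E3) : ‖tauField v x‖ ≤ |v x| := by
  rcases eq_or_ne (rad x) 0 with hx | hx
  · simp [tauField, hx]
  · exact (norm_tauField v hx).le

lemma tauComp_tauField (v : E3 → ℝ) {x : E3} (hx : rad x ≠ 0) : tauComp (tauField v) x = v x := by
  unfold tauComp
  rw [tauField_one, tauField_zero]
  linear_combination v x * dir_sq_add hx

lemma HasWeakGrad.tauField {v : E3 → ℝ} {w : Fin 3 → E3 → ℝ} (h : HasWeakGrad v w)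
    (hr : AxisL2 v) : HasWeakGrad (tauField v) (tauFieldGrad v w) := by
  refine hasWeakGrad_pi fun j => ?_
  fin_cases j
  · refine ((h.dir_mul hr (j := 1) (by decide)).const_smul (-1)).congr
      (ae_of_all _ fun x => ?_) fun i => ae_of_all _ fun x => ?_
    · simpa using (tauField_zero v x).symm
    · simp [tauFieldGrad]
  · refine (h.dir_mul hr (j := 0) (by decide)).congr
      (ae_of_all _ fun x => ?_) fun i => ae_of_all _ fun x => ?_
    · simpa using (tauField_one v x).symm
    · simp [tauFieldGrad]
  · refine (h.const_smul 0).congr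
      (ae_of_all _ fun x => ?_) fun i => ae_of_all _ fun x => ?_
    · simpa using (tauField_two v x).symm
    · simp [tauFieldGrad]

lemma HasWeakGrad.tauComp {V : E3 → E3} {B : Fin 3 → E3 → E3} (h : HasWeakGrad V B)
    (hr : AxisL2 V) : HasWeakGrad (tauComp V) (tauCompGrad V B) := by
  refine (((h.apply 1).dir_mul (hr.apply 1) (j := 0) (by decide)).add
    (((h.apply 0).dir_mul (hr.apply 0) (j := 1) (by decide)).const_smul (-1))).congr
      (ae_of_all _ fun x => ?_) fun i => ae_of_all _ fun x => ?_
  · simp [CurlCurl.tauComp, sub_eq_add_neg]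
  · simp [tauCompGrad]; ring

lemma HasWeakGrad.rhoComp {V : E3 → E3} {B : Fin 3 → E3 → E3} (h : HasWeakGrad V B)
    (hr : AxisL2 V) : HasWeakGrad (rhoComp V) (rhoCompGrad V B) := by
  refine (((h.apply 0).dir_mul (hr.apply 0) (j := 0) (by decide)).add
    (((h.apply 1).dir_mul (hr.apply 1) (j := 1) (by decide)))).congr
      (ae_of_all _ fun x => ?_) fun i => ae_of_all _ fun x => ?_
  · simp [CurlCurl.rhoComp]
  · simp [rhoCompGrad]

lemma abs_apply_le (y : E3) (j : Fin 3) : |y j| ≤ ‖y‖ := PiLp.norm_apply_le y j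

lemma abs_tauComp_le (V : E3 → E3) (x : E3) : |tauComp V x| ≤ 2 * ‖V x‖ := by
  unfold tauComp
  have h : ∀ (a : Fin 3) (b : Fin 3), a ≠ 2 → |dir a x * V x b| ≤ ‖V x‖ := by
    intro a b ha
    rw [abs_mul]
    exact (mul_le_of_le_one_left (abs_nonneg _) (abs_dir_le ha x)).trans (abs_apply_le _ b)
  calc _ ≤ _ := abs_sub _ _
    _ ≤ 2 * ‖V x‖ := by linarith [h 0 1 (by decide), h 1 0 (by decide)]

lemma aestronglyMeasurable_tauComp {V : E3 → E3} (hV : AEStronglyMeasurable V volume) :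
    AEStronglyMeasurable (tauComp V) volume := by
  have h : ∀ j, AEStronglyMeasurable (fun x => V x j) volume := fun j =>
    (EuclideanSpace.proj j : E3 →L[ℝ] ℝ).continuous.comp_aestronglyMeasurable hV
  exact ((measurable_dir 0).aestronglyMeasurable.mul (h 1)).sub
    ((measurable_dir 1).aestronglyMeasurable.mul (h 0))

lemma AxisL2.tauComp {V : E3 → E3} (hr : AxisL2 V) (hV : AEStronglyMeasurable V volume) :
    AxisL2 (tauComp V) := by
  refine (hr.const_smul 2).mono (aestronglyMeasurable_tauComp hV) (ae_of_all _ fun x => ?_)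
  simp only [Pi.smul_apply, norm_smul, Real.norm_two]
  exact abs_tauComp_le V x

/-- The azimuthal amplitude of an element of `𝒟_ℱ` is square integrable against `1 / r²`. -/
lemma HasWeakGrad.axisL2_of_tauField {u : E3 → ℝ} (hu : InvariantO u) {A : Fin 3 → E3 → E3}
    (h : HasWeakGrad (CurlCurl.tauField u) A) : AxisL2 (CurlCurl.tauField u) := by
  have hum : MemLp u 6 volume := by
    have hu' : CurlCurl.tauComp (CurlCurl.tauField u) =ᵐ[volume] u := by
      filter_upwards [ae_rad_ne_zero] with x hx
      exact tauComp_tauField u hx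
    have hm : AEStronglyMeasurable u volume := (aestronglyMeasurable_tauComp h.1.1).congr hu'
    refine h.1.mono hm ?_
    filter_upwards [ae_rad_ne_zero] with x hx
    rw [norm_tauField u hx, Real.norm_eq_abs]
  have hul : LocallyIntegrable u volume := hum.locallyIntegrable (by norm_num)
  have w0 : ∀ i, IsWeakPartial i (fun x => dir 0 x * u x) (fun x => A i x 1) := fun i =>
    ((h.2 i).1.apply 1).congr (ae_of_all _ fun x => tauField_one u x) (ae_eq_refl _)
  have w1 : ∀ i, IsWeakPartial i (fun x => dir 1 x * u x) (fun x => (-1 : ℝ) • A i x 0) := fun i =>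
    (((h.2 i).1.apply 0).const_smul (-1)).congr (ae_of_all _ fun x => by
      simp [tauField_zero]) (ae_eq_refl _)
  -- The angular derivative swaps, up to sign, `(x 0 / r) u` and `(x 1 / r) u`, and it is also
  -- bounded by `r` times the gradient of the field. Dividing by `r` bounds `u / r`; the factor 2 in
  -- the majorant comes from adding the two components.
  have a0 := hu.angular_dir_mul hul (j := 0) (by decide) (w0 0) (w0 1)
  have a1 := hu.angular_dir_mul hul (j := 1) (by decide) (w1 0) (w1 1)
  have hb : MemLp (fun x => (2 : ℝ) • (‖A 0 x‖ + ‖A 1 x‖)) 2 volume :=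
    ((h.2 0).2.norm.add (h.2 1).2.norm).const_smul (2 : ℝ)
  refine MemLp.mono hb (measurable_rad.inv.aestronglyMeasurable.smul h.1.1) ?_
  filter_upwards [ae_rad_ne_zero, a0, a1] with x hx h0 h1
  have hr : 0 < rad x := lt_of_le_of_ne (rad_nonneg x) hx.symm
  rw [norm_smul, norm_inv, norm_tauField u hx, Real.norm_of_nonneg hr.le,
    Real.norm_of_nonneg (by positivity), inv_mul_le_iff₀ hr, smul_eq_mul]
  have e0 : |dir 1 x * u x| ≤ rad x * (‖A 0 x‖ + ‖A 1 x‖) := by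
    have : dir 1 x * u x = -(x 0 * A 1 x 1 - x 1 * A 0 x 1) := by
      rw [h0]; simp [rot, dir]; ring
    rw [this, abs_neg]
    refine (abs_sub _ _).trans ?_
    rw [abs_mul, abs_mul, mul_add, add_comm]
    exact add_le_add (mul_le_mul (abs_apply_le_rad x (by decide)) (PiLp.norm_apply_le (A 0 x) 1)
      (abs_nonneg _) hr.le) (mul_le_mul (abs_apply_le_rad x (by decide))
      (PiLp.norm_apply_le (A 1 x) 1) (abs_nonneg _) hr.le)
  have e1 : |dir 0 x * u x| ≤ rad x * (‖A 0 x‖ + ‖A 1 x‖) := by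
    have : dir 0 x * u x = -(x 0 * A 1 x 0 - x 1 * A 0 x 0) := by
      have : x 0 * ((-1 : ℝ) • A 1 x 0) - x 1 * ((-1 : ℝ) • A 0 x 0) = dir 0 x * u x := by
        rw [h1]; simp [rot, dir]
      rw [← this]; simp only [smul_eq_mul]; ring
    rw [this, abs_neg]
    refine (abs_sub _ _).trans ?_
    rw [abs_mul, abs_mul, mul_add, add_comm]
    exact add_le_add (mul_le_mul (abs_apply_le_rad x (by decide)) (PiLp.norm_apply_le (A 0 x) 0)
      (abs_nonneg _) hr.le) (mul_le_mul (abs_apply_le_rad x (by decide))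
      (PiLp.norm_apply_le (A 1 x) 0) (abs_nonneg _) hr.le)
  -- The numbers `|dir 0 x|` and `|dir 1 x|` are at most one and their squares sum to one, so their
  -- sum is at least one.
  have e2 : |u x| ≤ |dir 0 x * u x| + |dir 1 x * u x| := by
    rw [abs_mul, abs_mul, ← add_mul]
    refine le_mul_of_one_le_left (abs_nonneg _) ?_
    have h2 := dir_sq_add hx
    have h3 := abs_dir_le (j := 0) (by decide) x
    have h4 := abs_dir_le (j := 1) (by decide) x
    rw [← sq_abs (dir 0 x), ← sq_abs (dir 1 x)] at h2
    nlinarith [abs_nonneg (dir 0 x), abs_nonneg (dir 1 x)]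
  linarith

/-- The correspondence between invariant amplitudes and azimuthal fields. -/
theorem mem_spaceDF_iff {U : E3 → E3} {u : E3 → ℝ} (hU : U =ᵐ[volume] tauField u) :
    U ∈ spaceDF ↔ u ∈ spaceXO := by
  constructor
  · rintro ⟨hD, b, hb, hUb⟩
    -- Off the axis the amplitude is recovered as `τ · U`, so the unspecified invariant `b` is `u`;
    -- this is how invariance of `u` is obtained.
    have hbu : b =ᵐ[volume] u := by
      filter_upwards [hU, hUb, ae_rad_ne_zero] with x h1 h2 hx
      rw [← tauComp_tauField b hx, ← tauComp_tauField u hx]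
      unfold tauComp
      rw [← h1, show tauField b x = U x from h2.symm]
    have hu : InvariantO u := hb.congr hbu
    have hD' : MemD12 U := hD
    have hg : HasWeakGrad (tauField u) (fun i => weakPartial i U) :=
      hD'.hasWeakGrad.congr hU fun i => ae_eq_refl _
    have hr := hg.axisL2_of_tauField hu
    have hc : tauComp (tauField u) =ᵐ[volume] u := by
      filter_upwards [ae_rad_ne_zero] with x hx
      exact tauComp_tauField u hx
    -- With `U / r ∈ L²` now known, the product rule applies to `τ · U`.
    have hu' : HasWeakGrad u (tauCompGrad (tauField u) fun i => weakPartial i U) :=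
      (hg.tauComp hr).congr hc fun i => ae_eq_refl _
    refine ⟨mem_spaceX_iff.2 ⟨hu'.memD12, ?_⟩, hu⟩
    refine (hr.tauComp hg.1.1).mono hu'.1.1 ?_
    filter_upwards [hc] with x hx
    rw [hx]
  · rintro ⟨hX, hu⟩
    obtain ⟨hD, hr⟩ := mem_spaceX_iff.1 hX
    have hg := hD.hasWeakGrad.tauField hr
    exact ⟨(hg.congr hU.symm fun i => ae_eq_refl _).memD12, u, hu, hU⟩

end Angular

/-! ### Hölder pairings and their continuity. -/

section Pairing
variable {F : Type*} [NormedAddCommGroup F]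

lemma integrable_norm_mul {f g : E3 → F} {p q : ENNReal} [ENNReal.HolderTriple p q 1]
    (hf : MemLp f p volume) (hg : MemLp g q volume) :
    Integrable (fun x => ‖f x‖ * ‖g x‖) volume := MemLp.integrable_mul hf.norm hg.norm

lemma integral_norm_mul_le {f g : E3 → F} {p q : ENNReal} [ENNReal.HolderTriple p q 1]
    (hf : MemLp f p volume) (hg : MemLp g q volume) :
    ∫ x, ‖f x‖ * ‖g x‖ ≤ (eLpNorm f p volume).toReal * (eLpNorm g q volume).toReal := by
  rw [← ENNReal.toReal_mul]
  have h : eLpNorm ((fun x => ‖f x‖) • (fun x => ‖g x‖)) 1 volume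
      ≤ eLpNorm f p volume * eLpNorm g q volume := by
    refine (eLpNorm_smul_le_mul_eLpNorm (p := p) (q := q) (r := 1) hg.1.norm hf.1.norm).trans ?_
    rw [eLpNorm_norm, eLpNorm_norm]
  have h2 : ∫ x, ‖f x‖ * ‖g x‖
      = (eLpNorm ((fun x => ‖f x‖) • (fun x => ‖g x‖)) 1 volume).toReal := by
    rw [eLpNorm_one_eq_lintegral_enorm, ← integral_norm_eq_lintegral_enorm
      (hf.1.norm.smul hg.1.norm)]
    congr 1; ext x; simp
  rw [h2]
  exact ENNReal.toReal_mono (ENNReal.mul_lt_top hf.2 hg.2).ne h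

variable [InnerProductSpace ℝ F]

lemma integrable_inner_of_memLp {f g : E3 → F} {p q : ENNReal} [ENNReal.HolderTriple p q 1]
    (hf : MemLp f p volume) (hg : MemLp g q volume) :
    Integrable (fun x => inner ℝ (f x) (g x)) volume := by
  have h := MemLp.integrable_mul hf.norm hg.norm
  refine h.mono (hf.1.inner hg.1) (ae_of_all _ fun x => ?_)
  simpa using abs_real_inner_le_norm (f x) (g x)

lemma abs_integral_inner_le {f g : E3 → F} {p q : ENNReal} [ENNReal.HolderTriple p q 1]
    (hf : MemLp f p volume) (hg : MemLp g q volume) :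
    |∫ x, inner ℝ (f x) (g x)| ≤ (eLpNorm f p volume).toReal * (eLpNorm g q volume).toReal := by
  refine le_trans ?_ (integral_norm_mul_le hf hg)
  rw [← Real.norm_eq_abs]
  exact norm_integral_le_of_norm_le (integrable_norm_mul hf hg)
    (ae_of_all _ fun x => abs_real_inner_le_norm (f x) (g x))

lemma tendsto_integral_inner {f g : E3 → F} {p q : ENNReal} [ENNReal.HolderTriple p q 1]
    (hf : MemLp f p volume) (hg : MemLp g q volume) {φ : ℕ → E3 → F}
    (hφ : ∀ n, MemLp (φ n) q volume)
    (hlim : Tendsto (fun n => eLpNorm (fun x => φ n x - g x) q volume) atTop (𝓝 0)) :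
    Tendsto (fun n => ∫ x, inner ℝ (f x) (φ n x)) atTop (𝓝 (∫ x, inner ℝ (f x) (g x))) := by
  rw [tendsto_iff_norm_sub_tendsto_zero]
  have h0 := (ENNReal.tendsto_toReal (a := 0) (by simp)).comp hlim
  have h1 := h0.const_mul (eLpNorm f p volume).toReal
  simp only [ENNReal.toReal_zero, mul_zero] at h1
  refine tendsto_of_tendsto_of_tendsto_of_le_of_le tendsto_const_nhds h1
    (fun n => norm_nonneg _) fun n => ?_
  simp only
  rw [← integral_sub (integrable_inner_of_memLp hf (hφ n)) (integrable_inner_of_memLp hf hg)]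
  simp_rw [← inner_sub_right]
  exact abs_integral_inner_le hf ((hφ n).sub hg)

lemma tendsto_integral_mul {f g : E3 → ℝ} {p q : ENNReal} [ENNReal.HolderTriple p q 1]
    (hf : MemLp f p volume) (hg : MemLp g q volume) {φ : ℕ → E3 → ℝ}
    (hφ : ∀ n, MemLp (φ n) q volume)
    (hlim : Tendsto (fun n => eLpNorm (fun x => φ n x - g x) q volume) atTop (𝓝 0)) :
    Tendsto (fun n => ∫ x, f x * φ n x) atTop (𝓝 (∫ x, f x * g x)) := by
  simpa [mul_comm] using tendsto_integral_inner hf hg hφ hlim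

lemma integrable_mul_of_memLp {f g : E3 → ℝ} {p q : ENNReal} [ENNReal.HolderTriple p q 1]
    (hf : MemLp f p volume) (hg : MemLp g q volume) :
    Integrable (fun x => f x * g x) volume := MemLp.integrable_mul hf hg

end Pairing

/-! ### Curl form, gradient form and the form of the scalar problem. -/

section Quadratic

lemma partialDeriv_comm {φ : E3 → ℝ} (hφ : IsTest φ) (i j : Fin 3) (x : E3) :
    partialDeriv i (partialDeriv j φ) x = partialDeriv j (partialDeriv i φ) x := by
  have hs : IsSymmSndFDerivAt ℝ φ x :=
    hφ.1.contDiffAt.isSymmSndFDerivAt (by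
      rw [minSmoothness_of_isRCLikeNormedField]; exact WithTop.coe_le_coe.2 le_top)
  have h : ∀ a b : Fin 3, partialDeriv a (partialDeriv b φ) x
      = fderiv ℝ (fderiv ℝ φ) x (EuclideanSpace.single a 1) (EuclideanSpace.single b 1) := by
    intro a b
    have hd : DifferentiableAt ℝ (fderiv ℝ φ) x :=
      ((hφ.1.fderiv_right (m := (⊤ : ℕ∞)) (by simp)).differentiable (by simp)) x
    have h1 := (hd.hasFDerivAt.clm_apply
      (hasFDerivAt_const (EuclideanSpace.single b 1 : E3) x)).fderiv
    unfold partialDeriv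
    rw [h1]
    simp
  rw [h, h]
  exact hs _ _

/-- Mixed second order terms can be exchanged in the quadratic form of the gradient. -/
lemma HasWeakGrad.integral_mul_comm {a b : E3 → ℝ} {α β : Fin 3 → E3 → ℝ} (ha : HasWeakGrad a α)
    (hb : HasWeakGrad b β) (i j : Fin 3) :
    ∫ x, α i x * β j x = ∫ x, α j x * β i x := by
  obtain ⟨φ, hφ, -, h2⟩ := hb.exists_seq
  have l := fun i j => tendsto_integral_mul (ha.2 i).2 (hb.2 j).2
    (fun n => ((hφ n).partialDeriv j).memLp 2) (h2 j)
  refine tendsto_nhds_unique (l i j) ((l j i).congr fun n => ?_)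
  -- Only `b` is replaced by test functions: their second derivatives commute, and one of the two
  -- derivatives is moved onto `a`.
  have e1 := (ha.2 i).1.2.2 _ ((hφ n).partialDeriv j)
  have e2 := (ha.2 j).1.2.2 _ ((hφ n).partialDeriv i)
  simp_rw [partialDeriv_comm (hφ n) i j] at e1
  rw [e1] at e2
  have := neg_injective e2
  simp only [smul_eq_mul] at this
  simp_rw [mul_comm (α _ _)]
  exact this.symm

lemma inner_eq_sum (y z : E3) : inner ℝ y z = y 0 * z 0 + y 1 * z 1 + y 2 * z 2 := by
  rw [PiLp.inner_apply]
  simp [Fin.sum_univ_three, mul_comm]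

/-- The curl of a field with gradient `A`. -/
def curlOf (A : Fin 3 → E3 → E3) (x : E3) : E3 :=
  !₂[A 1 x 2 - A 2 x 1, A 2 x 0 - A 0 x 2, A 0 x 1 - A 1 x 0]

lemma HasWeakGrad.curl_ae {V : E3 → E3} {B : Fin 3 → E3 → E3} (h : HasWeakGrad V B) :
    curl V =ᵐ[volume] curlOf B := by
  filter_upwards [h.weakPartial_ae 0, h.weakPartial_ae 1, h.weakPartial_ae 2] with x h0 h1 h2
  simp only [curl, curlOf, h0, h1, h2]

/-- For a divergence free field the bilinear forms of the curl and of the gradient agree. -/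
lemma integral_inner_curlOf {U V : E3 → E3} {A B : Fin 3 → E3 → E3} (hU : HasWeakGrad U A)
    (hV : HasWeakGrad V B) (hdiv : ∀ᵐ x, A 0 x 0 + A 1 x 1 + A 2 x 2 = 0) :
    ∫ x, inner ℝ (curlOf A x) (curlOf B x) = ∫ x, ∑ i, inner ℝ (A i x) (B i x) := by
  have hi : ∀ i j k l, Integrable (fun x => A i x j * B k x l) volume := fun i j k l =>
    integrable_mul_of_memLp ((hU.apply j).2 i).2 ((hV.apply l).2 k).2
  have hc : ∀ i j k l, ∫ x, A i x j * B k x l = ∫ x, A k x j * B i x l := fun i j k l =>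
    (hU.apply j).integral_mul_comm (hV.apply l) i k
  -- Pointwise the product of curls is the product of gradients minus the trace of the product of
  -- the two gradient matrices. Adding `div U · div V`, which is zero, turns that trace into a sum
  -- of exchanged pairs, each with vanishing integral.
  have e : ∀ᵐ x, inner ℝ (curlOf A x) (curlOf B x) = (∑ i, inner ℝ (A i x) (B i x))
      - ((A 0 x 1 * B 1 x 0 - A 1 x 1 * B 0 x 0) + (A 1 x 0 * B 0 x 1 - A 0 x 0 * B 1 x 1)
        + (A 0 x 2 * B 2 x 0 - A 2 x 2 * B 0 x 0) + (A 2 x 0 * B 0 x 2 - A 0 x 0 * B 2 x 2)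
        + (A 1 x 2 * B 2 x 1 - A 2 x 2 * B 1 x 1) + (A 2 x 1 * B 1 x 2 - A 1 x 1 * B 2 x 2)) := by
    filter_upwards [hdiv] with x hx
    simp only [inner_eq_sum, Fin.sum_univ_three, curlOf, Matrix.cons_val_zero, Matrix.cons_val_one,
      Matrix.cons_val]
    linear_combination -(B 0 x 0 + B 1 x 1 + B 2 x 2) * hx
  rw [integral_congr_ae e]
  have add0 : ∀ {f g : E3 → ℝ}, (Integrable f volume ∧ ∫ x, f x = 0) →
      (Integrable g volume ∧ ∫ x, g x = 0) →
      Integrable (fun x => f x + g x) volume ∧ ∫ x, (f x + g x) = 0 := fun hf hg =>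
    ⟨hf.1.add hg.1, by rw [integral_add hf.1 hg.1, hf.2, hg.2, add_zero]⟩
  have hz : ∀ i j k l, Integrable (fun x => A i x j * B k x l - A k x j * B i x l) volume ∧
      ∫ x, (A i x j * B k x l - A k x j * B i x l) = 0 := fun i j k l =>
    ⟨(hi i j k l).sub (hi k j i l), by
      rw [integral_sub (hi _ _ _ _) (hi _ _ _ _), hc, sub_self]⟩
  have hs : Integrable (fun x => ∑ i, inner ℝ (A i x) (B i x)) volume :=
    integrable_finsetSum _ fun i _ => integrable_inner_of_memLp (hU.2 i).2 (hV.2 i).2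
  have hall := add0 (add0 (add0 (add0 (add0 (hz 0 1 1 0) (hz 1 0 0 1)) (hz 0 2 2 0)) (hz 2 0 0 2))
    (hz 1 2 2 1)) (hz 2 1 1 2)
  rw [integral_sub hs hall.1, hall.2, sub_zero]

lemma dirDeriv_zero_zero {x : E3} (hx : rad x ≠ 0) :
    dirDeriv 0 0 x = dir 1 x ^ 2 * (rad x)⁻¹ := by
  have := rad_sq x
  simp [dirDeriv, horiz, dir]
  field_simp
  linarith

lemma dirDeriv_one_one {x : E3} (hx : rad x ≠ 0) :
    dirDeriv 1 1 x = dir 0 x ^ 2 * (rad x)⁻¹ := by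
  have := rad_sq x
  simp [dirDeriv, horiz, dir]
  field_simp
  linarith

lemma dirDeriv_zero_one {x : E3} (hx : rad x ≠ 0) :
    dirDeriv 0 1 x = -(dir 0 x * dir 1 x * (rad x)⁻¹) := by
  simp [dirDeriv, horiz, dir]
  field_simp

lemma dirDeriv_one_zero {x : E3} (hx : rad x ≠ 0) :
    dirDeriv 1 0 x = -(dir 0 x * dir 1 x * (rad x)⁻¹) := by
  simp [dirDeriv, horiz, dir]
  field_simp

lemma dirDeriv_two {j : Fin 3} (hj : j ≠ 2) (x : E3) : dirDeriv 2 j x = 0 := by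
  simp [dirDeriv, horiz, hj.symm]

lemma dir_angular {v0 v1 : E3 → ℝ} {x : E3} (h : x 0 * v1 x - x 1 * v0 x = 0) :
    dir 0 x * v1 x - dir 1 x * v0 x = 0 := by
  unfold dir
  have : x 0 / rad x * v1 x - x 1 / rad x * v0 x = (x 0 * v1 x - x 1 * v0 x) / rad x := by ring
  rw [this, h, zero_div]

/-- The divergence is `u div τ + τ · ∇u`: the first term cancels identically and the second is the
angular derivative of an invariant function divided by `r`. -/
lemma InvariantO.div_tauFieldGrad {u : E3 → ℝ} {w : Fin 3 → E3 → ℝ} (hu : InvariantO u)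
    (h : HasWeakGrad u w) :
    ∀ᵐ x, tauFieldGrad u w 0 x 0 + tauFieldGrad u w 1 x 1 + tauFieldGrad u w 2 x 2 = 0 := by
  filter_upwards [ae_rad_ne_zero, hu.angular_eq_zero (h.2 0).1 (h.2 1).1] with x hx hw
  have := dir_angular hw
  simp [tauFieldGrad, dirDeriv_zero_one hx, dirDeriv_one_zero hx]
  linarith

lemma radReg_act (ε : ℝ) (g : Matrix.orthogonalGroup (Fin 2) ℝ) (x : E3) :
    radReg ε (act g x) = radReg ε x := by
  have h := rad_act g x
  have h2 := rad_sq x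
  have h3 := rad_sq (act g x)
  unfold radReg
  rw [← h2, ← h3, h]

/-- The function `u / r²` need not be locally integrable, so the weight is first regularised; the
regularised weight is still invariant. Then `a` is approximated by test functions. -/
lemma InvariantO.integral_radReg_mul_angular {u : E3 → ℝ} (hinv : InvariantO u)
    (hu : LocallyIntegrable u volume) (hr : AxisL2 u) {a : E3 → ℝ}
    {α : Fin 3 → E3 → ℝ} (ha : HasWeakGrad a α) {ε : ℝ} (hε : ε ≠ 0) :
    ∫ x, u x * (radReg ε x)⁻¹ ^ 2 * (x 0 * α 1 x - x 1 * α 0 x) = 0 := by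
  obtain ⟨φ, hφ, -, h2⟩ := ha.exists_seq
  have hc : Continuous fun x => (radReg ε x)⁻¹ ^ 2 := (contDiff_inv_radReg hε).continuous.pow 2
  have hg : LocallyIntegrable (fun x => u x * (radReg ε x)⁻¹ ^ 2) volume := by
    simpa [mul_comm] using locallyIntegrable_continuous_smul hc hu
  have hginv : InvariantO (fun x => u x * (radReg ε x)⁻¹ ^ 2) := by
    intro g
    filter_upwards [hinv g] with x hx
    rw [hx, radReg_act]
  -- Since `|x j| / (r² + ε²) ≤ 1 / r`, this function is dominated by `u / r`, so it pairs with an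
  -- arbitrary gradient in `L²`.
  have hm : ∀ j : Fin 3, j ≠ 2 → MemLp (fun x => u x * (radReg ε x)⁻¹ ^ 2 * x j) 2 volume := by
    intro j hj
    refine MemLp.mono hr ((hu.aestronglyMeasurable.mul hc.aestronglyMeasurable).mul
      (contDiff_apply_coord j).continuous.aestronglyMeasurable) ?_
    filter_upwards [ae_rad_ne_zero] with x hx
    have hr0 : 0 < rad x := lt_of_le_of_ne (rad_nonneg x) hx.symm
    have hs := radReg_pos hε x
    rw [norm_mul, norm_mul, norm_smul, norm_pow, norm_inv, norm_inv, Real.norm_of_nonneg hs.le,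
      Real.norm_of_nonneg hr0.le, mul_comm ((rad x)⁻¹), mul_assoc]
    refine mul_le_mul_of_nonneg_left ?_ (norm_nonneg _)
    have h1 : ‖x j‖ ≤ rad x := abs_apply_le_rad x hj
    have h3 : (radReg ε x)⁻¹ ≤ (rad x)⁻¹ := inv_anti₀ hr0 (rad_le_radReg ε x)
    calc (radReg ε x)⁻¹ ^ 2 * ‖x j‖ ≤ (rad x)⁻¹ ^ 2 * rad x := by gcongr
      _ = (rad x)⁻¹ := by field_simp
  have l : ∀ j k : Fin 3, j ≠ 2 → Tendsto
      (fun n => ∫ x, (u x * (radReg ε x)⁻¹ ^ 2 * x j) * partialDeriv k (φ n) x) atTop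
      (𝓝 (∫ x, (u x * (radReg ε x)⁻¹ ^ 2 * x j) * α k x)) := fun j k hj =>
    tendsto_integral_mul (hm j hj) (ha.2 k).2 (fun n => ((hφ n).partialDeriv k).memLp 2) (h2 k)
  have hi : ∀ j k : Fin 3, j ≠ 2 → ∀ {β : E3 → ℝ}, MemLp β 2 volume →
      Integrable (fun x => (u x * (radReg ε x)⁻¹ ^ 2 * x j) * β x) volume := fun j k hj β hβ =>
    integrable_mul_of_memLp (hm j hj) hβ
  have hsplit : ∀ {β γ : E3 → ℝ}, MemLp β 2 volume → MemLp γ 2 volume →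
      ∫ x, u x * (radReg ε x)⁻¹ ^ 2 * (x 0 * β x - x 1 * γ x)
        = (∫ x, (u x * (radReg ε x)⁻¹ ^ 2 * x 0) * β x)
          - ∫ x, (u x * (radReg ε x)⁻¹ ^ 2 * x 1) * γ x := by
    intro β γ hβ hγ
    rw [← integral_sub (hi 0 0 (by decide) hβ) (hi 1 0 (by decide) hγ)]
    congr 1; ext x; ring
  have hn : ∀ n, (∫ x, (u x * (radReg ε x)⁻¹ ^ 2 * x 0) * partialDeriv 1 (φ n) x)
      - ∫ x, (u x * (radReg ε x)⁻¹ ^ 2 * x 1) * partialDeriv 0 (φ n) x = 0 := by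
    intro n
    rw [← hsplit (((hφ n).partialDeriv 1).memLp 2) (((hφ n).partialDeriv 0).memLp 2),
      ← integral_mul_angDeriv hg hginv (hφ n)]
    simp_rw [angDeriv_eq]
  rw [hsplit (ha.2 1).2 (ha.2 0).2]
  refine tendsto_nhds_unique ((l 0 1 (by decide)).sub (l 1 0 (by decide))) ?_
  simp_rw [hn]
  exact tendsto_const_nhds

/-- Limit `ε → 0` of the regularised identity: one power of `1 / r` goes to `u`, the other is
absorbed by the coefficients of the angular derivative, which are at most `r`. -/
lemma InvariantO.integral_mul_angular {u : E3 → ℝ} (hinv : InvariantO u)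
    (hu : LocallyIntegrable u volume) (hr : AxisL2 u) {a : E3 → ℝ}
    {α : Fin 3 → E3 → ℝ} (ha : HasWeakGrad a α) :
    Integrable (fun x => u x * (rad x)⁻¹ ^ 2 * (x 0 * α 1 x - x 1 * α 0 x)) volume ∧
    ∫ x, u x * (rad x)⁻¹ ^ 2 * (x 0 * α 1 x - x 1 * α 0 x) = 0 := by
  have hb : Integrable (fun x => ‖(rad x)⁻¹ • u x‖ * (‖α 1 x‖ + ‖α 0 x‖)) volume :=
    MemLp.integrable_mul (MemLp.norm hr) ((ha.2 1).2.norm.add (ha.2 0).2.norm)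
  have hxm : ∀ j : Fin 3, AEStronglyMeasurable (fun x : E3 => x j) volume := fun j =>
    (contDiff_apply_coord j).continuous.aestronglyMeasurable
  have hm : AEStronglyMeasurable (fun x => x 0 * α 1 x - x 1 * α 0 x) volume :=
    ((hxm 0).mul (ha.2 1).2.1).sub ((hxm 1).mul (ha.2 0).2.1)
  have key : ∀ (x : E3) (s : ℝ), rad x ≠ 0 → rad x ≤ s →
      ‖u x * s⁻¹ ^ 2 * (x 0 * α 1 x - x 1 * α 0 x)‖
        ≤ ‖(rad x)⁻¹ • u x‖ * (‖α 1 x‖ + ‖α 0 x‖) := by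
    intro x s hx hs
    have hr0 : 0 < rad x := lt_of_le_of_ne (rad_nonneg x) hx.symm
    have hs0 : 0 < s := hr0.trans_le hs
    have h1 : ‖x 0 * α 1 x - x 1 * α 0 x‖ ≤ rad x * (‖α 1 x‖ + ‖α 0 x‖) := by
      refine (norm_sub_le _ _).trans ?_
      rw [norm_mul, norm_mul, mul_add]
      gcongr
      · exact abs_apply_le_rad x (by decide)
      · exact abs_apply_le_rad x (by decide)
    rw [norm_mul, norm_mul, norm_smul, norm_pow, norm_inv, norm_inv, Real.norm_of_nonneg hs0.le,
      Real.norm_of_nonneg hr0.le]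
    calc ‖u x‖ * s⁻¹ ^ 2 * ‖x 0 * α 1 x - x 1 * α 0 x‖
        ≤ ‖u x‖ * (rad x)⁻¹ ^ 2 * (rad x * (‖α 1 x‖ + ‖α 0 x‖)) := by gcongr
      _ = (rad x)⁻¹ * ‖u x‖ * (‖α 1 x‖ + ‖α 0 x‖) := by field_simp
  have hum := hu.aestronglyMeasurable
  refine ⟨hb.mono' ((hum.mul (measurable_rad.inv.pow_const 2).aestronglyMeasurable).mul hm) ?_, ?_⟩
  · filter_upwards [ae_rad_ne_zero] with x hx
    exact key x _ hx le_rfl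
  · have l := tendsto_integral_of_dominated_convergence
      (F := fun (n : ℕ) x => u x * (radReg (epsSeq n) x)⁻¹ ^ 2 * (x 0 * α 1 x - x 1 * α 0 x))
      (f := fun x => u x * (rad x)⁻¹ ^ 2 * (x 0 * α 1 x - x 1 * α 0 x))
      (μ := (volume : Measure E3)) _ (fun n => (hum.mul
        ((contDiff_inv_radReg (epsSeq_ne_zero n)).continuous.pow 2).aestronglyMeasurable).mul hm) hb
      (fun n => by
        filter_upwards [ae_rad_ne_zero] with x hx
        exact key x _ hx (rad_le_radReg _ x))
      (by
        filter_upwards [ae_rad_ne_zero] with x hx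
        exact ((((tendsto_radReg x).inv₀ hx).pow 2).const_mul _).mul_const _)
    refine tendsto_nhds_unique l ?_
    simp_rw [hinv.integral_radReg_mul_angular hu hr ha (epsSeq_ne_zero _)]
    exact tendsto_const_nhds

/-- The gradient form of an azimuthal field with invariant amplitude `u`, tested with `V`, is the
form of the scalar problem, tested with `τ · V`. -/
lemma InvariantO.integral_inner_tauFieldGrad {u : E3 → ℝ} {w : Fin 3 → E3 → ℝ}
    (hinv : InvariantO u) (hu : HasWeakGrad u w) (hr : AxisL2 u) {V : E3 → E3}
    {B : Fin 3 → E3 → E3} (hV : HasWeakGrad V B) (hVr : AxisL2 V) :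
    ∫ x, ∑ i, inner ℝ (tauFieldGrad u w i x) (B i x)
      = ∫ x, ((∑ i, w i x * tauCompGrad V B i x) + 1 / rad x ^ 2 * (u x * tauComp V x)) := by
  have hul : LocallyIntegrable u volume := hu.1.locallyIntegrable (by norm_num)
  obtain ⟨hci, hc0⟩ := hinv.integral_mul_angular hul hr (hV.rhoComp hVr)
  have hmain : Integrable (fun x => (∑ i, w i x * tauCompGrad V B i x)
      + 1 / rad x ^ 2 * (u x * tauComp V x)) volume := by
    refine Integrable.add (integrable_finsetSum _ fun i _ =>
      integrable_mul_of_memLp (hu.2 i).2 ((hV.tauComp hVr).2 i).2) ?_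
    refine (MemLp.integrable_mul hr (hVr.tauComp hV.1.1)).congr (ae_of_all _ fun x => ?_)
    simp only [Pi.mul_apply, smul_eq_mul]
    ring
  -- Writing `V` in the moving frame `ρ, τ`, the two integrands differ exactly by `u / r²` times the
  -- angular derivative of `ρ · V`. The identity uses that the angular derivative of `u` vanishes.
  have e : ∀ᵐ x, ∑ i, inner ℝ (tauFieldGrad u w i x) (B i x)
      = ((∑ i, w i x * tauCompGrad V B i x) + 1 / rad x ^ 2 * (u x * tauComp V x))
        - u x * (rad x)⁻¹ ^ 2 * (x 0 * rhoCompGrad V B 1 x - x 1 * rhoCompGrad V B 0 x) := by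
    filter_upwards [ae_rad_ne_zero, hinv.angular_eq_zero (hu.2 0).1 (hu.2 1).1] with x hx hw
    have hw' := dir_angular hw
    have hcs := dir_sq_add hx
    have e0 : (rad x)⁻¹ ^ 2 * x 0 = (rad x)⁻¹ * dir 0 x := by unfold dir; field_simp
    have e1 : (rad x)⁻¹ ^ 2 * x 1 = (rad x)⁻¹ * dir 1 x := by unfold dir; field_simp
    have e2 : u x * (rad x)⁻¹ ^ 2 * (x 0 * rhoCompGrad V B 1 x - x 1 * rhoCompGrad V B 0 x)
        = u x * (rad x)⁻¹ * (dir 0 x * rhoCompGrad V B 1 x - dir 1 x * rhoCompGrad V B 0 x) := by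
      linear_combination u x * rhoCompGrad V B 1 x * e0 - u x * rhoCompGrad V B 0 x * e1
    rw [e2, one_div, ← inv_pow]
    simp only [inner_eq_sum, Fin.sum_univ_three, tauFieldGrad, tauCompGrad, rhoCompGrad, tauComp,
      Matrix.cons_val_zero, Matrix.cons_val_one, Matrix.cons_val,
      dirDeriv_zero_zero hx, dirDeriv_zero_one hx, dirDeriv_one_zero hx, dirDeriv_one_one hx,
      dirDeriv_two (j := 0) (by decide), dirDeriv_two (j := 1) (by decide)]
    linear_combination (rad x)⁻¹ * (dir 0 x * V x 0 + dir 1 x * V x 1) * hw'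
      + (rad x)⁻¹ ^ 2 * u x * (dir 0 x * V x 1 - dir 1 x * V x 0) * hcs
  rw [integral_congr_ae e, integral_sub hmain hci, hc0, sub_zero]

end Quadratic

/-! ### Pointwise structure of the nonlinearities. -/

section Pointwise

/-- The pointwise structure of the nonlinearities: `φ = f(x, ·)` and `η = h(x, ·)`. -/
structure NonlinAt (C : ℝ) (φ : ℝ → ℝ) (η : E3 → E3) : Prop where
  continuous : Continuous φ
  nonneg : 0 ≤ C
  bound : ∀ s, |φ s| ≤ C * |s| ^ 5
  apply_smul : ∀ (α : ℝ) (w : E3), ‖w‖ = 1 → η (α • w) = φ α • w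

variable {C : ℝ} {φ : ℝ → ℝ} {η : E3 → E3}

lemma NonlinAt.zero (H : NonlinAt C φ η) : φ 0 = 0 := by
  have := H.bound 0
  simpa using this

lemma exists_norm_eq_one : ∃ w : E3, ‖w‖ = 1 := ⟨EuclideanSpace.single 0 1, by simp⟩

lemma NonlinAt.vec_zero (H : NonlinAt C φ η) : η 0 = 0 := by
  obtain ⟨w, hw⟩ := exists_norm_eq_one
  have := H.apply_smul 0 w hw
  simpa [H.zero] using this

/-- The vector `s w` is also `(-s)(-w)`, with `-w` again a unit vector; comparing the two values of
`η` forces `φ` to be odd. -/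
lemma NonlinAt.odd (H : NonlinAt C φ η) (s : ℝ) : φ (-s) = -φ s := by
  obtain ⟨w, hw⟩ := exists_norm_eq_one
  have h1 := H.apply_smul s w hw
  have h2 := H.apply_smul (-s) (-w) (by rwa [norm_neg])
  rw [smul_neg, neg_smul, neg_neg, h1, smul_neg, ← neg_smul] at h2
  have hw0 : w ≠ 0 := by rintro rfl; simp at hw
  have : φ s = -φ (-s) := smul_left_injective ℝ hw0 h2
  linarith

lemma NonlinAt.vec_eq (H : NonlinAt C φ η) (W : E3) : η W = (φ ‖W‖ / ‖W‖) • W := by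
  rcases eq_or_ne W 0 with rfl | hW
  · simp [H.vec_zero]
  · have hn : ‖W‖ ≠ 0 := norm_ne_zero_iff.2 hW
    have h1 := H.apply_smul ‖W‖ (‖W‖⁻¹ • W) (by
      rw [norm_smul, norm_inv, norm_norm, inv_mul_cancel₀ hn])
    rw [smul_smul, mul_inv_cancel₀ hn, one_smul, smul_smul] at h1
    rw [h1, div_eq_mul_inv]

lemma NonlinAt.norm_vec_le (H : NonlinAt C φ η) (W : E3) : ‖η W‖ ≤ C * ‖W‖ ^ 5 := by
  rw [H.vec_eq, norm_smul, norm_div, norm_norm]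
  rcases eq_or_ne W 0 with rfl | hW
  · simp
  · rw [div_mul_cancel₀ _ (norm_ne_zero_iff.2 hW)]
    simpa using H.bound ‖W‖

/-- The primitive of `φ`. -/
def prim (φ : ℝ → ℝ) (s : ℝ) : ℝ := ∫ t in (0 : ℝ)..s, φ t

lemma NonlinAt.prim_neg (H : NonlinAt C φ η) (s : ℝ) : prim φ (-s) = prim φ s := by
  unfold prim
  have h := intervalIntegral.integral_comp_neg (a := 0) (b := s) φ
  simp_rw [H.odd, neg_zero] at h
  rw [intervalIntegral.integral_symm, ← h, intervalIntegral.integral_neg, neg_neg]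

lemma NonlinAt.prim_abs (H : NonlinAt C φ η) (s : ℝ) : prim φ |s| = prim φ s := by
  rcases abs_choice s with h | h <;> rw [h]
  exact H.prim_neg s

lemma prim_eq_mul (φ : ℝ → ℝ) (s : ℝ) : prim φ s = s * ∫ t in (0 : ℝ)..1, φ (s * t) := by
  have := intervalIntegral.smul_integral_comp_mul_left (a := 0) (b := 1) φ s
  simp only [mul_zero, mul_one, smul_eq_mul] at this
  exact this.symm

/-- The potential of the vector nonlinearity is the primitive at the norm. -/
lemma NonlinAt.potential_eq (H : NonlinAt C φ η) (W : E3) :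
    ∫ t in (0 : ℝ)..1, inner ℝ (η (t • W)) W = prim φ ‖W‖ := by
  rcases eq_or_ne W 0 with rfl | hW
  · simp [prim]
  · have hn : ‖W‖ ≠ 0 := norm_ne_zero_iff.2 hW
    rw [prim_eq_mul, ← intervalIntegral.integral_const_mul]
    congr 1
    ext t
    have h1 := H.apply_smul (‖W‖ * t) (‖W‖⁻¹ • W) (by
      rw [norm_smul, norm_inv, norm_norm, inv_mul_cancel₀ hn])
    rw [smul_smul, show ‖W‖ * t * ‖W‖⁻¹ = t by field_simp] at h1
    rw [h1, inner_smul_left, inner_smul_left, real_inner_self_eq_norm_sq]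
    simp
    field_simp

lemma NonlinAt.hasDerivAt_prim (H : NonlinAt C φ η) (s : ℝ) : HasDerivAt (prim φ) (φ s) s :=
  intervalIntegral.integral_hasDerivAt_right (H.continuous.intervalIntegrable _ _)
    (H.continuous.stronglyMeasurableAtFilter _ _) H.continuous.continuousAt

lemma NonlinAt.abs_prim_sub_le (H : NonlinAt C φ η) {s t m : ℝ} (hs : |s| ≤ m) (ht : |t| ≤ m) :
    |prim φ t - prim φ s| ≤ C * m ^ 5 * |t - s| := by
  have hC := H.nonneg
  have e : prim φ t - prim φ s = ∫ y in s..t, φ y :=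
    intervalIntegral.integral_interval_sub_left (H.continuous.intervalIntegrable _ _)
      (H.continuous.intervalIntegrable _ _)
  rw [e, ← Real.norm_eq_abs (∫ y in s..t, φ y)]
  refine intervalIntegral.norm_integral_le_of_norm_le_const fun y hy => ?_
  refine (H.bound y).trans ?_
  have hy' : |y| ≤ m := by
    rw [Set.mem_uIoc] at hy
    rw [abs_le] at hs ht ⊢
    rcases hy with hy | hy <;> constructor <;> linarith
  gcongr

lemma NonlinAt.abs_prim_le (H : NonlinAt C φ η) (s : ℝ) : |prim φ s| ≤ C * |s| ^ 6 := by
  have := H.abs_prim_sub_le (s := 0) (t := s) (m := |s|) (by simp) le_rfl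
  simp [prim] at this ⊢
  refine this.trans (le_of_eq (by ring))

/-- Away from the origin this is the chain rule. At the origin the norm is not differentiable, but
the bound by the sixth power makes the derivative zero there. -/
lemma NonlinAt.hasFDerivAt (H : NonlinAt C φ η) (W : E3) :
    HasFDerivAt (fun W : E3 => prim φ ‖W‖) (innerSL ℝ (η W)) W := by
  rcases eq_or_ne W 0 with rfl | hW
  · rw [H.vec_zero, map_zero, hasFDerivAt_iff_isLittleO_nhds_zero]
    simp only [zero_add, norm_zero, _root_.zero_apply, sub_zero]
    have h0 : prim φ 0 = 0 := by simp [prim]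
    rw [h0]
    simp only [sub_zero]
    have h1 : (fun y : E3 => prim φ ‖y‖) =O[𝓝 0] fun y : E3 => ‖y‖ ^ 6 := by
      refine Asymptotics.IsBigO.of_bound C (Eventually.of_forall fun y => ?_)
      have := H.abs_prim_le ‖y‖
      simpa using this
    refine h1.trans_isLittleO ?_
    have h2 := (Asymptotics.isLittleO_pow_id (𝕜 := ℝ) (n := 6) (by norm_num)).comp_tendsto
      (tendsto_norm_zero (E := E3))
    exact Asymptotics.IsLittleO.of_norm_right h2
  · have hn : ‖W‖ ≠ 0 := norm_ne_zero_iff.2 hW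
    have h1 := (hasStrictFDerivAt_norm_sq W).hasFDerivAt.sqrt (pow_ne_zero 2 hn)
    simp only [Real.sqrt_sq (norm_nonneg _)] at h1
    have h2 := (H.hasDerivAt_prim ‖W‖).comp_hasFDerivAt W h1
    refine h2.congr_fderiv ?_
    ext y
    rw [H.vec_eq]
    simp
    field_simp

/-- The first order Taylor remainder of the potential. -/
def remainder (φ : ℝ → ℝ) (η : E3 → E3) (W y : E3) : ℝ :=
  prim φ ‖W + y‖ - prim φ ‖W‖ - inner ℝ (η W) y

lemma NonlinAt.remainder_isLittleO (H : NonlinAt C φ η) (W : E3) :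
    (remainder φ η W) =o[𝓝 0] fun y => ‖y‖ := by
  have := hasFDerivAt_iff_isLittleO_nhds_zero.1 (H.hasFDerivAt W)
  exact Asymptotics.IsLittleO.norm_right this

lemma NonlinAt.abs_remainder_le (H : NonlinAt C φ η) (W y : E3) :
    |remainder φ η W y| ≤ 2 * C * (‖W‖ + ‖y‖) ^ 5 * ‖y‖ := by
  have hC := H.nonneg
  have h1 : |prim φ ‖W + y‖ - prim φ ‖W‖| ≤ C * (‖W‖ + ‖y‖) ^ 5 * ‖y‖ := by
    refine (H.abs_prim_sub_le (m := ‖W‖ + ‖y‖) ?_ ?_).trans ?_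
    · rw [abs_norm]; linarith [norm_nonneg y]
    · rw [abs_norm]; exact norm_add_le _ _
    · gcongr
      have := abs_norm_sub_norm_le (W + y) W
      simpa using this
  have h2 : |inner ℝ (η W) y| ≤ C * (‖W‖ + ‖y‖) ^ 5 * ‖y‖ := by
    refine (abs_real_inner_le_norm _ _).trans ?_
    gcongr
    refine (H.norm_vec_le W).trans ?_
    gcongr
    linarith [norm_nonneg y]
  unfold remainder
  calc _ ≤ _ := abs_sub _ _
    _ ≤ _ := add_le_add h1 h2
    _ = _ := by ring

end Pointwise

/-! ### Measurability of superpositions. -/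

section Caratheodory

/-- A Carathéodory function agrees, up to a null set of points `x`, with a jointly measurable
one. -/
lemma CondF1.exists_measurable {f : E3 → ℝ → ℝ} (hf : CondF1 f) :
    ∃ g : E3 → ℝ → ℝ, Measurable (Function.uncurry g) ∧ ∀ᵐ x, f x = g x := by
  classical
  -- Only countably many parameters can share one exceptional null set. Rational ones suffice, since
  -- continuity in `s` determines the rest.
  have hq : ∀ᵐ x, Continuous (f x) ∧ ∀ q : ℚ, f x q = (hf.measurable q).mk _ x :=
    hf.continuous.and (ae_all_iff.2 fun q => (hf.measurable q).ae_eq_mk)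
  obtain ⟨T, hT, hTm, hT0⟩ := exists_measurable_superset_of_null (ae_iff.1 hq)
  have hTc : ∀ x, x ∉ T → Continuous (f x) ∧ ∀ q : ℚ, f x q = (hf.measurable q).mk _ x :=
    fun x hx => by_contra fun hcon => hx (hT hcon)
  set g : E3 → ℝ → ℝ := fun x s => if x ∈ T then 0 else f x s with hg
  have hgc : ∀ x, Continuous (g x) := by
    intro x
    by_cases hx : x ∈ T
    · simp only [hg, hx, if_true]; exact continuous_const
    · simp only [hg, hx, if_false]; exact (hTc x hx).1
  have hgq : ∀ q : ℚ, Measurable fun x => g x q := by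
    intro q
    have : (fun x => g x q) = fun x => if x ∈ T then 0 else (hf.measurable q).mk _ x := by
      ext x
      by_cases hx : x ∈ T
      · simp [hg, hx]
      · simp only [hg, hx, if_false]; exact (hTc x hx).2 q
    rw [this]
    exact Measurable.ite hTm measurable_const (hf.measurable q).measurable_mk
  have hgm : ∀ s : ℝ, Measurable fun x => g x s := by
    intro s
    obtain ⟨q, hqs⟩ : ∃ q : ℕ → ℚ, Tendsto (fun n => (q n : ℝ)) atTop (𝓝 s) := by
      have hs : s ∈ closure (Set.range ((↑) : ℚ → ℝ)) := by
        rw [Rat.denseRange_cast.closure_range]; trivial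
      obtain ⟨y, hy, hy'⟩ := mem_closure_iff_seq_limit.1 hs
      choose q hq using hy
      exact ⟨q, by simpa only [hq] using hy'⟩
    exact measurable_of_tendsto_metrizable (fun n => hgq (q n)) (tendsto_pi_nhds.2 fun x =>
      ((hgc x).tendsto s).comp hqs)
  have hu := measurable_uncurry_of_continuous_of_measurable (u := fun s x => g x s) hgc hgm
  refine ⟨g, hu.comp measurable_swap, ?_⟩
  have hTae : ∀ᵐ x, x ∉ T := measure_eq_zero_iff_ae_notMem.1 hT0
  filter_upwards [hTae] with x hx
  ext s
  simp [hg, hx]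

lemma CondF1.aestronglyMeasurable_comp {f : E3 → ℝ → ℝ} (hf : CondF1 f) {u : E3 → ℝ}
    (hu : AEStronglyMeasurable u volume) : AEStronglyMeasurable (fun x => f x (u x)) volume := by
  obtain ⟨g, hg, hfg⟩ := hf.exists_measurable
  refine ⟨fun x => g x (hu.mk u x), ?_, ?_⟩
  · exact (hg.comp (measurable_id.prodMk hu.measurable_mk)).stronglyMeasurable
  · filter_upwards [hfg, hu.ae_eq_mk] with x h1 h2
    rw [h1, ← h2]

lemma CondF1.aestronglyMeasurable_prim {f : E3 → ℝ → ℝ} (hf : CondF1 f) {u : E3 → ℝ}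
    (hu : AEStronglyMeasurable u volume) :
    AEStronglyMeasurable (fun x => prim (f x) (u x)) volume := by
  obtain ⟨g, hg, hfg⟩ := hf.exists_measurable
  refine ⟨fun x => hu.mk u x * ∫ t in (0 : ℝ)..1, g x (hu.mk u x * t), ?_, ?_⟩
  · refine hu.stronglyMeasurable_mk.mul ?_
    simp_rw [intervalIntegral.integral_of_le (zero_le_one' ℝ)]
    refine StronglyMeasurable.integral_prod_right
      (f := fun x t => g x (hu.mk u x * t)) ?_
    exact (hg.comp (measurable_fst.prodMk
      ((hu.measurable_mk.comp measurable_fst).mul measurable_snd))).stronglyMeasurable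
  · filter_upwards [hfg, hu.ae_eq_mk] with x h1 h2
    rw [h1, prim_eq_mul, h2]

end Caratheodory

/-! ### Differentiability of integral functionals of critical growth. -/

section Nemytskii
open scoped ENNReal NNReal

/-- A nonlinearity of fifth order growth maps `L⁶` into `L^{6/5}`, which is dual to `L⁶`. -/
instance holderTriple_six_fifths : ENNReal.HolderTriple (6 / 5) 6 1 where
  inv_add_inv_eq_inv := by
    rw [ENNReal.inv_div (by simp) (by simp), ← ENNReal.toReal_eq_toReal_iff'
      (ENNReal.add_ne_top.2 ⟨ENNReal.div_ne_top (by simp) (by simp), by simp⟩) (by simp),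
      ENNReal.toReal_add (ENNReal.div_ne_top (by simp) (by simp)) (by simp), ENNReal.toReal_div]
    norm_num

lemma memLp_norm_pow_five {F : Type*} [NormedAddCommGroup F] {k : E3 → F}
    (hk : MemLp k 6 volume) : MemLp (fun x => ‖k x‖ ^ 5) (6 / 5) volume := by
  have := hk.norm_rpow_div 5
  simpa using this

/-- A sequence in `L⁶` with summable norms is dominated by an `L⁶` function and tends to zero
almost everywhere. -/
lemma exists_dominating {V : ℕ → E3 → E3} (hV : ∀ n, MemLp (V n) 6 volume)
    (hs : ∑' n, eLpNorm (V n) 6 volume ^ (6 : ℝ) ≠ ∞) :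
    ∃ S : E3 → ℝ, MemLp S 6 volume ∧ (∀ᵐ x, ∀ n, ‖V n x‖ ≤ S x) ∧
      ∀ᵐ x, Tendsto (fun n => V n x) atTop (𝓝 0) := by
  -- The dominating function is the sixth root of this sum. Where the sum is finite its terms tend
  -- to zero, which gives the convergence almost everywhere.
  set T : E3 → ℝ≥0∞ := fun x => ∑' n, ‖V n x‖ₑ ^ (6 : ℝ) with hT
  have hm : ∀ n, AEMeasurable (fun x => ‖V n x‖ₑ ^ (6 : ℝ)) volume := fun n =>
    (hV n).1.enorm.pow_const _
  have hTm : AEMeasurable T volume := AEMeasurable.tsum hm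
  have e : ∀ n, ∫⁻ x, ‖V n x‖ₑ ^ (6 : ℝ) = eLpNorm (V n) 6 volume ^ (6 : ℝ) := fun n => by
    have := eLpNorm_nnreal_pow_eq_lintegral (μ := (volume : Measure E3)) (f := V n) (p := 6)
      (by norm_num)
    simpa using this.symm
  have hTi : ∫⁻ x, T x ≠ ∞ := by
    rw [hT, lintegral_tsum hm]
    simp_rw [e]
    exact hs
  have hfin := ae_lt_top' hTm hTi
  have h6 : (0 : ℝ) < 6 := by norm_num
  refine ⟨fun x => (T x ^ (6 : ℝ)⁻¹).toReal, ⟨?_, ?_⟩, ?_, ?_⟩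
  · exact (hTm.pow_const _).ennreal_toReal.aestronglyMeasurable
  · rw [eLpNorm_lt_top_iff_lintegral_rpow_enorm_lt_top (by norm_num) (by norm_num)]
    refine lt_of_le_of_lt (lintegral_mono fun x => ?_) hTi.lt_top
    calc ‖(T x ^ (6 : ℝ)⁻¹).toReal‖ₑ ^ (6 : ℝ≥0∞).toReal
        ≤ (T x ^ (6 : ℝ)⁻¹) ^ (6 : ℝ) := by
          rw [Real.enorm_eq_ofReal ENNReal.toReal_nonneg]
          simp only [ENNReal.toReal_ofNat]
          gcongr
          exact ENNReal.ofReal_toReal_le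
      _ = T x := by rw [← ENNReal.rpow_mul, inv_mul_cancel₀ h6.ne', ENNReal.rpow_one]
  · filter_upwards [hfin] with x hx n
    have h1 : ‖V n x‖ₑ ≤ T x ^ (6 : ℝ)⁻¹ := by
      rw [← ENNReal.rpow_le_rpow_iff h6, ← ENNReal.rpow_mul, inv_mul_cancel₀ h6.ne',
        ENNReal.rpow_one]
      exact ENNReal.le_tsum n
    have h2 := ENNReal.toReal_mono (ENNReal.rpow_ne_top_of_nonneg (by positivity) hx.ne) h1
    simpa using h2
  · filter_upwards [hfin] with x hx
    have h1 := ENNReal.tendsto_atTop_zero_of_tsum_ne_top hx.ne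
    have h2 := ((ENNReal.continuous_rpow_const (y := (6 : ℝ)⁻¹)).tendsto 0).comp h1
    rw [ENNReal.zero_rpow_of_pos (by positivity)] at h2
    rw [tendsto_zero_iff_norm_tendsto_zero]
    have h3 := (ENNReal.tendsto_toReal (a := 0) (by simp)).comp h2
    refine h3.congr fun n => ?_
    simp only [Function.comp]
    rw [← ENNReal.rpow_mul, mul_inv_cancel₀ h6.ne', ENNReal.rpow_one, toReal_enorm]

/-- The integrated Taylor remainder of a superposition operator of critical growth is of smaller
order than the `L⁶` norm. -/
lemma exists_remainder_le {R : E3 → E3 → ℝ} {k : E3 → E3} {C : ℝ} (hC : 0 ≤ C)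
    (hk : MemLp k 6 volume)
    (hb : ∀ᵐ x, ∀ y, |R x y| ≤ C * (‖k x‖ + ‖y‖) ^ 5 * ‖y‖)
    (ho : ∀ᵐ x, (R x) =o[𝓝 0] fun y => ‖y‖)
    (hm : ∀ V : E3 → E3, AEStronglyMeasurable V volume →
      AEStronglyMeasurable (fun x => R x (V x)) volume) :
    (∀ V : E3 → E3, MemLp V 6 volume → Integrable (fun x => R x (V x)) volume) ∧
    ∀ ε > 0, ∃ δ > 0, ∀ V : E3 → E3, MemLp V 6 volume → (eLpNorm V 6 volume).toReal < δ →
      |∫ x, R x (V x)| ≤ ε * (eLpNorm V 6 volume).toReal := by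
  -- The difference quotient of the remainder. Division by zero gives 0 where `V` vanishes, and the
  -- growth bound makes `R` vanish there too, so nothing is lost.
  set K : (E3 → E3) → E3 → ℝ := fun V x => |R x (V x)| / ‖V x‖ with hK
  have hKm : ∀ V, AEStronglyMeasurable V volume → AEStronglyMeasurable (K V) volume := fun V hV =>
    ((hm V hV).norm.aemeasurable.div hV.norm.aemeasurable).aestronglyMeasurable
  have hKb : ∀ V : E3 → E3, ∀ᵐ x, ‖K V x‖ ≤ C * (‖k x‖ + ‖V x‖) ^ 5 := by
    intro V
    filter_upwards [hb] with x hx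
    simp only [hK]
    rw [Real.norm_of_nonneg (by positivity)]
    exact div_le_of_le_mul₀ (norm_nonneg _) (by positivity) (hx _)
  have hdom : ∀ S : E3 → ℝ, MemLp S 6 volume →
      MemLp (fun x => C * (‖k x‖ + ‖S x‖) ^ 5) (6 / 5) volume := by
    intro S hS
    have h1 := memLp_norm_pow_five (hk.norm.add hS.norm)
    have h2 := h1.const_mul C
    refine h2.ae_eq (ae_of_all _ fun x => ?_)
    simp only [Pi.add_apply]
    rw [Real.norm_of_nonneg (by positivity)]
  have hKL : ∀ V, MemLp V 6 volume → MemLp (K V) (6 / 5) volume := by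
    intro V hV
    refine (hdom _ hV.norm).mono (hKm V hV.1) ?_
    filter_upwards [hKb V] with x hx
    refine (hx.trans (le_of_eq ?_)).trans (le_abs_self _)
    rw [norm_norm]
  have hRK : ∀ V : E3 → E3, ∀ᵐ x, |R x (V x)| = ‖K V x‖ * ‖‖V x‖‖ := by
    intro V
    filter_upwards [hb] with x hx
    simp only [hK]
    rw [Real.norm_of_nonneg (by positivity), norm_norm]
    rcases eq_or_ne (‖V x‖) 0 with h | h
    · have := hx (V x)
      rw [h, mul_zero] at this
      rw [h, mul_zero]
      exact le_antisymm this (abs_nonneg _)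
    · rw [div_mul_cancel₀ _ h]
  have hint : ∀ V : E3 → E3, MemLp V 6 volume → Integrable (fun x => R x (V x)) volume := by
    intro V hV
    refine (integrable_norm_mul (hKL V hV) hV.norm).mono' (hm V hV.1) ?_
    filter_upwards [hRK V] with x hx
    exact hx.le
  have hle : ∀ V : E3 → E3, MemLp V 6 volume →
      |∫ x, R x (V x)| ≤ (eLpNorm (K V) (6 / 5) volume).toReal * (eLpNorm V 6 volume).toReal := by
    intro V hV
    have h1 := integral_norm_mul_le (hKL V hV) hV.norm
    rw [eLpNorm_norm] at h1
    refine le_trans (le_trans (abs_integral_le_integral_abs) ?_) h1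
    exact (integral_congr_ae (hRK V)).le
  refine ⟨hint, fun ε hε => ?_⟩
  -- A counterexample yields fields with `L⁶` norm below `2⁻ⁿ`. These are dominated in `L⁶` and tend
  -- to zero almost everywhere, so their quotients `K` tend to zero in `L^{6/5}`, contradicting the
  -- assumed lower bound.
  by_contra! hcon
  choose V hV hVn hVR using fun n : ℕ => hcon ((1 / 2 : ℝ) ^ n) (by positivity)
  have hs : ∑' n, eLpNorm (V n) 6 volume ^ (6 : ℝ) ≠ ∞ := by
    have hle' : ∀ n, eLpNorm (V n) 6 volume ^ (6 : ℝ) ≤ ENNReal.ofReal ((1 / 2 : ℝ) ^ n) := by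
      intro n
      have h1 : eLpNorm (V n) 6 volume ≤ ENNReal.ofReal ((1 / 2 : ℝ) ^ n) :=
        (ENNReal.le_ofReal_iff_toReal_le (hV n).eLpNorm_ne_top (by positivity)).2 (hVn n).le
      have h2 : ENNReal.ofReal ((1 / 2 : ℝ) ^ n) ≤ 1 :=
        ENNReal.ofReal_le_one.2 (pow_le_one₀ (by norm_num) (by norm_num))
      calc eLpNorm (V n) 6 volume ^ (6 : ℝ) ≤ eLpNorm (V n) 6 volume ^ (1 : ℝ) :=
            ENNReal.rpow_le_rpow_of_exponent_ge (h1.trans h2) (by norm_num)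
        _ = eLpNorm (V n) 6 volume := ENNReal.rpow_one _
        _ ≤ _ := h1
    refine ne_top_of_le_ne_top ?_ (ENNReal.tsum_le_tsum hle')
    rw [← ENNReal.ofReal_tsum_of_nonneg (fun n => by positivity)
      (summable_geometric_of_lt_one (by norm_num) (by norm_num))]
    exact ENNReal.ofReal_ne_top
  obtain ⟨S, hS, hSd, hV0⟩ := exists_dominating hV hs
  have hlim : Tendsto (fun n => eLpNorm (K (V n)) ((6 / 5 : ℝ≥0) : ℝ≥0∞) volume) atTop (𝓝 0) := by
    have hc : ((6 / 5 : ℝ≥0) : ℝ≥0∞) = 6 / 5 := by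
      rw [ENNReal.coe_div (by norm_num)]; simp
    refine tendsto_eLpNorm_of_dominated (g := fun x => C * (‖k x‖ + ‖S x‖) ^ 5) (by norm_num)
      (by rw [hc]; exact hdom S hS) (fun n => hKm _ (hV n).1) (fun n => ?_) ?_
    · filter_upwards [hKb (V n), hSd] with x h1 h2
      refine h1.trans ?_
      rw [Real.norm_of_nonneg (by positivity)]
      gcongr
      exact (h2 n).trans (le_abs_self _)
    · filter_upwards [hV0, ho] with x h1 h2
      have h3 := (h2.norm_left.tendsto_div_nhds_zero).comp h1
      exact h3
  have hc : ((6 / 5 : ℝ≥0) : ℝ≥0∞) = 6 / 5 := by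
    rw [ENNReal.coe_div (by norm_num)]; simp
  rw [hc] at hlim
  have h0 := (ENNReal.tendsto_toReal (a := 0) (by simp)).comp hlim
  obtain ⟨n, hn⟩ := (h0.eventually_lt_const (u := ε) (by simpa using hε)).exists
  have h1 := hVR n
  have h2 := hle (V n) (hV n)
  have h3 : (eLpNorm (K (V n)) (6 / 5) volume).toReal * (eLpNorm (V n) 6 volume).toReal
      ≤ ε * (eLpNorm (V n) 6 volume).toReal :=
    mul_le_mul_of_nonneg_right hn.le ENNReal.toReal_nonneg
  linarith

end Nemytskii

/-! ### The two potentials and their expansions. -/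

section Nonlinear
open scoped ENNReal

/-- The assumptions on the pair of nonlinearities. -/
structure NonlinPair (C : ℝ) (f : E3 → ℝ → ℝ) (h : E3 → E3 → E3) : Prop where
  cond : CondF1 f
  nonneg : 0 ≤ C
  at_ae : ∀ᵐ x, NonlinAt C (f x) (h x)

variable {C : ℝ} {f : E3 → ℝ → ℝ} {h : E3 → E3 → E3}

lemma NonlinPair.aestronglyMeasurable_vec (H : NonlinPair C f h) {V : E3 → E3}
    (hV : AEStronglyMeasurable V volume) :
    AEStronglyMeasurable (fun x => h x (V x)) volume := by
  have h1 : AEStronglyMeasurable (fun x => f x ‖V x‖ / ‖V x‖) volume :=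
    ((H.cond.aestronglyMeasurable_comp hV.norm).aemeasurable.div
      hV.norm.aemeasurable).aestronglyMeasurable
  refine (h1.smul hV).congr ?_
  filter_upwards [H.at_ae] with x hx
  exact (hx.vec_eq _).symm

lemma NonlinPair.memLp_vec (H : NonlinPair C f h) {V : E3 → E3} (hV : MemLp V 6 volume) :
    MemLp (fun x => h x (V x)) (6 / 5) volume := by
  refine ((memLp_norm_pow_five hV).const_mul C).mono (H.aestronglyMeasurable_vec hV.1) ?_
  filter_upwards [H.at_ae] with x hx
  rw [Real.norm_of_nonneg (mul_nonneg H.nonneg (by positivity))]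
  exact hx.norm_vec_le _

lemma NonlinPair.integrable_prim (H : NonlinPair C f h) {V : E3 → E3} (hV : MemLp V 6 volume) :
    Integrable (fun x => prim (f x) ‖V x‖) volume := by
  refine ((integrable_norm_mul (memLp_norm_pow_five hV) hV.norm).const_mul C).mono'
    (H.cond.aestronglyMeasurable_prim hV.1.norm) ?_
  filter_upwards [H.at_ae] with x hx
  refine (hx.abs_prim_le _).trans (le_of_eq ?_)
  simp only [abs_norm, norm_norm, norm_pow]
  ring

lemma NonlinPair.integral_primH (H : NonlinPair C f h) (V : E3 → E3) :
    ∫ x, primH h x (V x) = ∫ x, prim (f x) ‖V x‖ := by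
  refine integral_congr_ae ?_
  filter_upwards [H.at_ae] with x hx
  exact hx.potential_eq _

/-- The primitive of an odd function is even, so the scalar potential depends only on `|u| = |u τ|`.
The scalar statements can thus be read off from the vector ones. -/
lemma NonlinPair.integral_primF (H : NonlinPair C f h) (u : E3 → ℝ) :
    ∫ x, primF f x (u x) = ∫ x, prim (f x) ‖tauField u x‖ := by
  refine integral_congr_ae ?_
  filter_upwards [H.at_ae, ae_rad_ne_zero] with x hx hr
  rw [norm_tauField u hr, hx.prim_abs]
  rfl

lemma tauField_add (u v : E3 → ℝ) : tauField (u + v) = tauField u + tauField v := by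
  ext1 x
  simp [tauField, add_div, add_smul]

lemma inner_rot (V : E3 → E3) (x : E3) : inner ℝ ((rad x)⁻¹ • rot x) (V x) = tauComp V x := by
  rw [inner_eq_sum]
  simp [rot, tauComp, dir]
  ring

lemma NonlinAt.vec_tauField {φ : ℝ → ℝ} {η : E3 → E3} (H : NonlinAt C φ η) (u : E3 → ℝ) {x : E3}
    (hx : rad x ≠ 0) : η (tauField u x) = φ (u x) • (rad x)⁻¹ • rot x := by
  rw [← H.apply_smul (u x) ((rad x)⁻¹ • rot x) (by
    rw [norm_smul, norm_rot, norm_inv, Real.norm_of_nonneg (rad_nonneg x), inv_mul_cancel₀ hx])]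
  unfold tauField
  rw [smul_smul, div_eq_mul_inv]

lemma NonlinPair.integral_inner_vec_tauField (H : NonlinPair C f h) (u : E3 → ℝ) (V : E3 → E3) :
    ∫ x, inner ℝ (h x (tauField u x)) (V x) = ∫ x, f x (u x) * tauComp V x := by
  refine integral_congr_ae ?_
  filter_upwards [H.at_ae, ae_rad_ne_zero] with x hx hr
  rw [hx.vec_tauField u hr, inner_smul_left, inner_rot]
  rfl

lemma NonlinPair.potential_expansion (H : NonlinPair C f h) {U : E3 → E3}
    (hU : MemLp U 6 volume) {ε : ℝ} (hε : 0 < ε) :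
    ∃ δ > 0, ∀ V : E3 → E3, MemLp V 6 volume → (eLpNorm V 6 volume).toReal < δ →
      |(∫ x, primH h x ((U + V) x)) - (∫ x, primH h x (U x)) - ∫ x, inner ℝ (h x (U x)) (V x)|
        ≤ ε * (eLpNorm V 6 volume).toReal := by
  have key := exists_remainder_le (R := fun x y => remainder (f x) (h x) (U x) y) (k := U)
    (C := 2 * C) (mul_nonneg two_pos.le H.nonneg) hU
    (by filter_upwards [H.at_ae] with x hx y using hx.abs_remainder_le _ _)
    (by filter_upwards [H.at_ae] with x hx using hx.remainder_isLittleO _)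
    (fun V hV => ((H.cond.aestronglyMeasurable_prim (hU.1.add hV).norm).sub
      (H.cond.aestronglyMeasurable_prim hU.1.norm)).sub
      ((H.aestronglyMeasurable_vec hU.1).inner hV))
  obtain ⟨δ, hδ, hb⟩ := key.2 ε hε
  refine ⟨δ, hδ, fun V hV hVδ => ?_⟩
  have := hb V hV hVδ
  have i1 := H.integrable_prim (hU.add hV)
  have i2 := H.integrable_prim hU
  have i3 : Integrable (fun x => inner ℝ (h x (U x)) (V x)) volume :=
    integrable_inner_of_memLp (H.memLp_vec hU) hV
  rw [H.integral_primH, H.integral_primH, ← integral_sub i1 i2]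
  have i4 := integral_sub (i1.sub i2) i3
  simp only [Pi.sub_apply] at i4
  rw [← i4]
  exact this

lemma eLpNorm_tauField (v : E3 → ℝ) (p : ℝ≥0∞) :
    eLpNorm (tauField v) p volume = eLpNorm v p volume := by
  refine eLpNorm_congr_norm_ae ?_
  filter_upwards [ae_rad_ne_zero] with x hx
  rw [norm_tauField v hx, Real.norm_eq_abs]

lemma measurable_rot : Measurable rot := by
  have : rot = fun x => x 0 • (EuclideanSpace.single 1 1 : E3)
      - x 1 • (EuclideanSpace.single 0 1 : E3) := by ext1 x; exact rot_eq x
  rw [this]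
  exact Continuous.measurable (by fun_prop)

lemma memLp_tauField {v : E3 → ℝ} {p : ℝ≥0∞} (hv : MemLp v p volume) :
    MemLp (tauField v) p volume := by
  refine ⟨?_, by rw [eLpNorm_tauField]; exact hv.2⟩
  exact (hv.1.aemeasurable.div measurable_rad.aemeasurable).aestronglyMeasurable.smul
    measurable_rot.aestronglyMeasurable

/-- The vector expansion at `u τ` in the direction `v τ`: the map `v ↦ v τ` is additive and
isometric in `L⁶`. -/
lemma NonlinPair.potential_expansion_scalar (H : NonlinPair C f h) {u : E3 → ℝ}
    (hu : MemLp u 6 volume) {ε : ℝ} (hε : 0 < ε) :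
    ∃ δ > 0, ∀ v : E3 → ℝ, MemLp v 6 volume → (eLpNorm v 6 volume).toReal < δ →
      |(∫ x, primF f x ((u + v) x)) - (∫ x, primF f x (u x)) - ∫ x, f x (u x) * v x|
        ≤ ε * (eLpNorm v 6 volume).toReal := by
  obtain ⟨δ, hδ, hb⟩ := H.potential_expansion (memLp_tauField hu) hε
  refine ⟨δ, hδ, fun v hv hvδ => ?_⟩
  have := hb (tauField v) (memLp_tauField hv) (by rwa [eLpNorm_tauField])
  rw [eLpNorm_tauField, H.integral_inner_vec_tauField, ← tauField_add, H.integral_primH,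
    H.integral_primH, ← H.integral_primF, ← H.integral_primF] at this
  have e : ∫ x, f x (u x) * tauComp (tauField v) x = ∫ x, f x (u x) * v x := by
    refine integral_congr_ae ?_
    filter_upwards [ae_rad_ne_zero] with x hx
    rw [tauComp_tauField v hx]
  rwa [e] at this

end Nonlinear

/-! ### The norm of `𝒟^{1,2}` and the Sobolev constant. -/

section Norms

variable {F : Type*} [NormedAddCommGroup F]

lemma integrable_norm_sq {g : E3 → F} (hg : MemLp g 2 volume) :
    Integrable (fun x => ‖g x‖ ^ 2) volume := by
  simpa using hg.integrable_norm_rpow (by norm_num) (by norm_num)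

lemma sq_eLpNorm_two {g : E3 → F} (hg : MemLp g 2 volume) :
    (eLpNorm g 2 volume).toReal ^ 2 = ∫ x, ‖g x‖ ^ 2 := by
  rw [hg.eLpNorm_eq_integral_rpow_norm (by norm_num) (by norm_num),
    ENNReal.toReal_ofReal (by positivity)]
  simp only [ENNReal.toReal_ofNat, Real.rpow_ofNat]
  rw [← Real.rpow_ofNat, ← Real.rpow_mul (by positivity)]
  norm_num

variable [NormedSpace ℝ F]

lemma HasWeakGrad.integral_gradSq [CompleteSpace F] {u : E3 → F} {w : Fin 3 → E3 → F}
    (h : HasWeakGrad u w) :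
    Integrable (gradSq u) volume ∧ ∫ x, gradSq u x = ∫ x, ∑ i, ‖w i x‖ ^ 2 := by
  have e : (fun x => ∑ i, ‖w i x‖ ^ 2) =ᵐ[volume] gradSq u := by
    filter_upwards [h.weakPartial_ae 0, h.weakPartial_ae 1, h.weakPartial_ae 2] with x h0 h1 h2
    simp only [gradSq, Fin.sum_univ_three, h0, h1, h2]
  exact ⟨(integrable_finsetSum _ fun i _ => integrable_norm_sq (h.2 i).2).congr e,
    integral_congr_ae e.symm⟩

lemma gradSq_nonneg (u : E3 → F) (x : E3) : 0 ≤ gradSq u x :=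
  Finset.sum_nonneg fun _ _ => by positivity

lemma normD12_sq (u : E3 → F) : normD12 u ^ 2 = ∫ x, gradSq u x :=
  Real.sq_sqrt (integral_nonneg (gradSq_nonneg u))

lemma normD12_nonneg (u : E3 → F) : 0 ≤ normD12 u := Real.sqrt_nonneg _

lemma HasWeakGrad.eLpNorm_le_normD12 [CompleteSpace F] {u : E3 → F} {w : Fin 3 → E3 → F}
    (h : HasWeakGrad u w) (i : Fin 3) : (eLpNorm (w i) 2 volume).toReal ≤ normD12 u := by
  refine Real.le_sqrt_of_sq_le ?_
  rw [sq_eLpNorm_two (h.2 i).2, h.integral_gradSq.2]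
  refine integral_mono (integrable_norm_sq (h.2 i).2)
    (integrable_finsetSum _ fun i _ => integrable_norm_sq (h.2 i).2) fun x => ?_
  exact Finset.single_le_sum (f := fun i => ‖w i x‖ ^ 2) (fun _ _ => by positivity)
    (Finset.mem_univ i)

/-- The Sobolev inequality in terms of `normD12`. -/
lemma exists_sobolev (F : Type*) [NormedAddCommGroup F] [NormedSpace ℝ F]
    [FiniteDimensional ℝ F] :
    ∃ K > 0, ∀ u : E3 → F, MemD12 u → (eLpNorm u 6 volume).toReal ≤ K * normD12 u := by
  have : CompleteSpace F := FiniteDimensional.complete ℝ F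
  obtain ⟨K, hK⟩ := exists_sobolev_const F
  refine ⟨3 * K + 1, by positivity, fun u hu => ?_⟩
  have hg := hu.hasWeakGrad
  have h1 := hK u _ hg
  have hfin : ∀ i, eLpNorm (weakPartial i u) 2 volume ≠ ⊤ := fun i => (hg.2 i).2.eLpNorm_ne_top
  have h2 := ENNReal.toReal_mono (ENNReal.mul_ne_top ENNReal.coe_ne_top
    (ENNReal.sum_ne_top.2 fun i _ => hfin i)) h1
  rw [ENNReal.toReal_mul, ENNReal.toReal_sum fun i _ => hfin i, ENNReal.coe_toReal] at h2
  refine h2.trans ?_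
  have h3 : ∑ i, (eLpNorm (weakPartial i u) 2 volume).toReal ≤ ∑ _i : Fin 3, normD12 u :=
    Finset.sum_le_sum fun i _ => hg.eLpNorm_le_normD12 i
  simp only [Finset.sum_const, Finset.card_univ, Fintype.card_fin, nsmul_eq_mul,
    Nat.cast_ofNat] at h3
  have h4 := normD12_nonneg u
  have h5 : (K : ℝ) * ∑ i, (eLpNorm (weakPartial i u) 2 volume).toReal ≤ K * (3 * normD12 u) := by
    gcongr
  linarith

end Norms

/-! ### Critical points and first order expansions. -/

section Criticality

/-- A functional with a first order expansion `ℓ` is critical at `u` exactly if `ℓ` vanishes. -/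
lemma isCriticalPoint_iff {F : Type*} [NormedAddCommGroup F] [NormedSpace ℝ F]
    {S : Set (E3 → F)} {N Φ ℓ : (E3 → F) → ℝ} {u : E3 → F}
    (hS : ∀ (c : ℝ), ∀ v ∈ S, c • v ∈ S) (hN : ∀ v, 0 ≤ N v)
    (hNc : ∀ (c : ℝ), ∀ v ∈ S, N (c • v) = |c| * N v)
    (hℓ : ∀ (c : ℝ), ∀ v ∈ S, ℓ (c • v) = c * ℓ v)
    (hexp : ∀ ε > 0, ∃ δ > 0, ∀ v ∈ S, N v < δ → |Φ (u + v) - Φ u - ℓ v| ≤ ε * N v) :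
    IsCriticalPoint S N Φ u ↔ u ∈ S ∧ ∀ v ∈ S, ℓ v = 0 := by
  refine and_congr_right fun hu => ⟨fun h v hv => ?_, fun h ε hε => ?_⟩
  · have key : ∀ ε > 0, |ℓ v| ≤ 2 * ε * N v := by
      intro ε hε
      obtain ⟨δ₁, hδ₁, h₁⟩ := h ε hε
      obtain ⟨δ₂, hδ₂, h₂⟩ := hexp ε hε
      set δ := min δ₁ δ₂
      have hδ : 0 < δ := lt_min hδ₁ hδ₂
      have hNv := hN v
      -- Both bounds hold only for small directions, so `v` is scaled down; homogeneity then removes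
      -- `c`. The `+ 1` covers the case `N v = 0`.
      set c : ℝ := δ / (N v + 1)
      have hc : 0 < c := by positivity
      have hcN : N (c • v) < δ := by
        rw [hNc c v hv, abs_of_pos hc, div_mul_eq_mul_div, div_lt_iff₀ (by positivity)]
        nlinarith
      have a₁ := h₁ _ (hS c v hv) (hcN.trans_le (min_le_left _ _))
      have a₂ := h₂ _ (hS c v hv) (hcN.trans_le (min_le_right _ _))
      have a₃ : |ℓ (c • v)| ≤ 2 * ε * N (c • v) := by
        rw [abs_le] at *
        constructor <;> linarith
      rw [hℓ c v hv, hNc c v hv, abs_mul, abs_of_pos hc] at a₃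
      have a₄ : c * |ℓ v| ≤ c * (2 * ε * N v) := by linarith
      exact le_of_mul_le_mul_left a₄ hc
    by_contra hne
    have hpos : 0 < |ℓ v| := abs_pos.2 hne
    have hNv := hN v
    -- With this choice the bound reads `|ℓ v| ≤ |ℓ v| / 2`, which is absurd unless `ℓ v = 0`.
    have := key (|ℓ v| / (4 * (N v + 1))) (by positivity)
    have h2 : 2 * (|ℓ v| / (4 * (N v + 1))) * N v = |ℓ v| * (N v / (N v + 1)) / 2 := by
      field_simp; ring
    have h3 : N v / (N v + 1) ≤ 1 := div_le_one_of_le₀ (by linarith) (by linarith)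
    nlinarith
  · obtain ⟨δ, hδ, h'⟩ := hexp ε hε
    refine ⟨δ, hδ, fun v hv hvδ => ?_⟩
    have := h' v hv hvδ
    rwa [h v hv, sub_zero] at this

end Criticality

/-! ### First variation of the scalar energy. -/

section Scalar

lemma integral_add_two_mul_add {a b c : E3 → ℝ} (ha : Integrable a volume)
    (hb : Integrable b volume) (hc : Integrable c volume) :
    ∫ x, (a x + 2 * b x + c x) = (∫ x, a x) + 2 * (∫ x, b x) + ∫ x, c x := by
  have h1 : Integrable (fun x => a x + 2 * b x) volume := ha.add (hb.const_mul 2)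
  rw [integral_add h1 hc, integral_add ha (hb.const_mul 2), integral_const_mul]

/-- The bilinear form of the scalar problem, for functions `u, v` with gradients `w, z`. -/
def formX (u : E3 → ℝ) (w : Fin 3 → E3 → ℝ) (v : E3 → ℝ) (z : Fin 3 → E3 → ℝ) : ℝ :=
  ∫ x, ((∑ i, w i x * z i x) + 1 / rad x ^ 2 * (u x * v x))

/-- The first variation of the scalar energy. -/
def firstJ (f : E3 → ℝ → ℝ) (u : E3 → ℝ) (w : Fin 3 → E3 → ℝ) (v : E3 → ℝ)
    (z : Fin 3 → E3 → ℝ) : ℝ :=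
  formX u w v z - ∫ x, f x (u x) * v x

lemma formX_congr {u v v' : E3 → ℝ} {w w' z z' : Fin 3 → E3 → ℝ} (hw : ∀ i, w i =ᵐ[volume] w' i)
    (hv : v =ᵐ[volume] v') (hz : ∀ i, z i =ᵐ[volume] z' i) :
    formX u w v z = formX u w' v' z' := by
  refine integral_congr_ae ?_
  filter_upwards [hv, hz 0, hz 1, hz 2, hw 0, hw 1, hw 2] with x h h0 h1 h2 k0 k1 k2
  simp only [Fin.sum_univ_three, h, h0, h1, h2, k0, k1, k2]

lemma firstJ_congr {f : E3 → ℝ → ℝ} {u v v' : E3 → ℝ} {w z z' : Fin 3 → E3 → ℝ}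
    (hv : v =ᵐ[volume] v') (hz : ∀ i, z i =ᵐ[volume] z' i) :
    firstJ f u w v z = firstJ f u w v' z' := by
  unfold firstJ
  rw [formX_congr (fun i => ae_eq_refl _) hv hz]
  congr 1
  refine integral_congr_ae ?_
  filter_upwards [hv] with x h
  rw [h]

lemma integrable_formX {u v : E3 → ℝ} {w z : Fin 3 → E3 → ℝ} (hu : HasWeakGrad u w)
    (hur : AxisL2 u) (hv : HasWeakGrad v z) (hvr : AxisL2 v) :
    Integrable (fun x => (∑ i, w i x * z i x) + 1 / rad x ^ 2 * (u x * v x)) volume := by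
  refine Integrable.add (integrable_finsetSum _ fun i _ =>
    integrable_mul_of_memLp (hu.2 i).2 (hv.2 i).2) ?_
  refine (MemLp.integrable_mul hur hvr).congr (ae_of_all _ fun x => ?_)
  simp only [Pi.mul_apply, smul_eq_mul]
  ring

lemma formX_add {u v : E3 → ℝ} {w z : Fin 3 → E3 → ℝ} (hu : HasWeakGrad u w)
    (hur : AxisL2 u) (hv : HasWeakGrad v z) (hvr : AxisL2 v) :
    formX (u + v) (fun i => w i + z i) (u + v) (fun i => w i + z i)
      = formX u w u w + 2 * formX u w v z + formX v z v z := by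
  unfold formX
  rw [← integral_add_two_mul_add (integrable_formX hu hur hu hur) (integrable_formX hu hur hv hvr)
    (integrable_formX hv hvr hv hvr)]
  congr 1
  ext x
  simp only [Fin.sum_univ_three, Pi.add_apply]
  ring

lemma HasWeakGrad.energyJ_eq {f : E3 → ℝ → ℝ} {u : E3 → ℝ} {w : Fin 3 → E3 → ℝ}
    (hu : HasWeakGrad u w) :
    energyJ 1 f u = 1 / 2 * formX u w u w - ∫ x, primF f x (u x) := by
  unfold energyJ formX
  congr 2
  refine integral_congr_ae ?_
  filter_upwards [hu.weakPartial_ae 0, hu.weakPartial_ae 1, hu.weakPartial_ae 2] with x h0 h1 h2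
  simp only [gradSq, Fin.sum_univ_three, h0, h1, h2, Real.norm_eq_abs, sq_abs]
  ring

lemma HasWeakGrad.normX_eq {u : E3 → ℝ} {w : Fin 3 → E3 → ℝ} (hu : HasWeakGrad u w)
    (hur : AxisL2 u) : normX u = Real.sqrt (formX u w u w) := by
  have h1 := (mem_spaceX_iff.2 ⟨hu.memD12, hur⟩).2
  unfold normX formX
  rw [← integral_add hu.integral_gradSq.1 h1]
  congr 1
  refine integral_congr_ae ?_
  filter_upwards [hu.weakPartial_ae 0, hu.weakPartial_ae 1, hu.weakPartial_ae 2] with x h0 h1 h2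
  simp only [gradSq, Fin.sum_univ_three, h0, h1, h2, Real.norm_eq_abs, sq_abs]
  ring

lemma formX_self_nonneg (u : E3 → ℝ) (w : Fin 3 → E3 → ℝ) : 0 ≤ formX u w u w :=
  integral_nonneg fun x => add_nonneg (Finset.sum_nonneg fun i _ => mul_self_nonneg _)
    (mul_nonneg (by positivity) (mul_self_nonneg _))

lemma normX_nonneg (u : E3 → ℝ) : 0 ≤ normX u := Real.sqrt_nonneg _

lemma HasWeakGrad.normX_sq {u : E3 → ℝ} {w : Fin 3 → E3 → ℝ} (hu : HasWeakGrad u w)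
    (hur : AxisL2 u) : normX u ^ 2 = formX u w u w := by
  rw [hu.normX_eq hur, Real.sq_sqrt (formX_self_nonneg u w)]

lemma normD12_le_normX (u : E3 → ℝ) : normD12 u ≤ normX u :=
  Real.sqrt_le_sqrt (le_add_of_nonneg_right (integral_nonneg fun _ => by positivity))

lemma formX_smul_right (c : ℝ) (u v : E3 → ℝ) (w z : Fin 3 → E3 → ℝ) :
    formX u w (c • v) (fun i => c • z i) = c * formX u w v z := by
  unfold formX
  rw [← integral_const_mul]
  congr 1
  ext x
  simp only [Fin.sum_univ_three, Pi.smul_apply, smul_eq_mul]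
  ring

lemma formX_smul_smul (c : ℝ) (v : E3 → ℝ) (z : Fin 3 → E3 → ℝ) :
    formX (c • v) (fun i => c • z i) (c • v) (fun i => c • z i) = c ^ 2 * formX v z v z := by
  unfold formX
  rw [← integral_const_mul]
  congr 1
  ext x
  simp only [Fin.sum_univ_three, Pi.smul_apply, smul_eq_mul]
  ring

/-- Critical points of the scalar energy are the zeros of its first variation. -/
lemma NonlinPair.isSolutionS_iff {C : ℝ} {f : E3 → ℝ → ℝ} {h : E3 → E3 → E3}
    (H : NonlinPair C f h) {u : E3 → ℝ} {w : Fin 3 → E3 → ℝ} (hu : HasWeakGrad u w)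
    (hur : AxisL2 u) :
    IsSolutionS 1 f u ↔
      ∀ v z, HasWeakGrad v z → AxisL2 v → firstJ f u w v z = 0 := by
  have huX : u ∈ spaceX := mem_spaceX_iff.2 ⟨hu.memD12, hur⟩
  have hgrad : ∀ v ∈ spaceX, HasWeakGrad v (fun i => weakPartial i v) ∧ AxisL2 v := fun v hv =>
    ⟨(mem_spaceX_iff.1 hv).1.hasWeakGrad, (mem_spaceX_iff.1 hv).2⟩
  obtain ⟨K, hK, hsob⟩ := exists_sobolev ℝ
  unfold IsSolutionS
  rw [isCriticalPoint_iff (ℓ := fun v => firstJ f u w v (fun i => weakPartial i v))]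
  · constructor
    · rintro ⟨-, h0⟩ v z hv hvr
      rw [← h0 v (mem_spaceX_iff.2 ⟨hv.memD12, hvr⟩)]
      exact firstJ_congr (ae_eq_refl _) fun i => (hv.weakPartial_ae i).symm
    · intro h0
      exact ⟨huX, fun v hv => h0 v _ (hgrad v hv).1 (hgrad v hv).2⟩
  · intro c v hv
    exact mem_spaceX_iff.2 ⟨((hgrad v hv).1.const_smul c).memD12, (hgrad v hv).2.const_smul c⟩
  · exact normX_nonneg
  · intro c v hv
    obtain ⟨hg, hr⟩ := hgrad v hv
    rw [(hg.const_smul c).normX_eq (hr.const_smul c), hg.normX_eq hr, formX_smul_smul,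
      Real.sqrt_mul (sq_nonneg c), Real.sqrt_sq_eq_abs]
  · intro c v hv
    obtain ⟨hg, hr⟩ := hgrad v hv
    rw [firstJ_congr (ae_eq_refl _) fun i => (hg.const_smul c).weakPartial_ae i]
    unfold firstJ
    rw [formX_smul_right, mul_sub, ← integral_const_mul]
    congr 2
    ext x
    simp only [Pi.smul_apply, smul_eq_mul]
    ring
  · intro ε hε
    obtain ⟨δ, hδ, hexp⟩ := H.potential_expansion_scalar hu.1 (ε := ε / (2 * K)) (by positivity)
    -- The bound `δ / K` brings the `L⁶` norm below `δ` by Sobolev; the bound `ε` makes the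
    -- quadratic remainder `½ ‖v‖²` at most `½ ε ‖v‖`. The potential contributes the other half.
    refine ⟨min (δ / K) ε, lt_min (by positivity) hε, fun v hv hvδ => ?_⟩
    obtain ⟨hg, hr⟩ := hgrad v hv
    have hvn := normX_nonneg v
    have hs : (eLpNorm v 6 volume).toReal ≤ K * normX v :=
      (hsob v hv.1).trans (by gcongr; exact normD12_le_normX v)
    have h1 := hexp v hg.1 (hs.trans_lt (by
      rw [mul_comm, ← lt_div_iff₀ hK]; exact hvδ.trans_le (min_le_left _ _)))
    have h2 : ε / (2 * K) * (eLpNorm v 6 volume).toReal ≤ ε / 2 * normX v := by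
      calc _ ≤ ε / (2 * K) * (K * normX v) := by gcongr
        _ = _ := by field_simp
    have h3 : normX v ^ 2 ≤ ε * normX v := by
      rw [sq]; gcongr; exact (hvδ.trans_le (min_le_right _ _)).le
    rw [(hu.add hg).energyJ_eq, hu.energyJ_eq, formX_add hu hur hg hr, ← hg.normX_sq hr]
    unfold firstJ
    have h4 := h1.trans h2
    rw [abs_le] at h4 ⊢
    have h5 := sq_nonneg (normX v)
    constructor <;> linarith

end Scalar

/-! ### First variation of the curl energy, and its relation to the scalar one. -/

section Vector

/-- The bilinear form of the curl, for fields with gradients `A` and `B`. -/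
def formE (A B : Fin 3 → E3 → E3) : ℝ := ∫ x, inner ℝ (curlOf A x) (curlOf B x)

/-- The first variation of the vector energy. -/
def firstE (h : E3 → E3 → E3) (U : E3 → E3) (A : Fin 3 → E3 → E3) (V : E3 → E3)
    (B : Fin 3 → E3 → E3) : ℝ :=
  formE A B - ∫ x, inner ℝ (h x (U x)) (V x)

lemma curlOf_congr {A B : Fin 3 → E3 → E3} (h : ∀ i, A i =ᵐ[volume] B i) :
    curlOf A =ᵐ[volume] curlOf B := by
  filter_upwards [h 0, h 1, h 2] with x h0 h1 h2
  simp only [curlOf, h0, h1, h2]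

lemma formE_congr {A B A' B' : Fin 3 → E3 → E3} (hA : ∀ i, A i =ᵐ[volume] A' i)
    (hB : ∀ i, B i =ᵐ[volume] B' i) : formE A B = formE A' B' := by
  refine integral_congr_ae ?_
  filter_upwards [curlOf_congr hA, curlOf_congr hB] with x h0 h1
  rw [h0, h1]

lemma HasWeakGrad.memLp_curlOf {V : E3 → E3} {B : Fin 3 → E3 → E3} (h : HasWeakGrad V B) :
    MemLp (curlOf B) 2 volume := by
  have hm := fun i j => ((h.apply j).2 i).2
  refine memLp_pi fun j => ?_
  fin_cases j
  · exact (hm 1 2).sub (hm 2 1)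
  · exact (hm 2 0).sub (hm 0 2)
  · exact (hm 0 1).sub (hm 1 0)

lemma curlOf_add (A B : Fin 3 → E3 → E3) :
    curlOf (fun i => A i + B i) = curlOf A + curlOf B := by
  ext x k
  fin_cases k <;> simp [curlOf] <;> ring

lemma curlOf_smul (c : ℝ) (B : Fin 3 → E3 → E3) :
    curlOf (fun i => c • B i) = c • curlOf B := by
  ext x k
  fin_cases k <;> simp [curlOf] <;> ring

lemma formE_add {U V : E3 → E3} {A B : Fin 3 → E3 → E3} (hU : HasWeakGrad U A)
    (hV : HasWeakGrad V B) :
    formE (fun i => A i + B i) (fun i => A i + B i) = formE A A + 2 * formE A B + formE B B := by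
  have hi : ∀ {f g : E3 → E3}, MemLp f 2 volume → MemLp g 2 volume →
      Integrable (fun x => inner ℝ (f x) (g x)) volume := fun hf hg =>
    integrable_inner_of_memLp hf hg
  have a := hU.memLp_curlOf
  have b := hV.memLp_curlOf
  unfold formE
  rw [← integral_add_two_mul_add (hi a a) (hi a b) (hi b b)]
  congr 1
  ext x
  simp only [curlOf_add, Pi.add_apply, inner_add_left, inner_add_right]
  rw [real_inner_comm (curlOf A x) (curlOf B x)]
  ring

lemma HasWeakGrad.energyE_eq {h : E3 → E3 → E3} {U : E3 → E3} {A : Fin 3 → E3 → E3}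
    (hU : HasWeakGrad U A) :
    energyE h U = 1 / 2 * formE A A - ∫ x, primH h x (U x) := by
  unfold energyE formE
  congr 2
  refine integral_congr_ae ?_
  filter_upwards [hU.curl_ae] with x hx
  rw [hx, real_inner_self_eq_norm_sq]

/-- Each entry of the curl satisfies `(a - b)² ≤ 2a² + 2b²`. This controls the quadratic remainder
of the vector energy by the norm of `𝒟^{1,2}`. -/
lemma HasWeakGrad.formE_self_le {V : E3 → E3} {B : Fin 3 → E3 → E3} (h : HasWeakGrad V B) :
    formE B B ≤ 2 * normD12 V ^ 2 := by
  have hi := fun i => integrable_norm_sq (h.2 i).2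
  rw [normD12_sq, h.integral_gradSq.2, ← integral_const_mul]
  refine integral_mono (integrable_inner_of_memLp h.memLp_curlOf h.memLp_curlOf)
    ((integrable_finsetSum _ fun i _ => hi i).const_mul 2) fun x => ?_
  simp only [Fin.sum_univ_three, ← real_inner_self_eq_norm_sq]
  simp only [inner_eq_sum, curlOf, Matrix.cons_val_zero, Matrix.cons_val_one, Matrix.cons_val]
  nlinarith [sq_nonneg (B 1 x 2 + B 2 x 1), sq_nonneg (B 2 x 0 + B 0 x 2),
    sq_nonneg (B 0 x 1 + B 1 x 0), sq_nonneg (B 0 x 0), sq_nonneg (B 1 x 1), sq_nonneg (B 2 x 2)]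

lemma formE_self_nonneg (B : Fin 3 → E3 → E3) : 0 ≤ formE B B :=
  integral_nonneg fun _ => real_inner_self_nonneg

/-- Critical points of the vector energy are the zeros of its first variation. -/
lemma NonlinPair.isSolutionV_iff {C : ℝ} {f : E3 → ℝ → ℝ} {h : E3 → E3 → E3}
    (H : NonlinPair C f h) {U : E3 → E3} {A : Fin 3 → E3 → E3} (hU : HasWeakGrad U A) :
    IsSolutionV h U ↔ ∀ V B, HasWeakGrad V B → firstE h U A V B = 0 := by
  have hgrad : ∀ V ∈ spaceD, HasWeakGrad V (fun i => weakPartial i V) := fun V hV =>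
    MemD12.hasWeakGrad hV
  obtain ⟨K, hK, hsob⟩ := exists_sobolev E3
  unfold IsSolutionV
  rw [isCriticalPoint_iff (ℓ := fun V => firstE h U A V (fun i => weakPartial i V))]
  · constructor
    · rintro ⟨-, h0⟩ V B hV
      rw [← h0 V hV.memD12]
      unfold firstE
      rw [formE_congr (fun i => ae_eq_refl _) fun i => hV.weakPartial_ae i]
    · intro h0
      exact ⟨hU.memD12, fun V hV => h0 V _ (hgrad V hV)⟩
  · intro c V hV
    exact ((hgrad V hV).const_smul c).memD12
  · exact normD12_nonneg
  · intro c V hV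
    have hg := hgrad V hV
    unfold normD12
    rw [(hg.const_smul c).integral_gradSq.2, hg.integral_gradSq.2]
    have e : ∀ x, ∑ i, ‖(c • weakPartial i V) x‖ ^ 2 = c ^ 2 * ∑ i, ‖weakPartial i V x‖ ^ 2 := by
      intro x
      rw [Finset.mul_sum]
      refine Finset.sum_congr rfl fun i _ => ?_
      rw [Pi.smul_apply, norm_smul, mul_pow, Real.norm_eq_abs, sq_abs]
    simp_rw [e]
    rw [integral_const_mul, Real.sqrt_mul (sq_nonneg c), Real.sqrt_sq_eq_abs]
  · intro c V hV
    have hg := hgrad V hV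
    unfold firstE
    rw [formE_congr (fun i => ae_eq_refl _) fun i => (hg.const_smul c).weakPartial_ae i]
    unfold formE
    rw [mul_sub, ← integral_const_mul, ← integral_const_mul, curlOf_smul]
    simp only [Pi.smul_apply, inner_smul_right]
  · intro ε hε
    obtain ⟨δ, hδ, hexp⟩ := H.potential_expansion hU.1 (ε := ε / (2 * K)) (by positivity)
    -- Here `ε / 2` is needed, since half of the curl form is bounded by the full square of the
    -- norm.
    refine ⟨min (δ / K) (ε / 2), lt_min (by positivity) (by positivity), fun V hV hVδ => ?_⟩
    have hg := hgrad V hV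
    have hVn := normD12_nonneg V
    have hs : (eLpNorm V 6 volume).toReal ≤ K * normD12 V := hsob V hV
    have h1 := hexp V hg.1 (hs.trans_lt (by
      rw [mul_comm, ← lt_div_iff₀ hK]; exact hVδ.trans_le (min_le_left _ _)))
    have h2 : ε / (2 * K) * (eLpNorm V 6 volume).toReal ≤ ε / 2 * normD12 V := by
      calc _ ≤ ε / (2 * K) * (K * normD12 V) := by gcongr
        _ = _ := by field_simp
    have h3 : normD12 V ^ 2 ≤ ε / 2 * normD12 V := by
      rw [sq]; gcongr; exact (hVδ.trans_le (min_le_right _ _)).le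
    rw [(hU.add hg).energyE_eq, hU.energyE_eq, formE_add hU hg]
    unfold firstE
    have h4 := h1.trans h2
    have h5 := hg.formE_self_le
    have h6 := formE_self_nonneg (fun i => weakPartial i V)
    rw [abs_le] at h4 ⊢
    constructor <;> linarith

/-- For azimuthal fields the first variations of the two energies correspond. -/
lemma NonlinPair.firstE_eq {C : ℝ} {f : E3 → ℝ → ℝ} {h : E3 → E3 → E3}
    (H : NonlinPair C f h) {u : E3 → ℝ} {w : Fin 3 → E3 → ℝ} (hinv : InvariantO u)
    (hu : HasWeakGrad u w) (hur : AxisL2 u) {V : E3 → E3} {B : Fin 3 → E3 → E3}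
    (hV : HasWeakGrad V B) (hVr : AxisL2 V) :
    firstE h (tauField u) (tauFieldGrad u w) V B
      = firstJ f u w (tauComp V) (tauCompGrad V B) := by
  unfold firstE firstJ formE formX
  rw [integral_inner_curlOf (hu.tauField hur) hV (hinv.div_tauFieldGrad hu),
    hinv.integral_inner_tauFieldGrad hu hur hV hVr, H.integral_inner_vec_tauField]

lemma AxisL2.tauField {v : E3 → ℝ} {w : Fin 3 → E3 → ℝ} (h : AxisL2 v) (hv : HasWeakGrad v w) :
    AxisL2 (tauField v) :=
  h.mono (memLp_tauField hv.1).1 (ae_of_all _ fun x => norm_tauField_le v x)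

/-- Every scalar direction `v` arises as `τ · V` with `V = v τ`. The gradients match by uniqueness
of weak derivatives, without computing the composition. -/
lemma HasWeakGrad.tauComp_tauField {v : E3 → ℝ} {w : Fin 3 → E3 → ℝ} (hv : HasWeakGrad v w)
    (hr : AxisL2 v) : CurlCurl.tauComp (CurlCurl.tauField v) =ᵐ[volume] v ∧
      ∀ i, tauCompGrad (CurlCurl.tauField v) (tauFieldGrad v w) i =ᵐ[volume] w i := by
  have e : CurlCurl.tauComp (CurlCurl.tauField v) =ᵐ[volume] v := by
    filter_upwards [ae_rad_ne_zero] with x hx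
    exact CurlCurl.tauComp_tauField v hx
  have h1 := (hv.tauField hr).tauComp (hr.tauField hv)
  have h2 := h1.congr e fun i => ae_eq_refl _
  exact ⟨e, fun i => (h2.2 i).1.unique (hv.2 i).1⟩

/-- The energies of an invariant function and of its azimuthal field agree. -/
lemma NonlinPair.energy_eq {C : ℝ} {f : E3 → ℝ → ℝ} {h : E3 → E3 → E3}
    (H : NonlinPair C f h) {u : E3 → ℝ} {w : Fin 3 → E3 → ℝ} (hinv : InvariantO u)
    (hu : HasWeakGrad u w) (hur : AxisL2 u) {U : E3 → E3} (hU : U =ᵐ[volume] tauField u) :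
    energyJ 1 f u = energyE h U := by
  have hg := hu.tauField hur
  have hgU : HasWeakGrad U (tauFieldGrad u w) := hg.congr hU.symm fun i => ae_eq_refl _
  obtain ⟨e1, e2⟩ := hu.tauComp_tauField hur
  have e3 : formE (tauFieldGrad u w) (tauFieldGrad u w) = formX u w u w := by
    unfold formE
    rw [integral_inner_curlOf hg hg (hinv.div_tauFieldGrad hu),
      hinv.integral_inner_tauFieldGrad hu hur hg (hur.tauField hu)]
    exact formX_congr (fun i => ae_eq_refl _) e1 e2
  have e4 : ∫ x, primH h x (U x) = ∫ x, primF f x (u x) := by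
    rw [H.integral_primF, ← H.integral_primH]
    refine integral_congr_ae ?_
    filter_upwards [hU] with x hx
    rw [hx]
  rw [hu.energyJ_eq, hgU.energyE_eq, e3, e4]

/-- Azimuthal fields with invariant amplitude are divergence free. -/
lemma InvariantO.divFree {u : E3 → ℝ} {w : Fin 3 → E3 → ℝ} (hinv : InvariantO u)
    (hu : HasWeakGrad u w) (hur : AxisL2 u) {U : E3 → E3} (hU : U =ᵐ[volume] tauField u) :
    DivFree U := by
  refine ⟨((memLp_tauField hu.1).ae_eq hU.symm).locallyIntegrable (by norm_num), fun φ hφ => ?_⟩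
  -- Pairing `U` with `∇φ` pairs the invariant, locally integrable function `u / r` with the angular
  -- derivative of `φ`.
  have hg : InvariantO fun x => (rad x)⁻¹ • u x := by
    intro g
    filter_upwards [hinv g] with x hx
    rw [hx, rad_act]
  rw [← integral_mul_angDeriv hur.locallyIntegrable hg hφ]
  refine integral_congr_ae ?_
  filter_upwards [hU] with x hx
  rw [hx, angDeriv_eq]
  simp only [Fin.sum_univ_three, tauField_zero, tauField_one, tauField_two, dir, smul_eq_mul]
  ring

end Vector

/-! ### The axis has zero capacity. -/

section Capacity

/-- Sequences which are bounded in `L²` and tend to zero almost everywhere tend weakly to zero. -/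
lemma tendsto_integral_mul_of_bounded {a : E3 → ℝ} (ha : MemLp a 2 volume) (ha0 : ∀ x, 0 ≤ a x)
    {T : ℕ → E3 → ℝ} (hT0 : ∀ n x, 0 ≤ T n x) (hT : ∀ n, MemLp (T n) 2 volume) {M : ℝ}
    (hM : ∀ n, ∫ x, T n x ^ 2 ≤ M) (hlim : ∀ᵐ x, Tendsto (fun n => T n x) atTop (𝓝 0)) :
    Tendsto (fun n => ∫ x, a x * T n x) atTop (𝓝 0) := by
  have hM0 : 0 ≤ M := (integral_nonneg fun x => sq_nonneg _).trans (hM 0)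
  have hTi : ∀ n, Integrable (fun x => T n x ^ 2) volume := fun n => (hT n).integrable_sq
  have haT : ∀ n, Integrable (fun x => a x * T n x) volume := fun n =>
    integrable_mul_of_memLp ha (hT n)
  rw [Metric.tendsto_atTop]
  intro ε hε
  -- Split at `T n = K a`. The truncated part is dominated by `K a²` and tends to zero; where `T n >
  -- K a` the excess is at most `T n² / K`, and `K` is chosen so that `M / K < ε / 2`.
  set K : ℝ := 2 * (M + 1) / ε
  have hK : 0 < K := by positivity
  have hmin : ∀ n, Integrable (fun x => a x * min (T n x) (K * a x)) volume := fun n => by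
    refine (haT n).mono (ha.1.mul ((hT n).1.inf (ha.1.const_mul K))) (ae_of_all _ fun x => ?_)
    rw [norm_mul, norm_mul]
    refine mul_le_mul_of_nonneg_left ?_ (norm_nonneg _)
    have h1 : 0 ≤ min (T n x) (K * a x) := le_min (hT0 n x) (mul_nonneg hK.le (ha0 x))
    rw [Real.norm_of_nonneg h1, Real.norm_of_nonneg (hT0 n x)]
    exact min_le_left _ _
  have l1 : Tendsto (fun n => ∫ x, a x * min (T n x) (K * a x)) atTop (𝓝 (∫ _ : E3, 0)) := by
    refine tendsto_integral_of_dominated_convergence (fun x => K * a x ^ 2)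
      (fun n => (hmin n).1) (ha.integrable_sq.const_mul K) (fun n => ae_of_all _ fun x => ?_) ?_
    · have h1 : 0 ≤ min (T n x) (K * a x) := le_min (hT0 n x) (mul_nonneg hK.le (ha0 x))
      rw [Real.norm_of_nonneg (mul_nonneg (ha0 x) h1)]
      calc a x * min (T n x) (K * a x) ≤ a x * (K * a x) :=
            mul_le_mul_of_nonneg_left (min_le_right _ _) (ha0 x)
        _ = K * a x ^ 2 := by ring
    · filter_upwards [hlim] with x hx
      have h1 := (hx.min (tendsto_const_nhds (x := K * a x))).const_mul (a x)
      rwa [min_eq_left (mul_nonneg hK.le (ha0 x)), mul_zero] at h1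
  rw [integral_zero, Metric.tendsto_atTop] at l1
  obtain ⟨N, hN⟩ := l1 (ε / 2) (by positivity)
  refine ⟨N, fun n hn => ?_⟩
  have h1 := hN n hn
  rw [Real.dist_eq, sub_zero] at h1 ⊢
  have h0 : 0 ≤ ∫ x, a x * T n x := integral_nonneg fun x => mul_nonneg (ha0 x) (hT0 n x)
  rw [abs_of_nonneg h0]
  have h2 : ∫ x, a x * T n x
      ≤ (∫ x, a x * min (T n x) (K * a x)) + ∫ x, K⁻¹ * T n x ^ 2 := by
    rw [← integral_add (hmin n) ((hTi n).const_mul _)]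
    refine integral_mono (haT n) ((hmin n).add ((hTi n).const_mul _)) fun x => ?_
    simp only
    rcases le_total (T n x) (K * a x) with h | h
    · rw [min_eq_left h]
      have := mul_nonneg (inv_nonneg.2 hK.le) (sq_nonneg (T n x))
      linarith
    · rw [min_eq_right h]
      have h3 : a x ≤ K⁻¹ * T n x := by
        rw [← div_eq_inv_mul, le_div_iff₀ hK]; linarith
      have h4 : a x * T n x ≤ K⁻¹ * T n x * T n x := mul_le_mul_of_nonneg_right h3 (hT0 n x)
      have h5 := mul_nonneg (ha0 x) (mul_nonneg hK.le (ha0 x))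
      nlinarith
  rw [integral_const_mul] at h2
  have h3 : K⁻¹ * ∫ x, T n x ^ 2 < ε / 2 := by
    calc K⁻¹ * ∫ x, T n x ^ 2 ≤ K⁻¹ * M := by gcongr; exact hM n
      _ < K⁻¹ * (M + 1) := by gcongr; linarith
      _ = ε / 2 := by simp only [K]; field_simp
  have h4 := (abs_lt.1 h1).2
  linarith

/-- The anisotropic dilation by `1 / ε` orthogonally to the axis. -/
def stretch (ε : ℝ) : E3 →ₗ[ℝ] E3 := Matrix.toEuclideanLin (Matrix.diagonal ![ε⁻¹, ε⁻¹, 1])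

lemma stretch_apply (ε : ℝ) (x : E3) : stretch ε x = !₂[ε⁻¹ * x 0, ε⁻¹ * x 1, x 2] := by
  ext k
  fin_cases k <;> simp [stretch, Matrix.mulVec_diagonal]

lemma det_stretch (ε : ℝ) : LinearMap.det (stretch ε) = (ε ^ 2)⁻¹ := by
  unfold stretch
  rw [Matrix.toEuclideanLin_eq_toLin_orthonormal, LinearMap.det_toLin, Matrix.det_diagonal]
  simp [Fin.prod_univ_three]
  ring

lemma norm_sq_stretch (ε : ℝ) (x : E3) :
    ‖stretch ε x‖ ^ 2 = (ε⁻¹) ^ 2 * rad x ^ 2 + x 2 ^ 2 := by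
  rw [norm_sq_eq, rad_sq, rad_sq, stretch_apply]
  simp
  ring

lemma integral_comp_stretch {ε : ℝ} (hε : ε ≠ 0) {g : E3 → ℝ} (hg : Integrable g volume) :
    Integrable (fun x => g (stretch ε x)) volume ∧
      ∫ x, g (stretch ε x) = ε ^ 2 * ∫ x, g x := by
  have hdet : LinearMap.det (stretch ε) ≠ 0 := by rw [det_stretch]; positivity
  have hmap := Measure.map_linearMap_addHaar_eq_smul_addHaar (volume : Measure E3) hdet
  rw [det_stretch, inv_inv, abs_of_nonneg (sq_nonneg ε)] at hmap
  have hm : AEMeasurable (stretch ε) (volume : Measure E3) :=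
    (LinearMap.continuous_of_finiteDimensional (stretch ε)).aemeasurable
  have hgi : Integrable g (Measure.map (stretch ε) volume) := by
    rw [hmap]; exact hg.smul_measure ENNReal.ofReal_ne_top
  refine ⟨(integrable_map_measure hgi.1 hm).1 hgi, ?_⟩
  rw [← integral_map hm hgi.1, hmap, integral_smul_measure, ENNReal.toReal_ofReal (sq_nonneg ε)]
  rfl

/-- A majorant for the gradients of the cutoff functions of the axis. -/
def axisMajorant (ε : ℝ) (x : E3) : ℝ := 2 * ε⁻¹ * (1 + ‖stretch ε x‖ ^ 2)⁻¹

/-- The factor `ε⁻²` from squaring cancels the Jacobian `ε²`, since only two directions are dilated,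
so the `L²` norm does not depend on `ε`. The profile is integrable because its decay exponent 4
exceeds the dimension 3. -/
lemma axisMajorant_sq {ε : ℝ} (hε : 0 < ε) :
    MemLp (axisMajorant ε) 2 volume ∧
      ∫ x, axisMajorant ε x ^ 2 = 4 * ∫ x : E3, ((1 + ‖x‖ ^ 2)⁻¹) ^ 2 := by
  have hg : Integrable (fun x : E3 => ((1 + ‖x‖ ^ 2)⁻¹) ^ 2) volume := by
    have := integrable_rpow_neg_one_add_norm_sq (μ := (volume : Measure E3)) (r := 4)
      (by simp; norm_num)
    refine this.congr (ae_of_all _ fun x => ?_)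
    simp only
    rw [show (-4 / 2 : ℝ) = -((2 : ℕ) : ℝ) by norm_num, Real.rpow_neg (by positivity),
      Real.rpow_natCast, inv_pow]
  obtain ⟨h1, h2⟩ := integral_comp_stretch hε.ne' hg
  have e : ∀ x, axisMajorant ε x ^ 2
      = 4 * (ε⁻¹) ^ 2 * ((1 + ‖stretch ε x‖ ^ 2)⁻¹) ^ 2 := by
    intro x; unfold axisMajorant; ring
  have hc : Continuous (axisMajorant ε) := by
    unfold axisMajorant
    have := LinearMap.continuous_of_finiteDimensional (stretch ε)
    refine continuous_const.mul (Continuous.inv₀ (by fun_prop) fun x => by positivity)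
  constructor
  · rw [memLp_two_iff_integrable_sq hc.aestronglyMeasurable]
    simp_rw [e]
    exact h1.const_mul _
  · simp_rw [e]
    rw [integral_const_mul, h2]
    field_simp

lemma axisMajorant_nonneg {ε : ℝ} (hε : 0 < ε) (x : E3) : 0 ≤ axisMajorant ε x := by
  unfold axisMajorant; positivity

lemma axisMajorant_eq {ε : ℝ} (hε : 0 < ε) (x : E3) :
    axisMajorant ε x = 2 * ε / (ε ^ 2 + rad x ^ 2 + ε ^ 2 * x 2 ^ 2) := by
  unfold axisMajorant
  rw [norm_sq_stretch]
  have h1 : (0 : ℝ) < 1 + (ε⁻¹ ^ 2 * rad x ^ 2 + x 2 ^ 2) := by positivity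
  have h2 : (0 : ℝ) < ε ^ 2 + rad x ^ 2 + ε ^ 2 * x 2 ^ 2 := by positivity
  field_simp
  ring

lemma tendsto_axisMajorant {x : E3} (hx : rad x ≠ 0) :
    Tendsto (fun n => axisMajorant (epsSeq n) x) atTop (𝓝 0) := by
  simp_rw [axisMajorant_eq (epsSeq_pos _)]
  have hc : ContinuousAt (fun ε : ℝ => 2 * ε / (ε ^ 2 + rad x ^ 2 + ε ^ 2 * x 2 ^ 2)) 0 := by
    refine ContinuousAt.div (by fun_prop) (by fun_prop) ?_
    simpa using hx
  have := hc.tendsto.comp tendsto_epsSeq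
  simpa [Function.comp_def] using this

/-- A smooth function vanishing on the axis and tending to one away from it. -/
def axisCutoff (ε : ℝ) (x : E3) : ℝ := 1 - ε ^ 2 * ((radReg ε x)⁻¹ * (radReg ε x)⁻¹)

lemma contDiff_axisCutoff {ε : ℝ} (hε : ε ≠ 0) : ContDiff ℝ (⊤ : ℕ∞) (axisCutoff ε) :=
  contDiff_const.sub (contDiff_const.mul ((contDiff_inv_radReg hε).mul (contDiff_inv_radReg hε)))

lemma axisCutoff_eq {ε : ℝ} (hε : ε ≠ 0) (x : E3) :
    axisCutoff ε x = rad x ^ 2 * (radReg ε x)⁻¹ ^ 2 := by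
  unfold axisCutoff
  have hp := (radReg_pos hε x).ne'
  have h1 := radReg_sq ε x
  rw [← rad_sq] at h1
  field_simp
  linarith

lemma axisCutoff_nonneg {ε : ℝ} (hε : ε ≠ 0) (x : E3) : 0 ≤ axisCutoff ε x := by
  rw [axisCutoff_eq hε]; positivity

lemma axisCutoff_le_one {ε : ℝ} (x : E3) : axisCutoff ε x ≤ 1 := by
  unfold axisCutoff
  have := mul_nonneg (sq_nonneg ε) (mul_self_nonneg ((radReg ε x)⁻¹))
  linarith

lemma partialDeriv_axisCutoff {ε : ℝ} (hε : ε ≠ 0) (i : Fin 3) (x : E3) :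
    partialDeriv i (axisCutoff ε) x = 2 * ε ^ 2 * horiz i x / radReg ε x ^ 4 := by
  have hd := (contDiff_inv_radReg hε).differentiable (by simp) x
  have h1 := partialDeriv_mul i hd hd
  rw [partialDeriv_inv_radReg hε] at h1
  have h2 : HasFDerivAt (fun x => (radReg ε x)⁻¹ * (radReg ε x)⁻¹)
    (fderiv ℝ (fun x => (radReg ε x)⁻¹ * (radReg ε x)⁻¹) x) x := (hd.mul hd).hasFDerivAt
  have h3 := ((h2.const_mul (ε ^ 2)).const_sub 1).fderiv
  unfold partialDeriv at h1 ⊢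
  rw [show axisCutoff ε = fun x => 1 - ε ^ 2 * ((radReg ε x)⁻¹ * (radReg ε x)⁻¹) from rfl, h3]
  simp only [_root_.neg_apply, _root_.smul_apply, smul_eq_mul, h1]
  have hp := (radReg_pos hε x).ne'
  field_simp
  ring

/-- The derivative is at most `2ε / (r² + ε²)`. The factor `1 + x 2 ^ 2` makes up for the decay of
the majorant along the axis and will be absorbed by a compactly supported function. -/
lemma abs_partialDeriv_axisCutoff_le {ε : ℝ} (hε : 0 < ε) (i : Fin 3) (x : E3) :
    |partialDeriv i (axisCutoff ε) x| ≤ (1 + x 2 ^ 2) * axisMajorant ε x := by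
  rw [partialDeriv_axisCutoff hε.ne', axisMajorant_eq hε]
  have hs := radReg_pos hε.ne' x
  have hsq := radReg_sq ε x
  rw [← rad_sq] at hsq
  have hh := abs_horiz_le i x
  have hr := rad_nonneg x
  have hsr : rad x ≤ radReg ε x := rad_le_radReg ε x
  have hse : ε ≤ radReg ε x := by
    refine le_of_sq_le_sq ?_ hs.le
    rw [hsq]
    nlinarith
  rw [abs_div, abs_mul, abs_of_pos (by positivity : 0 < 2 * ε ^ 2),
    abs_of_pos (by positivity : 0 < radReg ε x ^ 4), ← mul_div_assoc,
    div_le_div_iff₀ (by positivity) (by positivity)]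
  have h1 : ε ^ 2 + rad x ^ 2 + ε ^ 2 * x 2 ^ 2 ≤ radReg ε x ^ 2 * (1 + x 2 ^ 2) := by
    rw [hsq]
    nlinarith [mul_nonneg (sq_nonneg (rad x)) (sq_nonneg (x 2))]
  have h2 : ε * |horiz i x| ≤ radReg ε x ^ 2 := by
    rw [sq]
    exact mul_le_mul hse (hh.trans hsr) (abs_nonneg _) hs.le
  calc 2 * ε ^ 2 * |horiz i x| * (ε ^ 2 + rad x ^ 2 + ε ^ 2 * x 2 ^ 2)
      ≤ 2 * ε ^ 2 * |horiz i x| * (radReg ε x ^ 2 * (1 + x 2 ^ 2)) := by gcongr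
    _ = 2 * ε * (radReg ε x ^ 2 * (1 + x 2 ^ 2)) * (ε * |horiz i x|) := by ring
    _ ≤ 2 * ε * (radReg ε x ^ 2 * (1 + x 2 ^ 2)) * radReg ε x ^ 2 := by gcongr
    _ = _ := by ring

lemma tendsto_axisCutoff {x : E3} (hx : rad x ≠ 0) :
    Tendsto (fun n => axisCutoff (epsSeq n) x) atTop (𝓝 1) := by
  simp_rw [axisCutoff_eq (epsSeq_ne_zero _)]
  have := (((tendsto_radReg x).inv₀ hx).pow 2).const_mul (rad x ^ 2)
  convert this using 2
  field_simp

/-- The cutoff equals `r² / (r² + ε²)`, so after division by `r` it is at most `r / ε²`, which is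
bounded on the support of `φ`. -/
lemma axisL2_axisCutoff_smul {ε : ℝ} (hε : 0 < ε) {φ : E3 → E3} (hφ : IsTest φ) :
    AxisL2 (fun x => axisCutoff ε x • φ x) := by
  have hc : Continuous fun x => ((ε ^ 2)⁻¹ * rad x) • φ x :=
    (continuous_const.mul continuous_rad).smul hφ.continuous
  have hm : MemLp (fun x => ((ε ^ 2)⁻¹ * rad x) • φ x) 2 volume :=
    hc.memLp_of_hasCompactSupport
      (HasCompactSupport.smul_left (f := fun x => (ε ^ 2)⁻¹ * rad x) hφ.2)
  have hs : AEStronglyMeasurable (fun x => axisCutoff ε x • φ x) volume :=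
    (hφ.smul_left (contDiff_axisCutoff (ne_of_gt hε))).continuous.aestronglyMeasurable
  have hi : AEStronglyMeasurable (fun x : E3 => (rad x)⁻¹) volume :=
    measurable_rad.inv.aestronglyMeasurable
  have hm' : AEStronglyMeasurable (fun x => (rad x)⁻¹ • (axisCutoff ε x • φ x)) volume :=
    hi.smul hs
  refine hm.mono hm' ?_
  filter_upwards [ae_rad_ne_zero] with x hx
  have hr : 0 < rad x := lt_of_le_of_ne (rad_nonneg x) hx.symm
  have hs := radReg_pos hε.ne' x
  rw [smul_smul, norm_smul, norm_smul]
  gcongr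
  rw [axisCutoff_eq hε.ne', Real.norm_of_nonneg (by positivity),
    Real.norm_of_nonneg (by positivity)]
  have hse : ε ^ 2 ≤ radReg ε x ^ 2 := by
    rw [radReg_sq]
    nlinarith [sq_nonneg (x 0), sq_nonneg (x 1)]
  have h1 : (radReg ε x)⁻¹ ^ 2 ≤ (ε ^ 2)⁻¹ := by
    rw [inv_pow]; exact inv_anti₀ (by positivity) hse
  calc (rad x)⁻¹ * (rad x ^ 2 * (radReg ε x)⁻¹ ^ 2) = rad x * (radReg ε x)⁻¹ ^ 2 := by field_simp
    _ ≤ rad x * (ε ^ 2)⁻¹ := by gcongr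
    _ = (ε ^ 2)⁻¹ * rad x := by ring

lemma tendsto_integral_inner_axisCutoff {a φ : E3 → E3}
    (hi : Integrable (fun x => inner ℝ (a x) (φ x)) volume) :
    Tendsto (fun n => ∫ x, inner ℝ (a x) (axisCutoff (epsSeq n) x • φ x)) atTop
      (𝓝 (∫ x, inner ℝ (a x) (φ x))) := by
  simp_rw [inner_smul_right]
  refine tendsto_integral_of_dominated_convergence (fun x => ‖inner ℝ (a x) (φ x)‖)
    (fun n => (contDiff_axisCutoff (epsSeq_ne_zero n)).continuous.aestronglyMeasurable.mul hi.1)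
    hi.norm (fun n => ae_of_all _ fun x => ?_) ?_
  · rw [norm_mul, Real.norm_of_nonneg (axisCutoff_nonneg (epsSeq_ne_zero n) x)]
    exact mul_le_of_le_one_left (norm_nonneg _) (axisCutoff_le_one x)
  · filter_upwards [ae_rad_ne_zero] with x hx
    simpa using (tendsto_axisCutoff hx).mul_const (inner ℝ (a x) (φ x))

/-- The axis has zero capacity. -/
lemma tendsto_integral_inner_partialDeriv_axisCutoff {a φ : E3 → E3} (ha : MemLp a 2 volume)
    (hφ : IsTest φ) (i : Fin 3) :
    Tendsto (fun n => ∫ x, inner ℝ (a x) (partialDeriv i (axisCutoff (epsSeq n)) x • φ x)) atTop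
      (𝓝 0) := by
  have hψ : IsTest fun x : E3 => (1 + x 2 ^ 2) • φ x :=
    hφ.smul_left (contDiff_const.add ((contDiff_apply_coord 2).pow 2))
  obtain ⟨M, hM⟩ := hψ.2.exists_bound_of_continuous hψ.continuous
  have hM0 : 0 ≤ M := (norm_nonneg _).trans (hM 0)
  have hT := fun n => axisMajorant_sq (epsSeq_pos n)
  -- The majorants keep a constant `L²` norm, so they do not tend to zero in `L²`. Against the fixed
  -- `a ∈ L²`, boundedness with convergence to zero almost everywhere is enough.
  have key := tendsto_integral_mul_of_bounded ha.norm (fun x => norm_nonneg _)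
    (fun n x => axisMajorant_nonneg (epsSeq_pos n) x) (fun n => (hT n).1)
    (fun n => (hT n).2.le) (by
      filter_upwards [ae_rad_ne_zero] with x hx using tendsto_axisMajorant hx)
  have key2 := key.const_mul M
  rw [mul_zero] at key2
  refine squeeze_zero_norm (fun n => ?_) key2
  rw [← integral_const_mul]
  refine norm_integral_le_of_norm_le
    ((integrable_mul_of_memLp ha.norm (hT n).1).const_mul M) (ae_of_all _ fun x => ?_)
  have h1 := abs_partialDeriv_axisCutoff_le (epsSeq_pos n) i x
  have h2 := hM x
  rw [norm_smul, Real.norm_of_nonneg (by positivity)] at h2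
  have h3 := axisMajorant_nonneg (epsSeq_pos n) x
  refine (norm_inner_le_norm _ _).trans ?_
  rw [norm_smul, Real.norm_eq_abs]
  calc ‖a x‖ * (|partialDeriv i (axisCutoff (epsSeq n)) x| * ‖φ x‖)
      ≤ ‖a x‖ * (((1 + x 2 ^ 2) * axisMajorant (epsSeq n) x) * ‖φ x‖) := by gcongr
    _ = ‖a x‖ * axisMajorant (epsSeq n) x * ((1 + x 2 ^ 2) * ‖φ x‖) := by ring
    _ ≤ ‖a x‖ * axisMajorant (epsSeq n) x * M := by gcongr
    _ = M * (‖a x‖ * axisMajorant (epsSeq n) x) := by ring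

end Capacity

/-! ### Passing to all directions; equivalence of the two equations. -/

section Main

/-- The first variation of the vector energy at a divergence free field. -/
lemma firstE_eq_sum {h : E3 → E3 → E3}
    {U V : E3 → E3} {A B : Fin 3 → E3 → E3} (hU : HasWeakGrad U A)
    (hdiv : ∀ᵐ x, A 0 x 0 + A 1 x 1 + A 2 x 2 = 0) (hV : HasWeakGrad V B) :
    firstE h U A V B = (∑ i, ∫ x, inner ℝ (A i x) (B i x)) - ∫ x, inner ℝ (h x (U x)) (V x) := by
  unfold firstE formE
  rw [integral_inner_curlOf hU hV hdiv, integral_finsetSum]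
  exact fun i _ => integrable_inner_of_memLp (hU.2 i).2 (hV.2 i).2

/-- The first variation at a divergence free field vanishes if it vanishes on all fields with
`V / r ∈ L²`. -/
lemma firstE_eq_zero {C : ℝ} {f : E3 → ℝ → ℝ} {h : E3 → E3 → E3} (H : NonlinPair C f h)
    {U : E3 → E3} {A : Fin 3 → E3 → E3} (hU : HasWeakGrad U A)
    (hdiv : ∀ᵐ x, A 0 x 0 + A 1 x 1 + A 2 x 2 = 0)
    (h0 : ∀ V B, HasWeakGrad V B → AxisL2 V → firstE h U A V B = 0)
    {V : E3 → E3} {B : Fin 3 → E3 → E3} (hV : HasWeakGrad V B) : firstE h U A V B = 0 := by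
  have hhU := H.memLp_vec hU.1
  -- A test field is multiplied by the axis cutoff, which makes it admissible for the hypothesis. In
  -- the limit the term with the derivative of the cutoff disappears.
  have htest : ∀ φ : E3 → E3, IsTest φ → firstE h U A φ (fun i => partialDeriv i φ) = 0 := by
    intro φ hφ
    have hg : ∀ n, HasWeakGrad (fun x => axisCutoff (epsSeq n) x • φ x) (fun i x =>
        partialDeriv i (axisCutoff (epsSeq n)) x • φ x
          + axisCutoff (epsSeq n) x • partialDeriv i φ x) := by
      intro n
      have hη := contDiff_axisCutoff (epsSeq_ne_zero n)
      refine (hφ.smul_left hη).hasWeakGrad.congr (ae_eq_refl _) fun i => ae_of_all _ fun x => ?_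
      exact partialDeriv_smul i (hη.differentiable (by simp) x) (hφ.differentiable x)
    have hz := fun n => h0 _ _ (hg n) (axisL2_axisCutoff_smul (epsSeq_pos n) hφ)
    have l1 : ∀ i, Tendsto (fun n => ∫ x, inner ℝ (A i x)
        (partialDeriv i (axisCutoff (epsSeq n)) x • φ x
          + axisCutoff (epsSeq n) x • partialDeriv i φ x)) atTop
        (𝓝 (∫ x, inner ℝ (A i x) (partialDeriv i φ x))) := by
      intro i
      have a1 := tendsto_integral_inner_partialDeriv_axisCutoff (hU.2 i).2 hφ i
      have a2 := tendsto_integral_inner_axisCutoff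
        (integrable_inner_of_memLp (hU.2 i).2 ((hφ.partialDeriv i).memLp 2))
      have a3 := a1.add a2
      rw [zero_add] at a3
      refine a3.congr fun n => ?_
      have hη := contDiff_axisCutoff (epsSeq_ne_zero n)
      simp_rw [inner_add_right]
      exact (integral_add (integrable_inner_of_memLp (hU.2 i).2
        ((hφ.smul_left (contDiff_partialDeriv hη i)).memLp 2)) (integrable_inner_of_memLp
        (hU.2 i).2 (((hφ.partialDeriv i).smul_left hη).memLp 2))).symm
    have l2 := tendsto_integral_inner_axisCutoff
      (integrable_inner_of_memLp hhU (hφ.memLp 6))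
    have l3 := (tendsto_finsetSum Finset.univ fun i _ => l1 i).sub l2
    rw [firstE_eq_sum hU hdiv hφ.hasWeakGrad]
    refine tendsto_nhds_unique l3 (tendsto_const_nhds.congr fun n => ?_)
    rw [← firstE_eq_sum hU hdiv (hg n), hz n]
  -- A general direction follows by density: at a fixed `U` the variation is continuous in the `L²`
  -- norm of the gradient and the `L⁶` norm.
  obtain ⟨φ, hφ, h6, h2⟩ := hV.exists_seq
  have l1 := fun i => tendsto_integral_inner (hU.2 i).2 (hV.2 i).2
    (fun n => ((hφ n).partialDeriv i).memLp 2) (h2 i)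
  have l2 := tendsto_integral_inner hhU hV.1 (fun n => (hφ n).memLp 6) h6
  have l3 := (tendsto_finsetSum Finset.univ fun i _ => l1 i).sub l2
  rw [firstE_eq_sum hU hdiv hV]
  refine tendsto_nhds_unique l3 (tendsto_const_nhds.congr fun n => ?_)
  rw [← firstE_eq_sum hU hdiv (hφ n).hasWeakGrad, htest _ (hφ n)]

/-- The equations for an invariant amplitude and for its azimuthal field are equivalent. -/
theorem NonlinPair.isSolution_iff {C : ℝ} {f : E3 → ℝ → ℝ} {h : E3 → E3 → E3}
    (H : NonlinPair C f h) {u : E3 → ℝ} (hu : u ∈ spaceXO) {U : E3 → E3}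
    (hU : U =ᵐ[volume] tauField u) : IsSolutionS 1 f u ↔ IsSolutionV h U := by
  obtain ⟨hX, hinv⟩ := hu
  obtain ⟨hD, hur⟩ := mem_spaceX_iff.1 hX
  have hg := hD.hasWeakGrad
  have hgU := (hg.tauField hur).congr hU.symm fun i => ae_eq_refl _
  have hfirst : ∀ V B, firstE h U (tauFieldGrad u fun i => weakPartial i u) V B
      = firstE h (tauField u) (tauFieldGrad u fun i => weakPartial i u) V B := by
    intro V B
    unfold firstE
    congr 1
    refine integral_congr_ae ?_
    filter_upwards [hU] with x hx
    rw [hx]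
  rw [H.isSolutionS_iff hg hur, H.isSolutionV_iff hgU]
  constructor
  · intro h0 V B hV
    -- It suffices to treat `V / r ∈ L²`, where `τ · V` is an admissible scalar direction. It need
    -- not be invariant, which is why criticality in all of `X` is used.
    refine firstE_eq_zero H hgU (hinv.div_tauFieldGrad hg) (fun V B hV hVr => ?_) hV
    rw [hfirst, H.firstE_eq hinv hg hur hV hVr]
    exact h0 _ _ (hV.tauComp hVr) (hVr.tauComp hV.1.1)
  · intro h0 v z hv hvr
    obtain ⟨e1, e2⟩ := hv.tauComp_tauField hvr
    rw [← firstJ_congr e1 e2, ← H.firstE_eq hinv hg hur (hv.tauField hvr) (hvr.tauField hv),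
      ← hfirst]
    exact h0 _ _ (hv.tauField hvr)

end Main

end CurlCurl
end

/-! ### The correspondence theorem. -/

theorem theorem2p1
    (f : CurlCurl.E3 → ℝ → ℝ) (hf : CurlCurl.CondF1 f)
    (hgrowth : ∃ C > 0, ∀ᵐ x : CurlCurl.E3, ∀ s : ℝ, |f x s| ≤ C * |s| ^ 5)
    (h : CurlCurl.E3 → CurlCurl.E3 → CurlCurl.E3)
    (hh : ∀ᵐ x : CurlCurl.E3, ∀ (α : ℝ) (w : CurlCurl.E3), ‖w‖ = 1 → h x (α • w) = f x α • w)
    (U : CurlCurl.E3 → CurlCurl.E3) (u : CurlCurl.E3 → ℝ)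
    (hU : ∀ᵐ x : CurlCurl.E3, U x = (u x / CurlCurl.rad x) • CurlCurl.rot x) :
    (U ∈ CurlCurl.spaceDF ↔ u ∈ CurlCurl.spaceXO) ∧
    (U ∈ CurlCurl.spaceDF →
      CurlCurl.DivFree U ∧ CurlCurl.energyJ 1 f u = CurlCurl.energyE h U) ∧
    ((u ∈ CurlCurl.spaceXO ∧ CurlCurl.IsSolutionS 1 f u) ↔
      (U ∈ CurlCurl.spaceDF ∧ CurlCurl.IsSolutionV h U)) := by
  obtain ⟨C, hC, hb⟩ := hgrowth
  have H : CurlCurl.NonlinPair C f h := by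
    refine ⟨hf, hC.le, ?_⟩
    filter_upwards [hf.continuous, hb, hh] with x h1 h2 h3
    exact ⟨h1, hC.le, h2, h3⟩
  have hU' : U =ᵐ[volume] CurlCurl.tauField u := hU
  have hiff := CurlCurl.mem_spaceDF_iff hU'
  refine ⟨hiff, fun hDF => ?_, ?_⟩
  · obtain ⟨hX, hinv⟩ := hiff.1 hDF
    obtain ⟨hD, hur⟩ := CurlCurl.mem_spaceX_iff.1 hX
    exact ⟨hinv.divFree hD.hasWeakGrad hur hU', H.energy_eq hinv hD.hasWeakGrad hur hU'⟩
  · rw [hiff]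
    exact and_congr_right fun hu => H.isSolution_iff hu hU'
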